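/- All algebras are associative algebras over $\mathbb C$, with or without identity. A product on $A$ is non-degenerate if $ab=0$ for all $b$ implies $a=0$, and $ab=0$ for all $a$ implies $b=0$. $M(A)$ is the multiplier algebra, i.e. the algebra of pairs $(L,R)$ of linear maps $A\to A$ with $L(ab)=L(a)b$, $R(ab)=aR(b)$, $R(a)b=aL(b)$, and $A$ is identified with its image in $M(A)$. A multiplier Hopf algebra is a pair $(A,\Delta)$ of an algebra $A$ with non-degenerate product and a homomorphism $\Delta:A\to M(A\otimes A)$ such that $\Delta(a)(1\otimes b)$ and $(a\otimes 1)\Delta(b)$ belong to $A\otimes A$, such that $(c\otimes1\otimes1)(\Delta\otimes\iota)(\Delta(a)(1\otimes b))=(\iota\otimes\Delta)((c\otimes1)\Delta(a))(1\otimes1\otimes b)$, and such that $a\otimes b\mapsto\Delta(a)(1\otimes b)$ and $a\otimes b\mapsto(a\otimes1)\Delta(b)$ are bijections of $A\otimes A$. It is regular if $(A,\Delta^{\rm op})$ is also a multiplier Hopf algebra. Its counit is a homomorphism $\varepsilon:A\to\mathbb C$ with $(\varepsilon\otimes\iota)(\Delta(a)(1\otimes b))=ab=(\iota\otimes\varepsilon)((a\otimes1)\Delta(b))$,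 and its antipode is an anti-homomorphism $S:A\to M(A)$ with $m((S\otimes\iota)(\Delta(a)(1\otimes b)))=\varepsilon(a)b=m((\iota\otimes S)((b\otimes1)\Delta(a)))$. For a group $G$, $(A,\Delta)$ is $G$-cograded by non-zero subalgebras $(A_p)_{p\in G}$ if $A=\bigoplus_pA_p$, $A_pA_q=0$ for $p\ne q$, and $\Delta(A_{pq})(1\otimes A_q)=A_p\otimes A_q=(A_p\otimes1)\Delta(A_{pq})$ (linear spans) for all $p,q$. **Theorem.** Let $G$ be a group with identity $e$. Consider a family $(A_p)_{p\in G}$ of algebras with non-degenerate products, with the following data. (i) Homomorphisms $\Delta_{p,q}:A_{pq}\to M(A_p\otimes A_q)$ for $p,q\in G$ such that $\Delta_{p,q}(A_{pq})(1\otimes A_q)$, $(A_p\otimes1)\Delta_{p,q}(A_{pq})$, $(1\otimes A_q)\Delta_{p,q}(A_{pq})$ and $\Delta_{p,q}(A_{pq})(A_p\otimes1)$ are contained in $A_p\otimes A_q$, and $$(c\otimes1\otimes1)\bigl((\Delta_{p,q}\otimes\iota)(\Delta_{pq,r}(a)(1\otimes b))\bigr)=\bigl((\iota\otimes\Delta_{q,r})((c\otimes1)\Delta_{p,qr}(a))\bigr)(1\otimes1\otimes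 b)$$ for all $a\in A_{pqr}$, $b\in A_r$, $c\in A_p$. (ii) A homomorphism $\varepsilon_e:A_e\to\mathbb C$ with $(\iota\otimes\varepsilon_e)((a\otimes1)\Delta_{p,e}(b))=ab$ and $(\varepsilon_e\otimes\iota)(\Delta_{e,p}(a)(1\otimes b))=ab$ for all $p\in G$ and $a,b\in A_p$. (iii) Anti-isomorphisms $S_p:A_p\to A_{p^{-1}}$ for $p\in G$ with $m(S_{p^{-1}}\otimes\iota)(\Delta_{p^{-1},p}(a)(1\otimes b))=\varepsilon_e(a)b$ and $m(\iota\otimes S_{p^{-1}})((b\otimes1)\Delta_{p,p^{-1}}(a))=\varepsilon_e(a)b$ for all $a\in A_e$, $b\in A_p$. (1) For every such family, let $A=\bigoplus_{p}A_p$ be the algebra of functions $a$ on $G$ with $a(p)\in A_p$ and finite support, with pointwise operations. There is a unique homomorphism $\Delta:A\to M(A\otimes A)$ with $(\Delta(a))(p,q)=\Delta_{p,q}(a(pq))$ for all $a\in A$, $p,q\in G$, and $(A,\Delta)$ is a regular multiplier Hopf algebra. The subalgebras $A_p$ of $A$ satisfy all the conditions for a $G$-cograding, except that some of them may be zero; so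 $(A,\Delta)$ is $G$-cograded by $(A_p)_{p\in G}$ if all $A_p$ are non-zero. (2) Conversely, let $(A,\Delta)$ be a regular multiplier Hopf algebra, $G$-cograded by subalgebras $(A_p)_{p\in G}$. Then $(A,\Delta)$ has a counit $\varepsilon$ and an antipode $S$, the products of the $A_p$ are non-degenerate, and the restrictions $\Delta_{p,q}$ of $\Delta$ to $A_{pq}$ (with $\Delta(a)$, for $a\in A_{pq}$, restricted to a multiplier of $A_p\otimes A_q$), $\varepsilon_e$ of $\varepsilon$ to $A_e$, and $S_p$ of $S$ to $A_p$ are well defined and satisfy (i), (ii) and (iii). (3) Suppose that all $A_p$ have an identity, so that $M(A_p\otimes A_q)=A_p\otimes A_q$. A Hopf $G$-coalgebra in the sense of Turaev on $(A_p)_{p\in G}$ consists of unital homomorphisms $\Delta_{p,q}:A_{pq}\to A_p\otimes A_q$ with $(\Delta_{p,q}\otimes\iota)\Delta_{pq,r}=(\iota\otimes\Delta_{q,r})\Delta_{p,qr}$, a unital homomorphism $\varepsilon_e:A_e\to\mathbb C$ with $(\iota\otimes\varepsilon_e)\Delta_{p,e}(a)=a=(\varepsilon_e\otimes\iota)\Delta_{e,p}(a)$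 for $a\in A_p$, and anti-isomorphisms $S_p:A_p\to A_{p^{-1}}$ with $m(S_{p^{-1}}\otimes\iota)\Delta_{p^{-1},p}(a)=\varepsilon_e(a)1=m(\iota\otimes S_{p^{-1}})\Delta_{p,p^{-1}}(a)$ for $a\in A_e$. Every Hopf $G$-coalgebra on $(A_p)$ is a system of data satisfying (i), (ii), (iii); and if $A_e\neq0$, every system of data on $(A_p)$ satisfying (i), (ii), (iii) is a Hopf $G$-coalgebra. -/

import Mathlib

open scoped TensorProduct

namespace CogradedMHA

/-! ### Algebras over `ℂ`, possibly without identity, and their multipliers -/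

section Multipliers

variable {A B C : Type*}
variable [NonUnitalRing A] [Module ℂ A] [IsScalarTower ℂ A A] [SMulCommClass ℂ A A]
variable [NonUnitalRing B] [Module ℂ B] [IsScalarTower ℂ B B] [SMulCommClass ℂ B B]
variable [NonUnitalRing C] [Module ℂ C] [IsScalarTower ℂ C C] [SMulCommClass ℂ C C]

/-- The product of `A` is non-degenerate, as a bilinear map. -/
def NondegenerateProduct (A : Type*) [NonUnitalRing A] : Prop :=
  (∀ a : A, (∀ b, a * b = 0) → a = 0) ∧ (∀ b : A, (∀ a, a * b = 0) → b = 0)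

/-- The multiplier algebra `M(A)`: the pairs `(L, R)` of a left multiplier `L` (to be thought of as
`a ↦ m a`) and a right multiplier `R` (to be thought of as `a ↦ a m`) with `R(a) b = a L(b)`. The
product is `(L, R) (L', R') = (L ∘ L', R' ∘ R)`. -/
def multiplierAlgebra (A : Type*) [NonUnitalRing A] [Module ℂ A] [IsScalarTower ℂ A A]
    [SMulCommClass ℂ A A] : Subalgebra ℂ (Module.End ℂ A × (Module.End ℂ A)ᵐᵒᵖ) where
  carrier := {m | (∀ a b, m.1 (a * b) = m.1 a * b) ∧
    (∀ a b, m.2.unop (a * b) = a * m.2.unop b) ∧ ∀ a b, m.2.unop a * b = a * m.1 b}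
  mul_mem' := by
    rintro m n ⟨hm, hm', hm''⟩ ⟨hn, hn', hn''⟩
    refine ⟨fun a b => ?_, fun a b => ?_, fun a b => ?_⟩ <;> simp [*]
  add_mem' := by
    rintro m n ⟨hm, hm', hm''⟩ ⟨hn, hn', hn''⟩
    refine ⟨fun a b => ?_, fun a b => ?_, fun a b => ?_⟩ <;> simp [*, add_mul, mul_add]
  algebraMap_mem' := by
    intro z
    refine ⟨fun a b => ?_, fun a b => ?_, fun a b => ?_⟩ <;>
      simp [Algebra.algebraMap_eq_smul_one, smul_mul_assoc, mul_smul_comm]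

/-- The type of multipliers of `A`. -/
def Multiplier (A : Type*) [NonUnitalRing A] [Module ℂ A] [IsScalarTower ℂ A A]
    [SMulCommClass ℂ A A] : Type _ := ↥(multiplierAlgebra A)

instance : Ring (Multiplier A) := inferInstanceAs (Ring ↥(multiplierAlgebra A))

instance : Algebra ℂ (Multiplier A) := inferInstanceAs (Algebra ℂ ↥(multiplierAlgebra A))

namespace Multiplier

/-- `m.left a` is `m a`. -/
def left (m : Multiplier A) : A →ₗ[ℂ] A := m.1.1

/-- `m.right a` is `a m`. -/
def right (m : Multiplier A) : A →ₗ[ℂ] A := m.1.2.unop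

theorem left_mul_apply (m : Multiplier A) (a b : A) : m.left (a * b) = m.left a * b := m.2.1 a b

theorem right_mul_apply (m : Multiplier A) (a b : A) : m.right (a * b) = a * m.right b :=
  m.2.2.1 a b

theorem right_mul_eq (m : Multiplier A) (a b : A) : m.right a * b = a * m.left b := m.2.2.2 a b

@[ext]
theorem ext {m n : Multiplier A} (hl : ∀ a, m.left a = n.left a)
    (hr : ∀ a, m.right a = n.right a) : m = n :=
  Subtype.ext (Prod.ext (LinearMap.ext hl) (MulOpposite.unop_injective (LinearMap.ext hr)))

/-- The multiplier with given left and right actions. -/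
def mk (L R : A →ₗ[ℂ] A) (hl : ∀ a b, L (a * b) = L a * b) (hr : ∀ a b, R (a * b) = a * R b)
    (h : ∀ a b, R a * b = a * L b) : Multiplier A :=
  ⟨(L, MulOpposite.op R), hl, hr, h⟩

@[simp] theorem left_mk (L R : A →ₗ[ℂ] A) (hl hr h) : (mk L R hl hr h).left = L := rfl
@[simp] theorem right_mk (L R : A →ₗ[ℂ] A) (hl hr h) : (mk L R hl hr h).right = R := rfl
@[simp] theorem left_one : (1 : Multiplier A).left = LinearMap.id := rfl
@[simp] theorem right_one : (1 : Multiplier A).right = LinearMap.id := rfl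
@[simp] theorem left_mul (m n : Multiplier A) : (m * n).left = m.left ∘ₗ n.left := rfl
@[simp] theorem right_mul (m n : Multiplier A) : (m * n).right = n.right ∘ₗ m.right := rfl
@[simp] theorem left_add (m n : Multiplier A) : (m + n).left = m.left + n.left := rfl
@[simp] theorem right_add (m n : Multiplier A) : (m + n).right = m.right + n.right := rfl
@[simp] theorem left_smul (z : ℂ) (m : Multiplier A) : (z • m).left = z • m.left := rfl
@[simp] theorem right_smul (z : ℂ) (m : Multiplier A) : (z • m).right = z • m.right := rfl
@[simp] theorem left_zero : (0 : Multiplier A).left = 0 := rfl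
@[simp] theorem right_zero : (0 : Multiplier A).right = 0 := rfl

/-- The canonical map `A → M(A)`; it is injective if the product is non-degenerate. -/
def incl (a : A) : Multiplier A :=
  mk (LinearMap.mulLeft ℂ a) (LinearMap.mulRight ℂ a)
    (fun b c => by simp [mul_assoc]) (fun b c => by simp [mul_assoc])
    (fun b c => by simp [mul_assoc])

@[simp] theorem left_incl (a b : A) : (incl a).left b = a * b := rfl
@[simp] theorem right_incl (a b : A) : (incl a).right b = b * a := rfl

/-- The canonical map `A → M(A)` as a homomorphism of algebras. -/
def inclHom : A →ₙₐ[ℂ] Multiplier A where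
  toFun := incl
  map_smul' z a := by ext b <;> simp [smul_mul_assoc, mul_smul_comm]
  map_zero' := by ext b <;> simp
  map_add' a b := by ext c <;> simp [add_mul, mul_add]
  map_mul' a b := by ext c <;> simp [mul_assoc]

/-- The multiplier `m ⊗ n` of `A ⊗ B`, for `m ∈ M(A)` and `n ∈ M(B)`. -/
def tmul (m : Multiplier A) (n : Multiplier B) : Multiplier (A ⊗[ℂ] B) :=
  mk (TensorProduct.map m.left n.left) (TensorProduct.map m.right n.right)
    (fun x y => by
      induction x with
      | zero => simp
      | add x x' hx hx' => simp [add_mul, hx, hx']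
      | tmul a b =>
        induction y with
        | zero => simp
        | add y y' hy hy' => simp [mul_add, hy, hy']
        | tmul c d => simp [left_mul_apply])
    (fun x y => by
      induction x with
      | zero => simp
      | add x x' hx hx' => simp [add_mul, hx, hx']
      | tmul a b =>
        induction y with
        | zero => simp
        | add y y' hy hy' => simp [mul_add, hy, hy']
        | tmul c d => simp [right_mul_apply])
    (fun x y => by
      induction x with
      | zero => simp
      | add x x' hx hx' => simp [add_mul, hx, hx']
      | tmul a b =>
        induction y with
        | zero => simp
        | add y y' hy hy' => simp only [mul_add, map_add, hy, hy']
        | tmul c d => simp [right_mul_eq])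

/-- The canonical linear map `M(A) ⊗ M(B) → M(A ⊗ B)`. -/
def ofTensor : Multiplier A ⊗[ℂ] Multiplier B →ₗ[ℂ] Multiplier (A ⊗[ℂ] B) :=
  TensorProduct.lift <| LinearMap.mk₂ ℂ tmul
    (fun m m' n => by ext x <;> simp [tmul, TensorProduct.map_add_left])
    (fun z m n => by ext x <;> simp [tmul, TensorProduct.map_smul_left])
    (fun m n n' => by ext x <;> simp [tmul, TensorProduct.map_add_right])
    (fun z m n => by ext x <;> simp [tmul, TensorProduct.map_smul_right])

/-- The element `a ⊗ 1` of `M(A ⊗ B)`. -/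
def tmulOne (B : Type*) [NonUnitalRing B] [Module ℂ B] [IsScalarTower ℂ B B] [SMulCommClass ℂ B B]
    (a : A) : Multiplier (A ⊗[ℂ] B) := tmul (incl a) 1

/-- The element `1 ⊗ b` of `M(A ⊗ B)`. -/
def oneTmul (A : Type*) [NonUnitalRing A] [Module ℂ A] [IsScalarTower ℂ A A] [SMulCommClass ℂ A A]
    (b : B) : Multiplier (A ⊗[ℂ] B) := tmul 1 (incl b)

/-- The homomorphism `M(A) → M(B)` induced by an isomorphism of algebras `A ≅ B`. -/
def congr (e : A ≃ₗ[ℂ] B) (he : ∀ x y, e (x * y) = e x * e y) : Multiplier A →ₙₐ[ℂ] Multiplier B :=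
  have he' : ∀ x y, e.symm (x * y) = e.symm x * e.symm y := fun x y => by
    rw [LinearEquiv.symm_apply_eq, he]; simp
  { toFun := fun m => mk (e.toLinearMap ∘ₗ m.left ∘ₗ e.symm.toLinearMap)
      (e.toLinearMap ∘ₗ m.right ∘ₗ e.symm.toLinearMap)
      (fun x y => by simp [he, he', left_mul_apply])
      (fun x y => by simp [he, he', right_mul_apply])
      (fun x y => by
        have := congrArg e (m.right_mul_eq (e.symm x) (e.symm y))
        simpa [he] using this)
    map_smul' := fun z m => by ext x <;> simp
    map_zero' := by ext x <;> simp
    map_add' := fun m n => by ext x <;> simp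
    map_mul' := fun m n => by ext x <;> simp }

/-- The identification of `M((A ⊗ B) ⊗ C)` with `M(A ⊗ (B ⊗ C))`. -/
noncomputable def assoc (A B C : Type*)
    [NonUnitalRing A] [Module ℂ A] [IsScalarTower ℂ A A] [SMulCommClass ℂ A A]
    [NonUnitalRing B] [Module ℂ B] [IsScalarTower ℂ B B] [SMulCommClass ℂ B B]
    [NonUnitalRing C] [Module ℂ C] [IsScalarTower ℂ C C] [SMulCommClass ℂ C C] :
    Multiplier ((A ⊗[ℂ] B) ⊗[ℂ] C) →ₙₐ[ℂ] Multiplier (A ⊗[ℂ] (B ⊗[ℂ] C)) :=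
  congr (TensorProduct.assoc ℂ A B C) (fun x y => by
    induction x with
    | zero => simp
    | add x x' hx hx' => simp [add_mul, hx, hx']
    | tmul x c =>
      induction y with
      | zero => simp
      | add y y' hy hy' => simp [mul_add, hy, hy']
      | tmul y c' =>
        induction x with
        | zero => simp
        | add x x' hx hx' => simp only [add_mul, TensorProduct.add_tmul, map_add, hx, hx']
        | tmul a b =>
          induction y with
          | zero => simp
          | add y y' hy hy' => simp only [mul_add, TensorProduct.add_tmul, map_add, hy, hy']
          | tmul a' b' => simp)

/-- The extension of the flip `A ⊗ B → B ⊗ A` to multipliers. -/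
noncomputable def flip : Multiplier (A ⊗[ℂ] B) →ₙₐ[ℂ] Multiplier (B ⊗[ℂ] A) :=
  congr (TensorProduct.comm ℂ A B) (fun x y => by
    induction x with
    | zero => simp
    | add x x' hx hx' => simp [add_mul, hx, hx']
    | tmul a b =>
      induction y with
      | zero => simp
      | add y y' hy hy' => simp [mul_add, hy, hy']
      | tmul c d => simp)

/-- The map `M(A) ⊗ A → A`, `m ⊗ a ↦ m a`. -/
noncomputable def mulLeft : Multiplier A ⊗[ℂ] A →ₗ[ℂ] A :=
  TensorProduct.lift <| LinearMap.mk₂ ℂ (fun (m : Multiplier A) a => m.left a)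
    (by simp) (by simp) (by simp) (by simp)

/-- The map `A ⊗ M(A) → A`, `a ⊗ m ↦ a m`. -/
noncomputable def mulRight : A ⊗[ℂ] Multiplier A →ₗ[ℂ] A :=
  TensorProduct.lift <| LinearMap.mk₂ ℂ (fun a (m : Multiplier A) => m.right a)
    (by simp) (by simp) (by simp) (by simp)

end Multiplier

open Multiplier

/-- `Δ ⊗ ι : D ⊗ C → M(A ⊗ B) ⊗ C ⊆ M((A ⊗ B) ⊗ C)` for `Δ : D → M(A ⊗ B)`. -/
noncomputable def comulTensorId {D : Type*} [NonUnitalRing D] [Module ℂ D]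
    (Δ : D →ₙₐ[ℂ] Multiplier (A ⊗[ℂ] B)) :
    D ⊗[ℂ] C →ₗ[ℂ] Multiplier ((A ⊗[ℂ] B) ⊗[ℂ] C) :=
  ofTensor ∘ₗ TensorProduct.map (Δ : D →ₗ[ℂ] _) ((inclHom : C →ₙₐ[ℂ] Multiplier C) : C →ₗ[ℂ] _)

/-- `ι ⊗ Δ : A ⊗ D → A ⊗ M(B ⊗ C) ⊆ M(A ⊗ (B ⊗ C))` for `Δ : D → M(B ⊗ C)`. -/
noncomputable def idTensorComul {D : Type*} [NonUnitalRing D] [Module ℂ D]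
    (Δ : D →ₙₐ[ℂ] Multiplier (B ⊗[ℂ] C)) :
    A ⊗[ℂ] D →ₗ[ℂ] Multiplier (A ⊗[ℂ] (B ⊗[ℂ] C)) :=
  ofTensor ∘ₗ TensorProduct.map ((inclHom : A →ₙₐ[ℂ] Multiplier A) : A →ₗ[ℂ] _) (Δ : D →ₗ[ℂ] _)

end Multipliers

open Multiplier

/-! ### Multiplier Hopf algebras -/

section MultiplierHopf

variable {A : Type*} [NonUnitalRing A] [Module ℂ A] [IsScalarTower ℂ A A] [SMulCommClass ℂ A A]

/-- `(A, Δ)` is a multiplier Hopf algebra. -/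
structure IsMultiplierHopf (Δ : A →ₙₐ[ℂ] Multiplier (A ⊗[ℂ] A)) : Prop where
  nondegenerate : NondegenerateProduct A
  /-- `Δ(a)(1 ⊗ b) ∈ A ⊗ A`. -/
  comul_mul_oneTmul : ∀ a b : A, ∃ x : A ⊗[ℂ] A, incl x = Δ a * oneTmul A b
  /-- `(b ⊗ 1)Δ(a) ∈ A ⊗ A`. -/
  tmulOne_mul_comul : ∀ a b : A, ∃ x : A ⊗[ℂ] A, incl x = tmulOne A b * Δ a
  /-- `(c ⊗ 1 ⊗ 1) (Δ ⊗ ι)(Δ(a)(1 ⊗ b)) = (ι ⊗ Δ)((c ⊗ 1)Δ(a)) (1 ⊗ 1 ⊗ b)`. -/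
  coassoc : ∀ (a b c : A) (x y : A ⊗[ℂ] A),
    incl x = Δ a * oneTmul A b → incl y = tmulOne A c * Δ a →
      Multiplier.assoc A A A (tmul (tmulOne A c) 1 * comulTensorId Δ x) =
        idTensorComul Δ y * tmul 1 (oneTmul A b)
  /-- `a ⊗ b ↦ Δ(a)(1 ⊗ b)` is a bijection of `A ⊗ A`. -/
  bijective_left : ∃ T : A ⊗[ℂ] A →ₗ[ℂ] A ⊗[ℂ] A, Function.Bijective T ∧
    ∀ a b, incl (T (a ⊗ₜ b)) = Δ a * oneTmul A b
  /-- `a ⊗ b ↦ (a ⊗ 1)Δ(b)` is a bijection of `A ⊗ A`. -/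
  bijective_right : ∃ T : A ⊗[ℂ] A →ₗ[ℂ] A ⊗[ℂ] A, Function.Bijective T ∧
    ∀ a b, incl (T (a ⊗ₜ b)) = tmulOne A a * Δ b

/-- `(A, Δ)` is a regular multiplier Hopf algebra: `(A, Δ)` and `(A, Δᵒᵖ)` are multiplier Hopf
algebras. -/
def IsRegularMultiplierHopf (Δ : A →ₙₐ[ℂ] Multiplier (A ⊗[ℂ] A)) : Prop :=
  IsMultiplierHopf Δ ∧ IsMultiplierHopf (Multiplier.flip.comp Δ)

/-- `ε` is the counit of the multiplier Hopf algebra `(A, Δ)`. (The elements `x` below exist, by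
the definition of a multiplier Hopf algebra, and are unique.) -/
structure IsCounit (Δ : A →ₙₐ[ℂ] Multiplier (A ⊗[ℂ] A)) (ε : A →ₙₐ[ℂ] ℂ) : Prop where
  /-- `(ε ⊗ ι)(Δ(a)(1 ⊗ b)) = ab`. -/
  counit_left : ∀ (a b : A) (x : A ⊗[ℂ] A), incl x = Δ a * oneTmul A b →
    TensorProduct.lid ℂ A (TensorProduct.map (ε : A →ₗ[ℂ] ℂ) LinearMap.id x) = a * b
  /-- `(ι ⊗ ε)((a ⊗ 1)Δ(b)) = ab`. -/
  counit_right : ∀ (a b : A) (x : A ⊗[ℂ] A), incl x = tmulOne A a * Δ b →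
    TensorProduct.rid ℂ A (TensorProduct.map LinearMap.id (ε : A →ₗ[ℂ] ℂ) x) = a * b

/-- `S : A → M(A)` is the antipode of the multiplier Hopf algebra `(A, Δ)` with counit `ε`. -/
structure IsAntipode (Δ : A →ₙₐ[ℂ] Multiplier (A ⊗[ℂ] A)) (ε : A →ₙₐ[ℂ] ℂ)
    (S : A →ₗ[ℂ] Multiplier A) : Prop where
  antimultiplicative : ∀ a b, S (a * b) = S b * S a
  /-- `m((S ⊗ ι)(Δ(a)(1 ⊗ b))) = ε(a)b`. -/
  antipode_left : ∀ (a b : A) (x : A ⊗[ℂ] A), incl x = Δ a * oneTmul A b →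
    Multiplier.mulLeft (TensorProduct.map S LinearMap.id x) = ε a • b
  /-- `m((ι ⊗ S)((b ⊗ 1)Δ(a))) = ε(a)b`. -/
  antipode_right : ∀ (a b : A) (x : A ⊗[ℂ] A), incl x = tmulOne A b * Δ a →
    Multiplier.mulRight (TensorProduct.map LinearMap.id S x) = ε a • b

variable {G : Type*} [Group G]

/-- The conditions for a `G`-cograding of `(A, Δ)` by subalgebras `A_p`, except that some `A_p` may
be zero. -/
structure IsWeakCograding (Δ : A →ₙₐ[ℂ] Multiplier (A ⊗[ℂ] A))
    (𝒜 : G → NonUnitalSubalgebra ℂ A) : Prop where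
  independent : iSupIndep fun p => (𝒜 p).toSubmodule
  iSup_eq_top : ⨆ p, (𝒜 p).toSubmodule = ⊤
  mul_eq_zero : ∀ p q, p ≠ q → ∀ a ∈ 𝒜 p, ∀ b ∈ 𝒜 q, a * b = 0
  /-- `Δ(A_{pq})(1 ⊗ A_q) = A_p ⊗ A_q`, where the left side is the linear span. -/
  comul_mul_oneTmul : ∀ p q,
    Submodule.span ℂ {m | ∃ a ∈ 𝒜 (p * q), ∃ b ∈ 𝒜 q, m = Δ a * oneTmul A b} =
      Submodule.span ℂ {m | ∃ a ∈ 𝒜 p, ∃ b ∈ 𝒜 q, m = incl (a ⊗ₜ[ℂ] b)}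
  /-- `(A_p ⊗ 1)Δ(A_{pq}) = A_p ⊗ A_q`, where the left side is the linear span. -/
  tmulOne_mul_comul : ∀ p q,
    Submodule.span ℂ {m | ∃ a ∈ 𝒜 p, ∃ b ∈ 𝒜 (p * q), m = tmulOne A a * Δ b} =
      Submodule.span ℂ {m | ∃ a ∈ 𝒜 p, ∃ b ∈ 𝒜 q, m = incl (a ⊗ₜ[ℂ] b)}

/-- The family of non-zero subalgebras `A_p` is a `G`-cograding of `(A, Δ)`. -/
structure IsCograding (Δ : A →ₙₐ[ℂ] Multiplier (A ⊗[ℂ] A))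
    (𝒜 : G → NonUnitalSubalgebra ℂ A) : Prop extends IsWeakCograding Δ 𝒜 where
  nontrivial : ∀ p, Nontrivial (𝒜 p)

end MultiplierHopf

/-- The inclusion of a subalgebra, as a linear map. -/
def subalgebraIncl {A : Type*} [NonUnitalRing A] [Module ℂ A] (B : NonUnitalSubalgebra ℂ A) :
    B →ₗ[ℂ] A where
  toFun b := b
  map_add' _ _ := rfl
  map_smul' _ _ := rfl

/-! ### Families of algebras indexed by a group -/

section Families

variable {G : Type*} [Group G]

/-- The identity map `A_p → A_q` when `p = q`. -/
abbrev castTo {A : G → Type*} [∀ p, AddCommGroup (A p)] [∀ p, Module ℂ (A p)] {p q : G}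
    (h : p = q) : A p ≃ₗ[ℂ] A q := LinearEquiv.cast (R := ℂ) (M := A) h

/-- A family of algebras `A_p` with non-degenerate products, together with a coassociative family of
homomorphisms `Δ_{p,q} : A_{pq} → M(A_p ⊗ A_q)`, a counit `ε_e : A_e → ℂ` and anti-isomorphisms
`S_p : A_p → A_{p⁻¹}` satisfying the antipode identities. In the identities, the elements `x`, `y`
exist by the four inclusions and are unique since the products are non-degenerate. -/
structure HopfFamily (A : G → Type*) [∀ p, NonUnitalRing (A p)] [∀ p, Module ℂ (A p)]
    [∀ p, IsScalarTower ℂ (A p) (A p)] [∀ p, SMulCommClass ℂ (A p) (A p)] where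
  nondegenerate : ∀ p, NondegenerateProduct (A p)
  comul : ∀ p q, A (p * q) →ₙₐ[ℂ] Multiplier (A p ⊗[ℂ] A q)
  /-- `Δ_{p,q}(a)(1 ⊗ b) ∈ A_p ⊗ A_q`. -/
  comul_mul_oneTmul : ∀ p q (a : A (p * q)) (b : A q),
    ∃ x : A p ⊗[ℂ] A q, incl x = comul p q a * oneTmul (A p) b
  /-- `(b ⊗ 1)Δ_{p,q}(a) ∈ A_p ⊗ A_q`. -/
  tmulOne_mul_comul : ∀ p q (a : A (p * q)) (b : A p),
    ∃ x : A p ⊗[ℂ] A q, incl x = tmulOne (A q) b * comul p q a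
  /-- `(1 ⊗ b)Δ_{p,q}(a) ∈ A_p ⊗ A_q`. -/
  oneTmul_mul_comul : ∀ p q (a : A (p * q)) (b : A q),
    ∃ x : A p ⊗[ℂ] A q, incl x = oneTmul (A p) b * comul p q a
  /-- `Δ_{p,q}(a)(b ⊗ 1) ∈ A_p ⊗ A_q`. -/
  comul_mul_tmulOne : ∀ p q (a : A (p * q)) (b : A p),
    ∃ x : A p ⊗[ℂ] A q, incl x = comul p q a * tmulOne (A q) b
  /-- `(c ⊗ 1 ⊗ 1) (Δ_{p,q} ⊗ ι)(Δ_{pq,r}(a)(1 ⊗ b))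
    = (ι ⊗ Δ_{q,r})((c ⊗ 1)Δ_{p,qr}(a)) (1 ⊗ 1 ⊗ b)`. -/
  coassoc : ∀ p q r (a : A (p * q * r)) (b : A r) (c : A p)
    (x : A (p * q) ⊗[ℂ] A r) (y : A p ⊗[ℂ] A (q * r)),
    incl x = comul (p * q) r a * oneTmul (A (p * q)) b →
    incl y = tmulOne (A (q * r)) c * comul p (q * r) (castTo (mul_assoc p q r) a) →
      Multiplier.assoc (A p) (A q) (A r) (tmul (tmulOne (A q) c) 1 * comulTensorId (comul p q) x) =
        idTensorComul (comul q r) y * tmul 1 (oneTmul (A q) b)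
  counit : A 1 →ₙₐ[ℂ] ℂ
  /-- `(ι ⊗ ε_e)((a ⊗ 1)Δ_{p,e}(b)) = ab`. -/
  counit_right : ∀ p (a b : A p) (x : A p ⊗[ℂ] A 1),
    incl x = tmulOne (A 1) a * comul p 1 (castTo (mul_one p).symm b) →
      TensorProduct.rid ℂ (A p)
        (TensorProduct.map LinearMap.id (counit : A 1 →ₗ[ℂ] ℂ) x) = a * b
  /-- `(ε_e ⊗ ι)(Δ_{e,p}(a)(1 ⊗ b)) = ab`. -/
  counit_left : ∀ p (a b : A p) (x : A 1 ⊗[ℂ] A p),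
    incl x = comul 1 p (castTo (one_mul p).symm a) * oneTmul (A 1) b →
      TensorProduct.lid ℂ (A p)
        (TensorProduct.map (counit : A 1 →ₗ[ℂ] ℂ) LinearMap.id x) = a * b
  antipode : ∀ p, A p ≃ₗ[ℂ] A p⁻¹
  antipode_mul : ∀ p (a b : A p), antipode p (a * b) = antipode p b * antipode p a
  /-- `m (S_{p⁻¹} ⊗ ι)(Δ_{p⁻¹,p}(a)(1 ⊗ b)) = ε_e(a)b`. -/
  antipode_left : ∀ p (a : A 1) (b : A p) (x : A p⁻¹ ⊗[ℂ] A p),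
    incl x = comul p⁻¹ p (castTo (inv_mul_cancel p).symm a) * oneTmul (A p⁻¹) b →
      LinearMap.mul' ℂ (A p) (TensorProduct.map
        ((antipode p⁻¹).trans (castTo (inv_inv p))).toLinearMap LinearMap.id x) = counit a • b
  /-- `m (ι ⊗ S_{p⁻¹})((b ⊗ 1)Δ_{p,p⁻¹}(a)) = ε_e(a)b`. -/
  antipode_right : ∀ p (a : A 1) (b : A p) (x : A p ⊗[ℂ] A p⁻¹),
    incl x = tmulOne (A p⁻¹) b * comul p p⁻¹ (castTo (mul_inv_cancel p).symm a) →
      LinearMap.mul' ℂ (A p) (TensorProduct.map LinearMap.id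
        ((antipode p⁻¹).trans (castTo (inv_inv p))).toLinearMap x) = counit a • b

section DirectSum

variable (A : G → Type*) [∀ p, NonUnitalRing (A p)] [∀ p, Module ℂ (A p)]
  [∀ p, IsScalarTower ℂ (A p) (A p)] [∀ p, SMulCommClass ℂ (A p) (A p)]

/-- The direct sum algebra `⊕ A_p`: functions `a` on `G` with `a(p) ∈ A_p` that vanish outside a
finite set, with pointwise operations. -/
def directSum : NonUnitalSubalgebra ℂ (∀ p, A p) where
  carrier := {a | {p | a p ≠ 0}.Finite}
  zero_mem' := by simp
  add_mem' := by
    intro a b ha hb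
    refine (ha.union hb).subset fun p hp => ?_
    by_contra h
    simp only [Set.mem_union, Set.mem_ofPred_eq, not_or, not_not] at h
    exact hp (by simp [h.1, h.2])
  mul_mem' := by
    intro a b ha _
    refine ha.subset fun p hp h => hp ?_
    simp [h]
  smul_mem' := by
    intro z a ha
    refine ha.subset fun p hp h => hp ?_
    simp [h]

/-- The evaluation `a ↦ a(p)` on `⊕ A_p`. -/
def directSumEval (p : G) : directSum A →ₗ[ℂ] A p :=
  LinearMap.proj p ∘ₗ subalgebraIncl (directSum A)

/-- The subalgebra `A_p` of `⊕ A_p`: the functions with support in `{p}`. -/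
def directSumComponent (p : G) : NonUnitalSubalgebra ℂ (directSum A) where
  carrier := {a | ∀ q, q ≠ p → a.1 q = 0}
  zero_mem' := fun q _ => rfl
  add_mem' := by
    intro a b ha hb q hq
    simp [ha q hq, hb q hq]
  mul_mem' := by
    intro a b ha _ q hq
    simp [ha q hq]
  smul_mem' := by
    intro z a ha q hq
    simp [ha q hq]

variable {A}

/-- `(Δ a)(p, q) = Δ_{p,q}(a(pq))` for all `a`, `p`, `q`. Here the component `m(p, q) ∈ M(A_p ⊗ A_q)`
of `m ∈ M(A ⊗ A)`, for `A = ⊕ A_p`, is given by `(m x)(p, q) = m(p, q) x(p, q)` and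
`(x m)(p, q) = x(p, q) m(p, q)` for `x ∈ A ⊗ A`. -/
def HopfFamily.IsDirectSumComul (D : HopfFamily A)
    (Δ : directSum A →ₙₐ[ℂ] Multiplier (directSum A ⊗[ℂ] directSum A)) : Prop :=
  ∀ (a : directSum A) (p q : G) (x : directSum A ⊗[ℂ] directSum A),
    TensorProduct.map (directSumEval A p) (directSumEval A q) ((Δ a).left x) =
      (D.comul p q (a.1 (p * q))).left
        (TensorProduct.map (directSumEval A p) (directSumEval A q) x) ∧
    TensorProduct.map (directSumEval A p) (directSumEval A q) ((Δ a).right x) =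
      (D.comul p q (a.1 (p * q))).right
        (TensorProduct.map (directSumEval A p) (directSumEval A q) x)

end DirectSum

section Restriction

variable {A : Type*} [NonUnitalRing A] [Module ℂ A] [IsScalarTower ℂ A A] [SMulCommClass ℂ A A]

/-- The maps `Δ_{p,q}`, `ε_e`, `S_p` of the family `D` on the subalgebras `A_p` of `A` are the
restrictions of `Δ : A → M(A ⊗ A)`, `ε : A → ℂ` and `S : A → M(A)`: for `a ∈ A_{pq}`, the
multiplier `Δ_{p,q}(a)` is the restriction of `Δ(a)` to `A_p ⊗ A_q ⊆ A ⊗ A`. -/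
structure HopfFamily.IsRestriction {𝒜 : G → NonUnitalSubalgebra ℂ A}
    (D : HopfFamily fun p => 𝒜 p) (Δ : A →ₙₐ[ℂ] Multiplier (A ⊗[ℂ] A)) (ε : A →ₙₐ[ℂ] ℂ)
    (S : A →ₗ[ℂ] Multiplier A) : Prop where
  comul_left : ∀ p q (a : 𝒜 (p * q)) (x : 𝒜 p ⊗[ℂ] 𝒜 q),
    TensorProduct.map (subalgebraIncl (𝒜 p)) (subalgebraIncl (𝒜 q))
        ((D.comul p q a).left x) =
      (Δ a).left (TensorProduct.map (subalgebraIncl (𝒜 p)) (subalgebraIncl (𝒜 q)) x)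
  comul_right : ∀ p q (a : 𝒜 (p * q)) (x : 𝒜 p ⊗[ℂ] 𝒜 q),
    TensorProduct.map (subalgebraIncl (𝒜 p)) (subalgebraIncl (𝒜 q))
        ((D.comul p q a).right x) =
      (Δ a).right (TensorProduct.map (subalgebraIncl (𝒜 p)) (subalgebraIncl (𝒜 q)) x)
  counit : ∀ a : 𝒜 1, D.counit a = ε a
  antipode : ∀ p (a : 𝒜 p), incl (D.antipode p a : A) = S a

end Restriction

section Turaev

/-- A Hopf `G`-coalgebra in the sense of Turaev on a family of unital algebras `A_p`. -/
structure HopfGroupCoalgebra (A : G → Type*) [∀ p, Ring (A p)] [∀ p, Algebra ℂ (A p)] where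
  comul : ∀ p q, A (p * q) →ₐ[ℂ] A p ⊗[ℂ] A q
  /-- `(Δ_{p,q} ⊗ ι)Δ_{pq,r} = (ι ⊗ Δ_{q,r})Δ_{p,qr}`. -/
  coassoc : ∀ p q r (a : A (p * q * r)),
    TensorProduct.assoc ℂ (A p) (A q) (A r)
        (TensorProduct.map (comul p q).toLinearMap LinearMap.id (comul (p * q) r a)) =
      TensorProduct.map LinearMap.id (comul q r).toLinearMap
        (comul p (q * r) (castTo (mul_assoc p q r) a))
  counit : A 1 →ₐ[ℂ] ℂ
  /-- `(ι ⊗ ε)Δ_{p,e}(a) = a`. -/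
  counit_right : ∀ p (a : A p), TensorProduct.rid ℂ (A p) (TensorProduct.map LinearMap.id
    counit.toLinearMap (comul p 1 (castTo (mul_one p).symm a))) = a
  /-- `(ε ⊗ ι)Δ_{e,p}(a) = a`. -/
  counit_left : ∀ p (a : A p), TensorProduct.lid ℂ (A p) (TensorProduct.map counit.toLinearMap
    LinearMap.id (comul 1 p (castTo (one_mul p).symm a))) = a
  antipode : ∀ p, A p ≃ₗ[ℂ] A p⁻¹
  antipode_mul : ∀ p (a b : A p), antipode p (a * b) = antipode p b * antipode p a
  /-- `m (S_{p⁻¹} ⊗ ι)Δ_{p⁻¹,p}(a) = ε(a)1`. -/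
  antipode_left : ∀ p (a : A 1), LinearMap.mul' ℂ (A p) (TensorProduct.map
    ((antipode p⁻¹).trans (castTo (inv_inv p))).toLinearMap LinearMap.id
    (comul p⁻¹ p (castTo (inv_mul_cancel p).symm a))) = counit a • 1
  /-- `m (ι ⊗ S_{p⁻¹})Δ_{p,p⁻¹}(a) = ε(a)1`. -/
  antipode_right : ∀ p (a : A 1), LinearMap.mul' ℂ (A p) (TensorProduct.map LinearMap.id
    ((antipode p⁻¹).trans (castTo (inv_inv p))).toLinearMap
    (comul p p⁻¹ (castTo (mul_inv_cancel p).symm a))) = counit a • 1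

/-- A Hopf `G`-coalgebra and a Hopf family on the same unital algebras consist of the same maps, when
`A_p ⊗ A_q` is identified with `M(A_p ⊗ A_q)`. -/
structure HopfGroupCoalgebra.SameData {A : G → Type*} [∀ p, Ring (A p)] [∀ p, Algebra ℂ (A p)]
    (T : HopfGroupCoalgebra A) (D : HopfFamily A) : Prop where
  comul : ∀ p q a, D.comul p q a = incl (T.comul p q a)
  counit : ∀ a, D.counit a = T.counit a
  antipode : ∀ p a, D.antipode p a = T.antipode p a

end Turaev

end Families

end CogradedMHA

set_option linter.unusedSectionVars false

/-! From families to algebras, the point is that a counit and a bijective antipode force the maps `a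
⊗ b ↦ Δ(a)(1 ⊗ b)` and `a ⊗ b ↦ (a ⊗ 1)Δ(b)` to be bijective. In Sweedler notation the inverse of
the first is `a ⊗ b ↦ a₁ ⊗ S(a₂)b`. Without identities, `Δ(a)` is not in `A ⊗ A`, so all identities
are stated for the four covered products `Δ(a)(1 ⊗ b)`, `(b ⊗ 1)Δ(a)`, `Δ(a)(b ⊗ 1)`, `(1 ⊗ b)Δ(a)`,
and the covering element is cancelled at the end by non-degeneracy. The structure `HopfMaps` records
these linear maps and their relations, and it is stable under two symmetries: opposite product with
flipped comultiplication (`HopfMaps.mirror`), and flipped comultiplication with inverse antipode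
(`HopfMaps.cop`). So the single computation `HopfMaps.bijective_lift_t₁` yields all four bijections
needed for regularity. For `⊕ A_p`, the tensor square consists of the finitely supported families in
`A_p ⊗ A_q`, and every identity is checked component by component (`hopfMaps_directSum`). Since the
bijections respect the grading, they also give the spans required of a cograding.

Conversely, the counit comes from the bijections alone. Coassociativity implies `a ⊗ m(T₁⁻¹(b ⊗ c))
= m(T₂⁻¹(a ⊗ b)) ⊗ c`, which forces `m(T₁⁻¹(b ⊗ c)) = ε(b)c` for a scalar `ε(b)`. The antipode is
then `S(a)b = (ε ⊗ ι)T₁⁻¹(a ⊗ b)`, and regularity makes it a bijection of `A` whose inverse is the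
antipode of the flipped comultiplication. The cograding makes `T₁⁻¹` map `A_p ⊗ A_q` into `A_{pq} ⊗
A_q`. Since the product of `A_p` and `A_e` vanishes for `p ≠ e`, the counit vanishes off `A_e`, and
hence `S(A_p) ⊆ A_{p⁻¹}`. All structure maps therefore restrict to the components.

In the unital case the only content is that the maps are automatically unital: `Δ_{p,q}(1)` is a
left identity for `Δ_{p,q}(A_{pq})(1 ⊗ A_q) = A_p ⊗ A_q`, and `ε_e(1)` is a non-zero idempotent of
`ℂ` if `A_e ≠ 0`. -/

namespace CogradedMHA

open Multiplier

/-! ### Jointly injective families of linear maps -/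

section JointlyInjective

variable {X Z : Type*} [AddCommGroup X] [Module ℂ X] [AddCommGroup Z] [Module ℂ Z]

/-- The common kernel of the linear maps `e i` is zero. -/
def JointlyInjective {ι : Type*} {Y : ι → Type*} [∀ i, AddCommGroup (Y i)] [∀ i, Module ℂ (Y i)]
    (e : ∀ i, X →ₗ[ℂ] Y i) : Prop :=
  ∀ x, (∀ i, e i x = 0) → x = 0

namespace JointlyInjective

variable {ι κ : Type*} {Y : ι → Type*} [∀ i, AddCommGroup (Y i)] [∀ i, Module ℂ (Y i)]
  {W : κ → Type*} [∀ i, AddCommGroup (W i)] [∀ i, Module ℂ (W i)]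
  {e : ∀ i, X →ₗ[ℂ] Y i} {f : ∀ j, Z →ₗ[ℂ] W j}

theorem eq_of_forall (he : JointlyInjective e) {x y : X} (h : ∀ i, e i x = e i y) : x = y :=
  sub_eq_zero.1 (he _ fun i => by simp [h i])

theorem of_injective {Y : Type*} [AddCommGroup Y] [Module ℂ Y] {g : X →ₗ[ℂ] Y}
    (hg : Function.Injective g) : JointlyInjective (fun _ : Unit => g) :=
  fun x h => hg (by simpa using h ())

/-- A basis of `Z` turns `X ⊗ Z` into finitely supported families in `X`, on which `e i ⊗ id` acts
coefficient by coefficient. This works for infinite families, which is what non-degeneracy and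
infinite direct sums require. -/
theorem rTensor (he : JointlyInjective e) (Z : Type*) [AddCommGroup Z] [Module ℂ Z] :
    JointlyInjective (fun i => TensorProduct.map (e i) (LinearMap.id : Z →ₗ[ℂ] Z)) := by
  classical
  intro x hx
  let b := Module.Basis.ofVectorSpace ℂ Z
  have key : ∀ (i : ι) (x : X ⊗[ℂ] Z) k,
      TensorProduct.equivFinsuppOfBasisRight b (TensorProduct.map (e i) LinearMap.id x) k =
        e i (TensorProduct.equivFinsuppOfBasisRight b x k) := by
    intro i x k
    induction x with
    | zero => simp
    | add x y hx hy => simp [hx, hy]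
    | tmul x z => simp
  apply (TensorProduct.equivFinsuppOfBasisRight b).injective
  ext k
  rw [map_zero, Finsupp.zero_apply]
  exact he _ fun i => by rw [← key, hx i]; simp

theorem lTensor (hf : JointlyInjective f) (X : Type*) [AddCommGroup X] [Module ℂ X] :
    JointlyInjective (fun j => TensorProduct.map (LinearMap.id : X →ₗ[ℂ] X) (f j)) := by
  intro x hx
  have := hf.rTensor X (TensorProduct.comm ℂ X Z x) fun j => by
    have := congrArg (TensorProduct.comm ℂ X (W j)) (hx j)
    rw [map_zero] at this
    rw [← this, TensorProduct.map_comm]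
  simpa using this

theorem tensor (he : JointlyInjective e) (hf : JointlyInjective f) :
    JointlyInjective (fun ij : ι × κ => TensorProduct.map (e ij.1) (f ij.2)) := by
  intro x hx
  refine he.rTensor Z x fun i => hf.lTensor (Y i) _ fun j => ?_
  rw [← LinearMap.comp_apply, ← TensorProduct.map_comp]
  exact hx (i, j)

/-- Linear maps into the targets of a jointly injective family which lift pointwise lift linearly. -/
theorem exists_lift (he : JointlyInjective e) (g : ∀ i, Z →ₗ[ℂ] Y i)
    (h : ∀ z, ∃ x, ∀ i, e i x = g i z) : ∃ T : Z →ₗ[ℂ] X, ∀ z i, e i (T z) = g i z := by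
  choose T hT using h
  refine ⟨{ toFun := T, map_add' := fun z w => ?_, map_smul' := fun c z => ?_ }, hT⟩
  · exact he.eq_of_forall fun i => by simp [hT]
  · exact he.eq_of_forall fun i => by simp [hT]

end JointlyInjective

end JointlyInjective

/-! ### Multipliers -/

section Multipliers

open Multiplier

variable {A B C D : Type*}
variable [NonUnitalRing A] [Module ℂ A] [IsScalarTower ℂ A A] [SMulCommClass ℂ A A]
variable [NonUnitalRing B] [Module ℂ B] [IsScalarTower ℂ B B] [SMulCommClass ℂ B B]
variable [NonUnitalRing C] [Module ℂ C] [IsScalarTower ℂ C C] [SMulCommClass ℂ C C]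

theorem NondegenerateProduct.jointlyInjective_mulRight (h : NondegenerateProduct A) :
    JointlyInjective (fun b : A => LinearMap.mulRight ℂ b) :=
  fun a ha => h.1 a ha

theorem NondegenerateProduct.jointlyInjective_mulLeft (h : NondegenerateProduct A) :
    JointlyInjective (fun a : A => LinearMap.mulLeft ℂ a) :=
  fun b hb => h.2 b hb

theorem mulLeft_tmul (a : A) (b : B) :
    LinearMap.mulLeft ℂ (a ⊗ₜ[ℂ] b) =
      TensorProduct.map (LinearMap.mulLeft ℂ a) (LinearMap.mulLeft ℂ b) := by
  ext x y; simp

theorem mulRight_tmul (a : A) (b : B) :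
    LinearMap.mulRight ℂ (a ⊗ₜ[ℂ] b) =
      TensorProduct.map (LinearMap.mulRight ℂ a) (LinearMap.mulRight ℂ b) := by
  ext x y; simp

/-- Non-degeneracy is joint injectivity of the one-sided multiplications, and multiplication by an
elementary tensor is a tensor product of multiplications, so `JointlyInjective.tensor` applies. -/
theorem NondegenerateProduct.tensor (hA : NondegenerateProduct A) (hB : NondegenerateProduct B) :
    NondegenerateProduct (A ⊗[ℂ] B) := by
  constructor
  · intro x hx
    refine hA.jointlyInjective_mulRight.tensor hB.jointlyInjective_mulRight x fun ⟨a, b⟩ => ?_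
    change TensorProduct.map (LinearMap.mulRight ℂ a) (LinearMap.mulRight ℂ b) x = 0
    rw [← mulRight_tmul]
    exact hx _
  · intro x hx
    refine hA.jointlyInjective_mulLeft.tensor hB.jointlyInjective_mulLeft x fun ⟨a, b⟩ => ?_
    change TensorProduct.map (LinearMap.mulLeft ℂ a) (LinearMap.mulLeft ℂ b) x = 0
    rw [← mulLeft_tmul]
    exact hx _

theorem NondegenerateProduct.eq_of_mul_right (h : NondegenerateProduct A) {x y : A}
    (hxy : ∀ z, x * z = y * z) : x = y :=
  h.jointlyInjective_mulRight.eq_of_forall hxy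

theorem NondegenerateProduct.eq_of_mul_left (h : NondegenerateProduct A) {x y : A}
    (hxy : ∀ z, z * x = z * y) : x = y :=
  h.jointlyInjective_mulLeft.eq_of_forall hxy

namespace Multiplier

/-- The identity `R(a)b = aL(b)` lets the left action determine the right action. -/
theorem ext_left (h : NondegenerateProduct A) {m n : Multiplier A}
    (hl : ∀ a, m.left a = n.left a) : m = n :=
  ext hl fun a => h.eq_of_mul_right fun b => by rw [right_mul_eq, right_mul_eq, hl]

theorem incl_injective (h : NondegenerateProduct A) : Function.Injective (incl : A → Multiplier A) :=
  fun a b hab => h.eq_of_mul_right fun c => by rw [← left_incl, hab, left_incl]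

theorem incl_add (a b : A) : incl (a + b) = incl a + incl b := (inclHom (A := A)).map_add a b

theorem incl_zero : incl (0 : A) = 0 := (inclHom (A := A)).map_zero

theorem incl_smul (z : ℂ) (a : A) : incl (z • a) = z • incl a := (inclHom (A := A)).map_smul z a

theorem incl_mul (a b : A) : incl (a * b) = incl a * incl b := (inclHom (A := A)).map_mul a b

/-- Together with `incl_mul_multiplier`, this makes `A` a two-sided ideal in `M(A)`, so that
equations of multipliers can be pulled back to `A`. -/
theorem mul_incl (m : Multiplier A) (a : A) : m * incl a = incl (m.left a) := by
  ext b <;> simp [left_mul_apply, right_mul_eq]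

theorem incl_mul_multiplier (m : Multiplier A) (a : A) : incl a * m = incl (m.right a) := by
  ext b <;> simp [right_mul_apply, right_mul_eq]

@[simp] theorem left_tmul (m : Multiplier A) (n : Multiplier B) :
    (tmul m n).left = TensorProduct.map m.left n.left := rfl

@[simp] theorem right_tmul (m : Multiplier A) (n : Multiplier B) :
    (tmul m n).right = TensorProduct.map m.right n.right := rfl

theorem tmul_mul_tmul (m m' : Multiplier A) (n n' : Multiplier B) :
    tmul m n * tmul m' n' = tmul (m * m') (n * n') := by
  ext x <;> simp [TensorProduct.map_comp]

theorem incl_tmul (a : A) (b : B) : incl (a ⊗ₜ[ℂ] b) = tmul (incl a) (incl b) := by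
  ext x
  · change LinearMap.mulLeft ℂ _ _ = _
    rw [mulLeft_tmul]; rfl
  · change LinearMap.mulRight ℂ _ _ = _
    rw [mulRight_tmul]; rfl

@[simp] theorem left_oneTmul (b : B) : (oneTmul A b).left =
    TensorProduct.map LinearMap.id (LinearMap.mulLeft ℂ b) := rfl

@[simp] theorem right_oneTmul (b : B) : (oneTmul A b).right =
    TensorProduct.map LinearMap.id (LinearMap.mulRight ℂ b) := rfl

@[simp] theorem left_tmulOne (a : A) : (tmulOne B a).left =
    TensorProduct.map (LinearMap.mulLeft ℂ a) LinearMap.id := rfl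

@[simp] theorem right_tmulOne (a : A) : (tmulOne B a).right =
    TensorProduct.map (LinearMap.mulRight ℂ a) LinearMap.id := rfl

theorem tmulOne_mul_oneTmul (a : A) (b : B) : tmulOne B a * oneTmul A b = incl (a ⊗ₜ[ℂ] b) := by
  rw [incl_tmul, tmulOne, oneTmul, tmul_mul_tmul, mul_one, one_mul]

theorem oneTmul_mul_tmulOne (a : A) (b : B) : oneTmul A b * tmulOne B a = incl (a ⊗ₜ[ℂ] b) := by
  rw [incl_tmul, tmulOne, oneTmul, tmul_mul_tmul, mul_one, one_mul]

theorem oneTmul_comm_tmulOne (a : A) (b : B) :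
    oneTmul A b * tmulOne B a = tmulOne B a * oneTmul A b := by
  rw [tmulOne_mul_oneTmul, oneTmul_mul_tmulOne]

/-- `b ↦ 1 ⊗ b` as a linear map. -/
noncomputable def oneTmulHom (A : Type*) {B : Type*} [NonUnitalRing A] [Module ℂ A]
    [IsScalarTower ℂ A A] [SMulCommClass ℂ A A] [NonUnitalRing B] [Module ℂ B]
    [IsScalarTower ℂ B B] [SMulCommClass ℂ B B] : B →ₗ[ℂ] Multiplier (A ⊗[ℂ] B) :=
  (ofTensor ∘ₗ TensorProduct.mk ℂ (Multiplier A) (Multiplier B) 1) ∘ₗ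
    ((inclHom : B →ₙₐ[ℂ] Multiplier B) : B →ₗ[ℂ] _)

/-- `a ↦ a ⊗ 1` as a linear map. -/
noncomputable def tmulOneHom {A : Type*} (B : Type*) [NonUnitalRing A] [Module ℂ A]
    [IsScalarTower ℂ A A] [SMulCommClass ℂ A A] [NonUnitalRing B] [Module ℂ B]
    [IsScalarTower ℂ B B] [SMulCommClass ℂ B B] : A →ₗ[ℂ] Multiplier (A ⊗[ℂ] B) :=
  (ofTensor ∘ₗ (TensorProduct.mk ℂ (Multiplier A) (Multiplier B)).flip 1) ∘ₗ
    ((inclHom : A →ₙₐ[ℂ] Multiplier A) : A →ₗ[ℂ] _)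

theorem oneTmulHom_apply (b : B) : oneTmulHom A b = oneTmul A b := rfl

theorem left_congr (e : A ≃ₗ[ℂ] B) (he : ∀ x y, e (x * y) = e x * e y) (m : Multiplier A) (b : B) :
    (congr e he m).left b = e (m.left (e.symm b)) := rfl

theorem right_congr (e : A ≃ₗ[ℂ] B) (he : ∀ x y, e (x * y) = e x * e y) (m : Multiplier A)
    (b : B) : (congr e he m).right b = e (m.right (e.symm b)) := rfl

theorem congr_incl (e : A ≃ₗ[ℂ] B) (he : ∀ x y, e (x * y) = e x * e y) (a : A) :
    congr e he (incl a) = incl (e a) := by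
  ext b <;> simp [left_congr, right_congr, he]

theorem assoc_incl (x : (A ⊗[ℂ] B) ⊗[ℂ] C) :
    Multiplier.assoc A B C (incl x) = incl (TensorProduct.assoc ℂ A B C x) :=
  congr_incl _ _ _

theorem flip_incl (x : A ⊗[ℂ] B) : Multiplier.flip (incl x) = incl (TensorProduct.comm ℂ A B x) :=
  congr_incl _ _ _

theorem left_flip (m : Multiplier (A ⊗[ℂ] B)) (x : B ⊗[ℂ] A) :
    (Multiplier.flip m).left x =
      TensorProduct.comm ℂ A B (m.left (TensorProduct.comm ℂ B A x)) := rfl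

theorem right_flip (m : Multiplier (A ⊗[ℂ] B)) (x : B ⊗[ℂ] A) :
    (Multiplier.flip m).right x =
      TensorProduct.comm ℂ A B (m.right (TensorProduct.comm ℂ B A x)) := rfl

theorem flip_tmul (m : Multiplier A) (n : Multiplier B) :
    Multiplier.flip (tmul m n) = tmul n m := by
  ext x <;> simp [left_flip, right_flip, TensorProduct.map_comm]

theorem flip_tmulOne (a : A) : Multiplier.flip (tmulOne B a) = oneTmul B a := flip_tmul _ _

theorem flip_oneTmul (b : B) : Multiplier.flip (oneTmul A b) = tmulOne A b := flip_tmul _ _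

theorem flip_flip (m : Multiplier (A ⊗[ℂ] B)) : Multiplier.flip (Multiplier.flip m) = m := by
  ext x <;> simp [left_flip, right_flip]

/-- A bilinear family of multipliers which belong to `A` comes from a linear map into `A`. -/
theorem exists_linearMap_incl {X Y : Type*} [AddCommGroup X] [Module ℂ X] [AddCommGroup Y]
    [Module ℂ Y] (h : NondegenerateProduct A) (f : X →ₗ[ℂ] Y →ₗ[ℂ] Multiplier A)
    (hf : ∀ x y, ∃ a, incl a = f x y) :
    ∃ T : X →ₗ[ℂ] Y →ₗ[ℂ] A, ∀ x y, incl (T x y) = f x y := by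
  have hi : JointlyInjective
      (fun _ : Unit => ((inclHom : A →ₙₐ[ℂ] Multiplier A) : A →ₗ[ℂ] Multiplier A)) :=
    JointlyInjective.of_injective (incl_injective h)
  obtain ⟨T, hT⟩ := hi.exists_lift (fun _ => TensorProduct.lift f) fun z => by
    induction z with
    | zero => exact ⟨0, fun _ => by simp⟩
    | add z w hz hw =>
      obtain ⟨a, ha⟩ := hz
      obtain ⟨b, hb⟩ := hw
      exact ⟨a + b, fun i => by rw [map_add, map_add, ha i, hb i]⟩
    | tmul x y =>
      obtain ⟨a, ha⟩ := hf x y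
      exact ⟨a, fun _ => ha⟩
  exact ⟨TensorProduct.curry T, fun x y => hT (x ⊗ₜ y) ()⟩

end Multiplier

/-! ### Coassociativity as an identity in the threefold tensor product -/

section Coassoc

variable {E F : Type*} [NonUnitalRing E] [Module ℂ E] [NonUnitalRing F] [Module ℂ F]

/-- Covering the first leg by `c` puts `(c ⊗ 1)Δ(u)` into `A ⊗ B`. With its counterpart
`idTensorComul_mul_oneTmul`, this replaces the multiplier form of coassociativity by an equation in
`A ⊗ B ⊗ C`. -/
theorem assoc_tmulOne_mul_comulTensorId (Δ : E →ₙₐ[ℂ] Multiplier (A ⊗[ℂ] B))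
    (T : E →ₗ[ℂ] A →ₗ[ℂ] A ⊗[ℂ] B) (hT : ∀ a c, incl (T a c) = tmulOne B c * Δ a)
    (c : A) (x : E ⊗[ℂ] C) :
    Multiplier.assoc A B C (tmul (tmulOne B c) 1 * comulTensorId Δ x) =
      incl (TensorProduct.assoc ℂ A B C (TensorProduct.map (T.flip c) LinearMap.id x)) := by
  rw [← assoc_incl]
  congr 1
  induction x with
  | zero => simp [incl_zero]
  | add x y hx hy => simp only [map_add, mul_add, hx, hy, incl_add]
  | tmul u v =>
    change tmul (tmulOne B c) 1 * tmul (Δ u) (incl v) = _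
    rw [tmul_mul_tmul, ← hT, one_mul]
    simp [incl_tmul]

theorem idTensorComul_mul_oneTmul (Δ : F →ₙₐ[ℂ] Multiplier (B ⊗[ℂ] C))
    (T : F →ₗ[ℂ] C →ₗ[ℂ] B ⊗[ℂ] C) (hT : ∀ a b, incl (T a b) = Δ a * oneTmul B b)
    (b : C) (y : A ⊗[ℂ] F) :
    idTensorComul Δ y * tmul 1 (oneTmul B b) =
      incl (TensorProduct.map LinearMap.id (T.flip b) y) := by
  induction y with
  | zero => simp [incl_zero]
  | add x y hx hy => simp only [map_add, add_mul, hx, hy, incl_add]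
  | tmul u v =>
    change tmul (incl u) (Δ v) * tmul 1 (oneTmul B b) = _
    rw [tmul_mul_tmul, ← hT, mul_one]
    simp [incl_tmul]

end Coassoc

end Multipliers

/-! ### Comultiplications with counit and antipode, in terms of linear maps -/

section HopfMaps

open TensorProduct (map lift comm)

variable {A : Type*} [AddCommGroup A] [Module ℂ A]

/-- The linear maps `t₁(a, b) = Δ(a)(1 ⊗ b)`, `t₂(a, b) = (b ⊗ 1)Δ(a)`, `t₃(a, b) = Δ(a)(b ⊗ 1)` and
`t₄(a, b) = (1 ⊗ b)Δ(a)` of a coassociative comultiplication `Δ` with counit `ε` and bijective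
antipode `S` on the algebra `A` with product `μ`. The product is not an instance since the notion
is symmetric under passing to the opposite product. -/
structure HopfMaps (μ : A →ₗ[ℂ] A →ₗ[ℂ] A) (t₁ t₂ t₃ t₄ : A →ₗ[ℂ] A →ₗ[ℂ] A ⊗[ℂ] A)
    (ε : A →ₗ[ℂ] ℂ) (S : A ≃ₗ[ℂ] A) : Prop where
  mul_assoc : ∀ a b c, μ (μ a b) c = μ a (μ b c)
  inj_left : JointlyInjective (fun c => μ c)
  inj_right : JointlyInjective (fun c => μ.flip c)
  rel₁₂ : ∀ a b c, map (μ c) LinearMap.id (t₁ a b) = map LinearMap.id (μ.flip b) (t₂ a c)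
  rel₁₃ : ∀ a b c, map (μ.flip c) LinearMap.id (t₁ a b) = map LinearMap.id (μ.flip b) (t₃ a c)
  rel₁₄ : ∀ a b c, map LinearMap.id (μ c) (t₁ a b) = map LinearMap.id (μ.flip b) (t₄ a c)
  rel₂₃ : ∀ a b c, map (μ.flip c) LinearMap.id (t₂ a b) = map (μ b) LinearMap.id (t₃ a c)
  rel₂₄ : ∀ a b c, map LinearMap.id (μ c) (t₂ a b) = map (μ b) LinearMap.id (t₄ a c)
  rel₃₄ : ∀ a b c, map LinearMap.id (μ c) (t₃ a b) = map (μ.flip b) LinearMap.id (t₄ a c)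
  coassoc : ∀ a b c, TensorProduct.assoc ℂ A A A (map (t₂.flip c) LinearMap.id (t₁ a b)) =
    map LinearMap.id (t₁.flip b) (t₂ a c)
  counit_left : ∀ a b, TensorProduct.lid ℂ A (map ε LinearMap.id (t₁ a b)) = μ a b
  counit_right : ∀ a b, TensorProduct.rid ℂ A (map LinearMap.id ε (t₂ a b)) = μ b a
  antipode_mul : ∀ a b, S (μ a b) = μ (S b) (S a)
  antipode_left : ∀ a b, lift μ (map S.toLinearMap LinearMap.id (t₁ a b)) = ε a • b
  antipode_right : ∀ a b, lift μ (map LinearMap.id S.toLinearMap (t₂ a b)) = ε a • b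

/-- The flip `a ⊗ b ↦ b ⊗ a` as a linear map. -/
noncomputable abbrev swap (A : Type*) [AddCommGroup A] [Module ℂ A] :
    A ⊗[ℂ] A →ₗ[ℂ] A ⊗[ℂ] A := (comm ℂ A A).toLinearMap

/-- `a ⊗ b ⊗ c ↦ c ⊗ b ⊗ a`. -/
noncomputable def reverse (A : Type*) [AddCommGroup A] [Module ℂ A] :
    A ⊗[ℂ] (A ⊗[ℂ] A) →ₗ[ℂ] A ⊗[ℂ] (A ⊗[ℂ] A) :=
  (TensorProduct.assoc ℂ A A A).toLinearMap ∘ₗ map (swap A) LinearMap.id ∘ₗ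
    (comm ℂ A (A ⊗[ℂ] A)).toLinearMap

/-- Flipping the comultiplication reverses the three legs and exchanges the two sides of
coassociativity. This and `map_swap_swap` carry that out for both symmetries of `HopfMaps`. -/
theorem assoc_map_swap (f : A →ₗ[ℂ] A ⊗[ℂ] A) (x : A ⊗[ℂ] A) :
    TensorProduct.assoc ℂ A A A (map (swap A ∘ₗ f) LinearMap.id (swap A x)) =
      reverse A (map LinearMap.id f x) := by
  induction x with
  | zero => simp
  | add x y hx hy => simp only [map_add, hx, hy]
  | tmul u v => simp [reverse]

theorem map_swap_swap (f : A →ₗ[ℂ] A ⊗[ℂ] A) (x : A ⊗[ℂ] A) :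
    map LinearMap.id (swap A ∘ₗ f) (swap A x) =
      reverse A (TensorProduct.assoc ℂ A A A (map f LinearMap.id x)) := by
  induction x with
  | zero => simp
  | add x y hx hy => simp only [map_add, hx, hy]
  | tmul u v =>
    simp only [LinearEquiv.coe_coe, TensorProduct.comm_tmul, TensorProduct.map_tmul,
      LinearMap.id_apply, LinearMap.comp_apply]
    induction f u with
    | zero => simp
    | add x y hx hy => simp only [map_add, TensorProduct.add_tmul, TensorProduct.tmul_add, hx, hy]
    | tmul a b => simp [reverse]

theorem lift_flip_comm (μ : A →ₗ[ℂ] A →ₗ[ℂ] A) (x : A ⊗[ℂ] A) :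
    lift μ.flip (comm ℂ A A x) = lift μ x := by
  induction x with
  | zero => simp
  | add x y hx hy => simp only [map_add, hx, hy]
  | tmul u v => simp

theorem map_smulRight (ε : A →ₗ[ℂ] ℂ) (b : A) (x : A ⊗[ℂ] A) :
    map LinearMap.id (ε.smulRight b) x = TensorProduct.rid ℂ A (map LinearMap.id ε x) ⊗ₜ b := by
  induction x with
  | zero => simp
  | add x y hx hy => simp only [map_add, hx, hy, TensorProduct.add_tmul]
  | tmul u v => simp [TensorProduct.smul_tmul]

namespace HopfMaps

variable {μ : A →ₗ[ℂ] A →ₗ[ℂ] A} {t₁ t₂ t₃ t₄ : A →ₗ[ℂ] A →ₗ[ℂ] A ⊗[ℂ] A}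
  {ε : A →ₗ[ℂ] ℂ} {S : A ≃ₗ[ℂ] A}

/-- The same comultiplication followed by the flip, for the opposite product. -/
theorem mirror (h : HopfMaps μ t₁ t₂ t₃ t₄ ε S) :
    HopfMaps μ.flip (t₂.compr₂ (swap A)) (t₁.compr₂ (swap A)) (t₄.compr₂ (swap A))
      (t₃.compr₂ (swap A)) ε S where
  mul_assoc a b c := by simp [h.mul_assoc]
  inj_left := h.inj_right
  inj_right := h.inj_left
  rel₁₂ a b c := by simp [TensorProduct.map_comm, h.rel₁₂]
  rel₁₃ a b c := by simp [TensorProduct.map_comm, h.rel₂₄]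
  rel₁₄ a b c := by simp [TensorProduct.map_comm, h.rel₂₃]
  rel₂₃ a b c := by simp [TensorProduct.map_comm, h.rel₁₄]
  rel₂₄ a b c := by simp [TensorProduct.map_comm, h.rel₁₃]
  rel₃₄ a b c := by simp [TensorProduct.map_comm, h.rel₃₄]
  coassoc a b c := by
    have e₁ : (t₁.compr₂ (swap A)).flip c = swap A ∘ₗ t₁.flip c := rfl
    have e₂ : (t₂.compr₂ (swap A)).flip b = swap A ∘ₗ t₂.flip b := rfl
    rw [e₁, e₂, LinearMap.compr₂_apply, LinearMap.compr₂_apply, assoc_map_swap, map_swap_swap,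
      h.coassoc]
  counit_left a b := by
    rw [LinearMap.flip_apply, ← h.counit_right]
    simp [TensorProduct.map_comm]
  counit_right a b := by
    rw [LinearMap.flip_apply, ← h.counit_left]
    simp [TensorProduct.map_comm]
  antipode_mul a b := by simp [h.antipode_mul]
  antipode_left a b := by
    rw [← h.antipode_right]
    simp [TensorProduct.map_comm, lift_flip_comm]
  antipode_right a b := by
    rw [← h.antipode_left]
    simp [TensorProduct.map_comm, lift_flip_comm]

/-- Coassociativity with `(1 ⊗ b)Δ(a)` in place of `Δ(a)(1 ⊗ b)`. Multiplying the last leg by `d` on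
the right trades `t₄` for `t₁` by `rel₁₄`; the given coassociativity then applies, and `d` is
cancelled. -/
theorem assoc_map_t₂ (h : HopfMaps μ t₁ t₂ t₃ t₄ ε S) (a b c : A) :
    TensorProduct.assoc ℂ A A A (map (t₂.flip c) LinearMap.id (t₄ a b)) =
      map LinearMap.id (t₄.flip b) (t₂ a c) := by
  refine ((h.inj_right.lTensor A).lTensor A).eq_of_forall fun d => ?_
  have e : map LinearMap.id (μ.flip d) ∘ₗ t₄.flip b = map LinearMap.id (μ b) ∘ₗ t₁.flip d := by
    ext z; simp [h.rel₁₄]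
  calc _ = TensorProduct.assoc ℂ A A A (map (t₂.flip c) LinearMap.id
          (map LinearMap.id (μ.flip d) (t₄ a b))) := by
        simp only [TensorProduct.map_map_assoc, TensorProduct.map_map, TensorProduct.map_id,
          LinearMap.id_comp, LinearMap.comp_id]
    _ = map LinearMap.id (map LinearMap.id (μ b)) (TensorProduct.assoc ℂ A A A
          (map (t₂.flip c) LinearMap.id (t₁ a d))) := by
        rw [← h.rel₁₄]
        simp only [TensorProduct.map_map_assoc, TensorProduct.map_map, TensorProduct.map_id,
          LinearMap.id_comp, LinearMap.comp_id]
    _ = _ := by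
        rw [h.coassoc, TensorProduct.map_map, TensorProduct.map_map, e]

/-- After multiplication of the first leg by `e` on the left, `rel₂₃` trades `t₃` for `t₂`, which
reduces the claim to `assoc_map_t₂`. This is the coassociativity of the flipped comultiplication. -/
theorem assoc_map_t₃ (h : HopfMaps μ t₁ t₂ t₃ t₄ ε S) (a b c : A) :
    TensorProduct.assoc ℂ A A A (map (t₃.flip b) LinearMap.id (t₄ a c)) =
      map LinearMap.id (t₄.flip c) (t₃ a b) := by
  refine (h.inj_left.rTensor (A ⊗[ℂ] A)).eq_of_forall fun e => ?_
  have h₂₃ : map (μ e) LinearMap.id ∘ₗ t₃.flip b = map (μ.flip b) LinearMap.id ∘ₗ t₂.flip e := by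
    ext z; simp [h.rel₂₃]
  calc _ = TensorProduct.assoc ℂ A A A (map (map (μ e) LinearMap.id ∘ₗ t₃.flip b) LinearMap.id
          (t₄ a c)) := by
        rw [← TensorProduct.map_id, TensorProduct.map_map_assoc, TensorProduct.map_map,
          LinearMap.id_comp]
    _ = map (μ.flip b) LinearMap.id (TensorProduct.assoc ℂ A A A
          (map (t₂.flip e) LinearMap.id (t₄ a c))) := by
        rw [h₂₃, ← TensorProduct.map_id, TensorProduct.map_map_assoc, TensorProduct.map_map,
          LinearMap.id_comp]
    _ = map LinearMap.id (t₄.flip c) (map (μ.flip b) LinearMap.id (t₂ a e)) := by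
        rw [h.assoc_map_t₂, TensorProduct.map_map, TensorProduct.map_map]; rfl
    _ = _ := by
        rw [h.rel₂₃, TensorProduct.map_map, TensorProduct.map_map]; rfl

theorem lift_map_left (h : HopfMaps μ t₁ t₂ t₃ t₄ ε S) (f : A →ₗ[ℂ] A) (c : A) (x : A ⊗[ℂ] A) :
    μ c (lift μ (map LinearMap.id f x)) =
      lift μ (map LinearMap.id f (map (μ c) LinearMap.id x)) := by
  induction x with
  | zero => simp
  | add x y hx hy => simp only [map_add, hx, hy]
  | tmul u v => simp [h.mul_assoc]

theorem lift_map_right (h : HopfMaps μ t₁ t₂ t₃ t₄ ε S) (f : A →ₗ[ℂ] A) (c : A) (x : A ⊗[ℂ] A) :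
    μ (lift μ (map f LinearMap.id x)) c =
      lift μ (map f LinearMap.id (map LinearMap.id (μ.flip c) x)) := by
  induction x with
  | zero => simp
  | add x y hx hy => simp only [map_add, LinearMap.add_apply, hx, hy]
  | tmul u v => simp [h.mul_assoc]

/-- Formally `a₁S(ba₂) = a₁S(a₂)S(b) = ε(a)S(b)`. The factor `c` on the left is needed to pass to
`t₂`, where the antipode axiom is available. -/
theorem antipode_t₄ (h : HopfMaps μ t₁ t₂ t₃ t₄ ε S) (a b : A) :
    lift μ (map LinearMap.id S.toLinearMap (t₄ a b)) = ε a • S b := by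
  refine h.inj_left.eq_of_forall fun c => ?_
  have key : ∀ x : A ⊗[ℂ] A, lift μ (map LinearMap.id S.toLinearMap (map LinearMap.id (μ b) x)) =
      μ (lift μ (map LinearMap.id S.toLinearMap x)) (S b) := by
    intro x
    induction x with
    | zero => simp
    | add x y hx hy => simp only [map_add, LinearMap.add_apply, hx, hy]
    | tmul u v => simp [h.mul_assoc, h.antipode_mul]
  rw [h.lift_map_left, ← h.rel₂₄, key, h.antipode_right]
  simp

/-- Formally `S(a₁b)a₂ = S(b)S(a₁)a₂ = ε(a)S(b)`, with a factor `c` on the right to pass to `t₁`. -/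
theorem antipode_t₃ (h : HopfMaps μ t₁ t₂ t₃ t₄ ε S) (a b : A) :
    lift μ (map S.toLinearMap LinearMap.id (t₃ a b)) = ε a • S b := by
  refine h.inj_right.eq_of_forall fun c => ?_
  have key : ∀ x : A ⊗[ℂ] A,
      lift μ (map S.toLinearMap LinearMap.id (map (μ.flip b) LinearMap.id x)) =
      μ (S b) (lift μ (map S.toLinearMap LinearMap.id x)) := by
    intro x
    induction x with
    | zero => simp
    | add x y hx hy => simp only [map_add, hx, hy]
    | tmul u v => simp [h.mul_assoc, h.antipode_mul]
  rw [LinearMap.flip_apply, h.lift_map_right, ← h.rel₁₃, key, h.antipode_left]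
  simp

/-- The comultiplication followed by the flip, with the inverse antipode. -/
theorem cop (h : HopfMaps μ t₁ t₂ t₃ t₄ ε S) :
    HopfMaps μ (t₃.compr₂ (swap A)) (t₄.compr₂ (swap A)) (t₁.compr₂ (swap A))
      (t₂.compr₂ (swap A)) ε S.symm where
  mul_assoc := h.mul_assoc
  inj_left := h.inj_left
  inj_right := h.inj_right
  rel₁₂ a b c := by simp [TensorProduct.map_comm, h.rel₃₄]
  rel₁₃ a b c := by simp [TensorProduct.map_comm, h.rel₁₃]
  rel₁₄ a b c := by simp [TensorProduct.map_comm, h.rel₂₃]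
  rel₂₃ a b c := by simp [TensorProduct.map_comm, h.rel₁₄]
  rel₂₄ a b c := by simp [TensorProduct.map_comm, h.rel₂₄]
  rel₃₄ a b c := by simp [TensorProduct.map_comm, h.rel₁₂]
  coassoc a b c := by
    have e₃ : (t₃.compr₂ (swap A)).flip b = swap A ∘ₗ t₃.flip b := rfl
    have e₄ : (t₄.compr₂ (swap A)).flip c = swap A ∘ₗ t₄.flip c := rfl
    rw [e₃, e₄, LinearMap.compr₂_apply, LinearMap.compr₂_apply, assoc_map_swap, map_swap_swap,
      h.assoc_map_t₃]
  counit_left a b := by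
    -- With `c` on the left, `rel₂₃` moves from `Δ(a)(b ⊗ 1)` to `(c ⊗ 1)Δ(a)`, for which the counit
    -- identity is known.
    refine h.inj_left.eq_of_forall fun c => ?_
    have key : ∀ x : A ⊗[ℂ] A, μ c (TensorProduct.lid ℂ A (map ε LinearMap.id (swap A x))) =
        TensorProduct.rid ℂ A (map LinearMap.id ε (map (μ c) LinearMap.id x)) := by
      intro x
      induction x with
      | zero => simp
      | add x y hx hy => simp only [map_add, hx, hy]
      | tmul u v => simp
    have key' : ∀ x : A ⊗[ℂ] A,
        TensorProduct.rid ℂ A (map LinearMap.id ε (map (μ.flip b) LinearMap.id x)) =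
          μ (TensorProduct.rid ℂ A (map LinearMap.id ε x)) b := by
      intro x
      induction x with
      | zero => simp
      | add x y hx hy => simp only [map_add, LinearMap.add_apply, hx, hy]
      | tmul u v => simp
    rw [LinearMap.compr₂_apply, key, ← h.rel₂₃, key', h.counit_right, h.mul_assoc]
  counit_right a b := by
    refine h.inj_right.eq_of_forall fun c => ?_
    have key : ∀ x : A ⊗[ℂ] A, μ (TensorProduct.rid ℂ A (map LinearMap.id ε (swap A x))) c =
        TensorProduct.lid ℂ A (map ε LinearMap.id (map LinearMap.id (μ.flip c) x)) := by
      intro x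
      induction x with
      | zero => simp
      | add x y hx hy => simp only [map_add, LinearMap.add_apply, hx, hy]
      | tmul u v => simp
    have key' : ∀ x : A ⊗[ℂ] A,
        TensorProduct.lid ℂ A (map ε LinearMap.id (map LinearMap.id (μ b) x)) =
          μ b (TensorProduct.lid ℂ A (map ε LinearMap.id x)) := by
      intro x
      induction x with
      | zero => simp
      | add x y hx hy => simp only [map_add, hx, hy]
      | tmul u v => simp
    rw [LinearMap.compr₂_apply, LinearMap.flip_apply, key, ← h.rel₁₄, key', h.counit_left,
      LinearMap.flip_apply, h.mul_assoc]
  antipode_mul a b := by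
    rw [LinearEquiv.symm_apply_eq, h.antipode_mul]; simp
  antipode_left a b := by
    -- The expression is `S⁻¹(a₂)a₁b`, and `S` turns it into `S(a₁b)a₂`, which `antipode_t₃`
    -- evaluates.
    apply S.injective
    have key : ∀ x : A ⊗[ℂ] A, S (lift μ (map S.symm.toLinearMap LinearMap.id (swap A x))) =
        lift μ (map S.toLinearMap LinearMap.id x) := by
      intro x
      induction x with
      | zero => simp
      | add x y hx hy => simp only [map_add, hx, hy]
      | tmul u v => simp [h.antipode_mul]
    rw [LinearMap.compr₂_apply, key, h.antipode_t₃]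
    simp
  antipode_right a b := by
    apply S.injective
    have key : ∀ x : A ⊗[ℂ] A, S (lift μ (map LinearMap.id S.symm.toLinearMap (swap A x))) =
        lift μ (map LinearMap.id S.toLinearMap x) := by
      intro x
      induction x with
      | zero => simp
      | add x y hx hy => simp only [map_add, hx, hy]
      | tmul u v => simp [h.antipode_mul]
    rw [LinearMap.compr₂_apply, key, h.antipode_t₄]
    simp

/-- The inverse of `a ⊗ b ↦ Δ(a)(1 ⊗ b)` is `a ⊗ b ↦ (ι ⊗ S)((1 ⊗ S⁻¹(b))Δ(a))`. -/
theorem bijective_lift_t₁ (h : HopfMaps μ t₁ t₂ t₃ t₄ ε S) : Function.Bijective (lift t₁) := by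
  let R : A ⊗[ℂ] A →ₗ[ℂ] A ⊗[ℂ] A :=
    lift ((t₄.compl₂ S.symm.toLinearMap).compr₂ (map LinearMap.id S.toLinearMap))
  have hR : ∀ a b, R (a ⊗ₜ b) = map LinearMap.id S.toLinearMap (t₄ a (S.symm b)) :=
    fun a b => by simp [R]
  have cancel : ∀ {x y : A ⊗[ℂ] A},
      (∀ c, map (μ c) LinearMap.id x = map (μ c) LinearMap.id y) → x = y :=
    fun hxy => (h.inj_left.rTensor A).eq_of_forall hxy
  have RT : R ∘ₗ lift t₁ = LinearMap.id := by
    refine TensorProduct.ext' fun a b => cancel fun c => ?_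
    -- Since `S(S⁻¹(v)y) = S(y)v`, the map `R` is `x ⊗ v ↦ x₁ ⊗ S(x₂)v`, and the composite sends `a
    -- ⊗ b` to `a₁ ⊗ S(a₂)a₃b = a ⊗ b`. The factor `c` on the first leg makes the threefold
    -- coproduct meaningful.
    have e₁ : ∀ (v : A) (y : A ⊗[ℂ] A),
        map LinearMap.id S.toLinearMap (map LinearMap.id (μ (S.symm v)) y) =
          map LinearMap.id (lift μ ∘ₗ map S.toLinearMap LinearMap.id)
            (TensorProduct.assoc ℂ A A A (y ⊗ₜ v)) := by
      intro v y
      induction y with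
      | zero => simp
      | add x y hx hy => simp only [map_add, TensorProduct.add_tmul, hx, hy]
      | tmul y z => simp [h.antipode_mul]
    have e₂ : ∀ x : A ⊗[ℂ] A, map (μ c) LinearMap.id (R x) =
        map LinearMap.id (lift μ ∘ₗ map S.toLinearMap LinearMap.id)
          (TensorProduct.assoc ℂ A A A (map (t₂.flip c) LinearMap.id x)) := by
      intro x
      induction x with
      | zero => simp
      | add x y hx hy => simp only [map_add, hx, hy]
      | tmul u v =>
        rw [hR, TensorProduct.map_tmul, LinearMap.flip_apply, LinearMap.id_apply, ← e₁, h.rel₂₄,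
          TensorProduct.map_map, TensorProduct.map_map]
        rfl
    have e₃ : (lift μ ∘ₗ map S.toLinearMap LinearMap.id) ∘ₗ t₁.flip b = ε.smulRight b := by
      ext z; simp [h.antipode_left]
    rw [LinearMap.comp_apply, TensorProduct.lift.tmul, e₂, h.coassoc, TensorProduct.map_map, e₃,
      LinearMap.id_comp, map_smulRight, h.counit_right]
    simp
  have TR : lift t₁ ∘ₗ R = LinearMap.id := by
    refine TensorProduct.ext' fun a b => cancel fun c => ?_
    -- Here the composite is `a₁ ⊗ a₂S(a₃)b`. The element `b` enters as `S⁻¹(b)` to the left of `a₃`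
    -- inside `S`, hence the coassociativity for `t₄` and `antipode_t₄` are used.
    have e₁ : ∀ (v : A) (y : A ⊗[ℂ] A), map LinearMap.id (μ.flip (S v)) y =
          map LinearMap.id (lift μ ∘ₗ map LinearMap.id S.toLinearMap)
            (TensorProduct.assoc ℂ A A A (y ⊗ₜ v)) := by
      intro v y
      induction y with
      | zero => simp
      | add x y hx hy => simp only [map_add, TensorProduct.add_tmul, hx, hy]
      | tmul y z => simp
    have e₂ : ∀ x : A ⊗[ℂ] A,
        map (μ c) LinearMap.id (lift t₁ (map LinearMap.id S.toLinearMap x)) =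
        map LinearMap.id (lift μ ∘ₗ map LinearMap.id S.toLinearMap)
          (TensorProduct.assoc ℂ A A A (map (t₂.flip c) LinearMap.id x)) := by
      intro x
      induction x with
      | zero => simp
      | add x y hx hy => simp only [map_add, hx, hy]
      | tmul u v =>
        rw [TensorProduct.map_tmul, TensorProduct.map_tmul, LinearMap.flip_apply,
          LinearMap.id_apply, LinearMap.id_apply, ← e₁, TensorProduct.lift.tmul, h.rel₁₂]
        rfl
    have e₃ : (lift μ ∘ₗ map LinearMap.id S.toLinearMap) ∘ₗ t₄.flip (S.symm b) =
        ε.smulRight b := by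
      ext z; simp [h.antipode_t₄]
    rw [LinearMap.comp_apply, hR, e₂, h.assoc_map_t₂, TensorProduct.map_map, e₃,
      LinearMap.id_comp, map_smulRight, h.counit_right]
    simp
  exact Function.bijective_iff_has_inverse.2 ⟨R, LinearMap.congr_fun RT, LinearMap.congr_fun TR⟩

/-- The mirror symmetry turns `t₂` into the first map, up to flips on both sides. -/
theorem bijective_lift_t₂_flip (h : HopfMaps μ t₁ t₂ t₃ t₄ ε S) :
    Function.Bijective (lift t₂.flip) := by
  have h' := h.mirror.bijective_lift_t₁
  have e : lift t₂.flip = swap A ∘ₗ lift (t₂.compr₂ (swap A)) ∘ₗ swap A := by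
    ext a b; simp
  rw [e]
  exact (comm ℂ A A).bijective.comp (h'.comp (comm ℂ A A).bijective)

end HopfMaps

end HopfMaps

/-! ### The linear maps attached to a comultiplication -/

section CoveredComul

open TensorProduct (map lift)

variable {A B E : Type*}
variable [NonUnitalRing A] [Module ℂ A] [IsScalarTower ℂ A A] [SMulCommClass ℂ A A]
variable [NonUnitalRing B] [Module ℂ B] [IsScalarTower ℂ B B] [SMulCommClass ℂ B B]
variable [NonUnitalRing E] [Module ℂ E] [IsScalarTower ℂ E E] [SMulCommClass ℂ E E]

theorem incl_map_mulLeft_id (c : A) (x : A ⊗[ℂ] B) :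
    incl (map (LinearMap.mulLeft ℂ c) LinearMap.id x) = tmulOne B c * incl x :=
  (mul_incl (tmulOne B c) x).symm

theorem incl_map_id_mulLeft (c : B) (x : A ⊗[ℂ] B) :
    incl (map LinearMap.id (LinearMap.mulLeft ℂ c) x) = oneTmul A c * incl x :=
  (mul_incl (oneTmul A c) x).symm

theorem incl_map_mulRight_id (c : A) (x : A ⊗[ℂ] B) :
    incl (map (LinearMap.mulRight ℂ c) LinearMap.id x) = incl x * tmulOne B c :=
  (incl_mul_multiplier (tmulOne B c) x).symm

theorem incl_map_id_mulRight (c : B) (x : A ⊗[ℂ] B) :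
    incl (map LinearMap.id (LinearMap.mulRight ℂ c) x) = incl x * oneTmul A c :=
  (incl_mul_multiplier (oneTmul A c) x).symm

theorem exists_comul_mul_oneTmul (hA : NondegenerateProduct A) (hB : NondegenerateProduct B)
    (Δ : E →ₙₐ[ℂ] Multiplier (A ⊗[ℂ] B))
    (h : ∀ a b, ∃ x : A ⊗[ℂ] B, incl x = Δ a * oneTmul A b) :
    ∃ t : E →ₗ[ℂ] B →ₗ[ℂ] A ⊗[ℂ] B, ∀ a b, incl (t a b) = Δ a * oneTmul A b :=
  exists_linearMap_incl (hA.tensor hB)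
    ((LinearMap.mul ℂ (Multiplier (A ⊗[ℂ] B))).compl₁₂
      (Δ : E →ₗ[ℂ] Multiplier (A ⊗[ℂ] B)) (oneTmulHom A)) h

theorem exists_tmulOne_mul_comul (hA : NondegenerateProduct A) (hB : NondegenerateProduct B)
    (Δ : E →ₙₐ[ℂ] Multiplier (A ⊗[ℂ] B))
    (h : ∀ a b, ∃ x : A ⊗[ℂ] B, incl x = tmulOne B b * Δ a) :
    ∃ t : E →ₗ[ℂ] A →ₗ[ℂ] A ⊗[ℂ] B, ∀ a b, incl (t a b) = tmulOne B b * Δ a :=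
  exists_linearMap_incl (hA.tensor hB)
    ((LinearMap.mul ℂ (Multiplier (A ⊗[ℂ] B))).flip.compl₁₂
      (Δ : E →ₗ[ℂ] Multiplier (A ⊗[ℂ] B)) (tmulOneHom B)) h

theorem exists_comul_mul_tmulOne (hA : NondegenerateProduct A) (hB : NondegenerateProduct B)
    (Δ : E →ₙₐ[ℂ] Multiplier (A ⊗[ℂ] B))
    (h : ∀ a b, ∃ x : A ⊗[ℂ] B, incl x = Δ a * tmulOne B b) :
    ∃ t : E →ₗ[ℂ] A →ₗ[ℂ] A ⊗[ℂ] B, ∀ a b, incl (t a b) = Δ a * tmulOne B b :=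
  exists_linearMap_incl (hA.tensor hB)
    ((LinearMap.mul ℂ (Multiplier (A ⊗[ℂ] B))).compl₁₂
      (Δ : E →ₗ[ℂ] Multiplier (A ⊗[ℂ] B)) (tmulOneHom B)) h

theorem exists_oneTmul_mul_comul (hA : NondegenerateProduct A) (hB : NondegenerateProduct B)
    (Δ : E →ₙₐ[ℂ] Multiplier (A ⊗[ℂ] B))
    (h : ∀ a b, ∃ x : A ⊗[ℂ] B, incl x = oneTmul A b * Δ a) :
    ∃ t : E →ₗ[ℂ] B →ₗ[ℂ] A ⊗[ℂ] B, ∀ a b, incl (t a b) = oneTmul A b * Δ a :=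
  exists_linearMap_incl (hA.tensor hB)
    ((LinearMap.mul ℂ (Multiplier (A ⊗[ℂ] B))).flip.compl₁₂
      (Δ : E →ₗ[ℂ] Multiplier (A ⊗[ℂ] B)) (oneTmulHom A)) h

/-- The bilinear maps `Δ(a)(1 ⊗ b)`, `(b ⊗ 1)Δ(a)`, `Δ(a)(b ⊗ 1)` and `(1 ⊗ b)Δ(a)`. -/
structure CoveredComul (Δ : E →ₙₐ[ℂ] Multiplier (A ⊗[ℂ] B)) (t₁ : E →ₗ[ℂ] B →ₗ[ℂ] A ⊗[ℂ] B)
    (t₂ t₃ : E →ₗ[ℂ] A →ₗ[ℂ] A ⊗[ℂ] B) (t₄ : E →ₗ[ℂ] B →ₗ[ℂ] A ⊗[ℂ] B) : Prop where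
  nondegenerate_left : NondegenerateProduct A
  nondegenerate_right : NondegenerateProduct B
  incl₁ : ∀ a b, incl (t₁ a b) = Δ a * oneTmul A b
  incl₂ : ∀ a b, incl (t₂ a b) = tmulOne B b * Δ a
  incl₃ : ∀ a b, incl (t₃ a b) = Δ a * tmulOne B b
  incl₄ : ∀ a b, incl (t₄ a b) = oneTmul A b * Δ a

namespace CoveredComul

variable {Δ : E →ₙₐ[ℂ] Multiplier (A ⊗[ℂ] B)} {t₁ : E →ₗ[ℂ] B →ₗ[ℂ] A ⊗[ℂ] B}
  {t₂ t₃ : E →ₗ[ℂ] A →ₗ[ℂ] A ⊗[ℂ] B} {t₄ : E →ₗ[ℂ] B →ₗ[ℂ] A ⊗[ℂ] B}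

theorem incl_injective (h : CoveredComul Δ t₁ t₂ t₃ t₄) :
    Function.Injective (incl : A ⊗[ℂ] B → Multiplier (A ⊗[ℂ] B)) :=
  Multiplier.incl_injective (h.nondegenerate_left.tensor h.nondegenerate_right)

/-- This relation and the five that follow are associativity in `M(A ⊗ B)`, together with the
commutation of `1 ⊗ b` and `c ⊗ 1` where both stand on the same side of `Δ(a)`. -/
theorem rel₁₂ (h : CoveredComul Δ t₁ t₂ t₃ t₄) (a : E) (b : B) (c : A) :
    map (LinearMap.mulLeft ℂ c) LinearMap.id (t₁ a b) =
      map LinearMap.id (LinearMap.mulRight ℂ b) (t₂ a c) :=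
  h.incl_injective <| by
    rw [incl_map_mulLeft_id, incl_map_id_mulRight, h.incl₁, h.incl₂, mul_assoc]

theorem rel₁₃ (h : CoveredComul Δ t₁ t₂ t₃ t₄) (a : E) (b : B) (c : A) :
    map (LinearMap.mulRight ℂ c) LinearMap.id (t₁ a b) =
      map LinearMap.id (LinearMap.mulRight ℂ b) (t₃ a c) :=
  h.incl_injective <| by
    rw [incl_map_mulRight_id, incl_map_id_mulRight, h.incl₁, h.incl₃, mul_assoc, mul_assoc,
      oneTmul_comm_tmulOne]

theorem rel₁₄ (h : CoveredComul Δ t₁ t₂ t₃ t₄) (a : E) (b c : B) :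
    map LinearMap.id (LinearMap.mulLeft ℂ c) (t₁ a b) =
      map LinearMap.id (LinearMap.mulRight ℂ b) (t₄ a c) :=
  h.incl_injective <| by
    rw [incl_map_id_mulLeft, incl_map_id_mulRight, h.incl₁, h.incl₄, mul_assoc]

theorem rel₂₃ (h : CoveredComul Δ t₁ t₂ t₃ t₄) (a : E) (b c : A) :
    map (LinearMap.mulRight ℂ c) LinearMap.id (t₂ a b) =
      map (LinearMap.mulLeft ℂ b) LinearMap.id (t₃ a c) :=
  h.incl_injective <| by
    rw [incl_map_mulRight_id, incl_map_mulLeft_id, h.incl₂, h.incl₃, mul_assoc]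

theorem rel₂₄ (h : CoveredComul Δ t₁ t₂ t₃ t₄) (a : E) (b : A) (c : B) :
    map LinearMap.id (LinearMap.mulLeft ℂ c) (t₂ a b) =
      map (LinearMap.mulLeft ℂ b) LinearMap.id (t₄ a c) :=
  h.incl_injective <| by
    rw [incl_map_id_mulLeft, incl_map_mulLeft_id, h.incl₂, h.incl₄, ← mul_assoc, ← mul_assoc,
      oneTmul_comm_tmulOne]

theorem rel₃₄ (h : CoveredComul Δ t₁ t₂ t₃ t₄) (a : E) (b : A) (c : B) :
    map LinearMap.id (LinearMap.mulLeft ℂ c) (t₃ a b) =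
      map (LinearMap.mulRight ℂ b) LinearMap.id (t₄ a c) :=
  h.incl_injective <| by
    rw [incl_map_id_mulLeft, incl_map_mulRight_id, h.incl₃, h.incl₄, mul_assoc]

end CoveredComul

theorem exists_coveredComul (hA : NondegenerateProduct A) (hB : NondegenerateProduct B)
    (Δ : E →ₙₐ[ℂ] Multiplier (A ⊗[ℂ] B))
    (h₁ : ∀ a b, ∃ x : A ⊗[ℂ] B, incl x = Δ a * oneTmul A b)
    (h₂ : ∀ a b, ∃ x : A ⊗[ℂ] B, incl x = tmulOne B b * Δ a)
    (h₃ : ∀ a b, ∃ x : A ⊗[ℂ] B, incl x = Δ a * tmulOne B b)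
    (h₄ : ∀ a b, ∃ x : A ⊗[ℂ] B, incl x = oneTmul A b * Δ a) :
    ∃ t₁ t₂ t₃ t₄, CoveredComul Δ t₁ t₂ t₃ t₄ := by
  obtain ⟨t₁, ht₁⟩ := exists_comul_mul_oneTmul hA hB Δ h₁
  obtain ⟨t₂, ht₂⟩ := exists_tmulOne_mul_comul hA hB Δ h₂
  obtain ⟨t₃, ht₃⟩ := exists_comul_mul_tmulOne hA hB Δ h₃
  obtain ⟨t₄, ht₄⟩ := exists_oneTmul_mul_comul hA hB Δ h₄
  exact ⟨t₁, t₂, t₃, t₄, hA, hB, ht₁, ht₂, ht₃, ht₄⟩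

end CoveredComul

/-! ### Regular multiplier Hopf algebras from covered products -/

section MultiplierHopf

open TensorProduct (map lift)

variable {A : Type*} [NonUnitalRing A] [Module ℂ A] [IsScalarTower ℂ A A] [SMulCommClass ℂ A A]
  {Δ : A →ₙₐ[ℂ] Multiplier (A ⊗[ℂ] A)} {t₁ t₂ t₃ t₄ : A →ₗ[ℂ] A →ₗ[ℂ] A ⊗[ℂ] A}
  {ε : A →ₗ[ℂ] ℂ} {S : A ≃ₗ[ℂ] A}

/-- By non-degeneracy the elements quantified over in the coassociativity axiom can only be the
values of `t₁` and `t₂`. -/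
theorem isMultiplierHopf_of_maps (hA : NondegenerateProduct A)
    (h₁ : ∀ a b, incl (t₁ a b) = Δ a * oneTmul A b)
    (h₂ : ∀ a b, incl (t₂ a b) = tmulOne A b * Δ a)
    (hc : ∀ a b c, TensorProduct.assoc ℂ A A A (map (t₂.flip c) LinearMap.id (t₁ a b)) =
      map LinearMap.id (t₁.flip b) (t₂ a c))
    (hb₁ : Function.Bijective (lift t₁)) (hb₂ : Function.Bijective (lift t₂.flip)) :
    IsMultiplierHopf Δ where
  nondegenerate := hA
  comul_mul_oneTmul a b := ⟨_, h₁ a b⟩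
  tmulOne_mul_comul a b := ⟨_, h₂ a b⟩
  coassoc a b c x y hx hy := by
    obtain rfl : x = t₁ a b := incl_injective (hA.tensor hA) (by rw [hx, h₁])
    obtain rfl : y = t₂ a c := incl_injective (hA.tensor hA) (by rw [hy, h₂])
    rw [assoc_tmulOne_mul_comulTensorId Δ t₂ h₂, idTensorComul_mul_oneTmul Δ t₁ h₁, hc]
  bijective_left := ⟨lift t₁, hb₁, fun a b => by simp [h₁]⟩
  bijective_right := ⟨lift t₂.flip, hb₂, fun a b => by simp [h₂]⟩

/-- The axioms for `Δᵒᵖ` are those for `Δ` applied to `h.cop`, whose first two maps are the flips of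
`t₃` and `t₄`. -/
theorem HopfMaps.isRegularMultiplierHopf
    (h : HopfMaps (LinearMap.mul ℂ A) t₁ t₂ t₃ t₄ ε S) (ht : CoveredComul Δ t₁ t₂ t₃ t₄) :
    IsRegularMultiplierHopf Δ := by
  refine ⟨isMultiplierHopf_of_maps ht.nondegenerate_left ht.incl₁ ht.incl₂ h.coassoc
    h.bijective_lift_t₁ h.bijective_lift_t₂_flip, isMultiplierHopf_of_maps ht.nondegenerate_left
    (fun a b => ?_) (fun a b => ?_) h.cop.coassoc h.cop.bijective_lift_t₁
    h.cop.bijective_lift_t₂_flip⟩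
  · change incl (TensorProduct.comm ℂ A A (t₃ a b)) = Multiplier.flip (Δ a) * _
    rw [← flip_incl, ht.incl₃, map_mul, flip_tmulOne]
  · change incl (TensorProduct.comm ℂ A A (t₄ a b)) = _ * Multiplier.flip (Δ a)
    rw [← flip_incl, ht.incl₄, map_mul, flip_oneTmul]

end MultiplierHopf

/-! ### The comultiplication on the direct sum of a Hopf family -/

section DirectSum

open TensorProduct (map lift)

variable {G : Type*} [Group G] {A : G → Type*} [∀ p, NonUnitalRing (A p)] [∀ p, Module ℂ (A p)]
  [∀ p, IsScalarTower ℂ (A p) (A p)] [∀ p, SMulCommClass ℂ (A p) (A p)]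

theorem castTo_apply_eval (a : ∀ p, A p) {p q : G} (h : p = q) : castTo h (a p) = a q := by
  subst h; rfl

theorem directSumEval_apply (p : G) (a : directSum A) : directSumEval A p a = a.1 p := rfl

theorem directSumEval_mul (p : G) (a b : directSum A) :
    directSumEval A p (a * b) = directSumEval A p a * directSumEval A p b := rfl

theorem castTo_directSumEval {p q : G} (h : p = q) (a : directSum A) :
    castTo h (directSumEval A p a) = directSumEval A q a :=
  castTo_apply_eval a.1 h

theorem jointlyInjective_directSumEval : JointlyInjective (directSumEval A) :=
  fun _ ha => Subtype.ext (funext ha)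

open scoped Classical in
/-- The inclusion of `A_p` into `⊕ A_p`. -/
noncomputable def directSumSingle (p : G) : A p →ₗ[ℂ] directSum A :=
  (LinearMap.single ℂ A p).codRestrict (directSum A).toSubmodule fun x =>
    (Set.finite_singleton p).subset fun q hq => by
      by_contra h
      exact hq (Pi.single_eq_of_ne h x)

open scoped Classical in
theorem directSumEval_single_self (p : G) (x : A p) :
    directSumEval A p (directSumSingle p x) = x :=
  Pi.single_eq_same p x

open scoped Classical in
theorem directSumEval_single_of_ne {p q : G} (h : q ≠ p) (x : A p) :
    directSumEval A q (directSumSingle p x) = 0 :=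
  Pi.single_eq_of_ne h x

theorem directSumSingle_mem (p : G) (x : A p) : directSumSingle p x ∈ directSumComponent A p :=
  fun _ hq => directSumEval_single_of_ne hq x

theorem directSumSingle_eval {p : G} {a : directSum A} (ha : a ∈ directSumComponent A p) :
    directSumSingle p (directSumEval A p a) = a :=
  jointlyInjective_directSumEval.eq_of_forall fun q => by
    obtain rfl | h := eq_or_ne q p
    · rw [directSumEval_single_self]
    · rw [directSumEval_single_of_ne h]
      exact (ha q h).symm

theorem nondegenerateProduct_directSum (h : ∀ p, NondegenerateProduct (A p)) :
    NondegenerateProduct (directSum A) := by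
  constructor
  · refine fun a ha => jointlyInjective_directSumEval a fun p => (h p).1 _ fun b => ?_
    rw [← directSumEval_single_self p b, ← directSumEval_mul, ha, map_zero]
  · refine fun a ha => jointlyInjective_directSumEval a fun p => (h p).2 _ fun b => ?_
    rw [← directSumEval_single_self p b, ← directSumEval_mul, ha, map_zero]

variable (A) in
/-- The component `x(p, q)` of `x ∈ A ⊗ A` for `A = ⊕ A_p`. -/
noncomputable abbrev tensorEval (p q : G) : directSum A ⊗[ℂ] directSum A →ₗ[ℂ] A p ⊗[ℂ] A q :=
  map (directSumEval A p) (directSumEval A q)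

theorem jointlyInjective_tensorEval :
    JointlyInjective (X := directSum A ⊗[ℂ] directSum A)
      (Y := fun pq : G × G => A pq.1 ⊗[ℂ] A pq.2) (fun pq => tensorEval A pq.1 pq.2) :=
  jointlyInjective_directSumEval.tensor jointlyInjective_directSumEval

theorem tensorEval_mul (p q : G) (x y : directSum A ⊗[ℂ] directSum A) :
    tensorEval A p q (x * y) = tensorEval A p q x * tensorEval A p q y := by
  induction x with
  | zero => simp
  | add x x' hx hx' => simp only [add_mul, map_add, hx, hx']
  | tmul a b =>
    induction y with
    | zero => simp
    | add y y' hy hy' => simp only [mul_add, map_add, hy, hy']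
    | tmul c d => simp [directSumEval_mul]

theorem tensorEval_single_self (p q : G) (x : A p ⊗[ℂ] A q) :
    tensorEval A p q (map (directSumSingle p) (directSumSingle q) x) = x := by
  rw [TensorProduct.map_map]
  have : ∀ r : G, directSumEval A r ∘ₗ directSumSingle r = LinearMap.id :=
    fun r => LinearMap.ext (directSumEval_single_self r)
  rw [this, this, TensorProduct.map_id, LinearMap.id_apply]

theorem tensorEval_single_of_ne {p q r s : G} (h : (p, q) ≠ (r, s)) (x : A r ⊗[ℂ] A s) :
    tensorEval A p q (map (directSumSingle r) (directSumSingle s) x) = 0 := by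
  have hz : ∀ {r s : G}, r ≠ s → directSumEval A r ∘ₗ directSumSingle s = 0 :=
    fun h => LinearMap.ext (directSumEval_single_of_ne h)
  rw [TensorProduct.map_map]
  by_cases hp : p = r
  · have hq : q ≠ s := fun hq => h (by rw [hp, hq])
    rw [hz hq, TensorProduct.map_zero_right, LinearMap.zero_apply]
  · rw [hz hp, TensorProduct.map_zero_left, LinearMap.zero_apply]

/-- With `jointlyInjective_tensorEval`, this identifies `A ⊗ A` with the finitely supported families
in `A_p ⊗ A_q`, so elements and maps can be constructed by components. -/
theorem exists_tensorEval_eq (y : ∀ pq : G × G, A pq.1 ⊗[ℂ] A pq.2)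
    (hy : {pq | y pq ≠ 0}.Finite) :
    ∃ x : directSum A ⊗[ℂ] directSum A, ∀ pq : G × G, tensorEval A pq.1 pq.2 x = y pq := by
  refine ⟨∑ pq ∈ hy.toFinset, map (directSumSingle pq.1) (directSumSingle pq.2) (y pq),
    fun pq => ?_⟩
  rw [map_sum, Finset.sum_eq_single pq]
  · exact tensorEval_single_self _ _ _
  · intro rs _ h
    exact tensorEval_single_of_ne h.symm _
  · intro h
    have : y pq = 0 := by simpa using h
    rw [this, map_zero, map_zero]

theorem exists_linearMap_tensorEval {Z W : Type*} [AddCommGroup Z] [Module ℂ Z] [AddCommGroup W]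
    [Module ℂ W] (g : ∀ pq : G × G, Z ⊗[ℂ] W →ₗ[ℂ] A pq.1 ⊗[ℂ] A pq.2)
    (hg : ∀ a b, {pq | g pq (a ⊗ₜ b) ≠ 0}.Finite) :
    ∃ T : Z ⊗[ℂ] W →ₗ[ℂ] directSum A ⊗[ℂ] directSum A,
      ∀ z p q, tensorEval A p q (T z) = g (p, q) z := by
  obtain ⟨T, hT⟩ := jointlyInjective_tensorEval.exists_lift g fun z => by
    induction z with
    | zero => exact ⟨0, fun _ => by simp⟩
    | add z w hz hw =>
      obtain ⟨x, hx⟩ := hz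
      obtain ⟨y, hy⟩ := hw
      exact ⟨x + y, fun i => by rw [map_add, map_add, hx, hy]⟩
    | tmul a b => exact exists_tensorEval_eq _ (hg a b)
  exact ⟨T, fun z p q => hT z (p, q)⟩

/-- Bilinear maps `A_{i(p,q)} × A_{j(p,q)} → A_p ⊗ A_q` combine to a bilinear map on `⊕ A_p`. -/
theorem exists_bilinear_tensorEval (i j : G × G → G)
    (hij : Function.Injective fun pq => (i pq, j pq))
    (t : ∀ pq : G × G, A (i pq) →ₗ[ℂ] A (j pq) →ₗ[ℂ] A pq.1 ⊗[ℂ] A pq.2) :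
    ∃ T : directSum A →ₗ[ℂ] directSum A →ₗ[ℂ] directSum A ⊗[ℂ] directSum A,
      ∀ a b p q, tensorEval A p q (T a b) = t (p, q) (a.1 (i (p, q))) (b.1 (j (p, q))) := by
  obtain ⟨T, hT⟩ := exists_linearMap_tensorEval
    (fun pq => lift (t pq) ∘ₗ map (directSumEval A (i pq)) (directSumEval A (j pq))) fun a b => by
      -- A component can be non-zero only if `i(p,q)` is in the support of `a` and `j(p,q)` in that
      -- of `b`; injectivity of `(i, j)` leaves finitely many `(p, q)`.
      refine ((a.2.prod b.2).preimage (f := fun pq => (i pq, j pq)) hij.injOn).subset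
        fun pq hpq => ?_
      have hpq' : t pq (a.1 (i pq)) (b.1 (j pq)) ≠ 0 := by simpa [directSumEval_apply] using hpq
      constructor
      · intro h
        change a.1 (i pq) = 0 at h
        simp [h] at hpq'
      · intro h
        change b.1 (j pq) = 0 at h
        simp [h] at hpq'
  exact ⟨TensorProduct.curry T, fun a b p q => by simp [hT, directSumEval_apply]⟩

theorem iSupIndep_directSumComponent :
    iSupIndep fun p => (directSumComponent A p).toSubmodule := by
  intro p
  have h : ⨆ q, ⨆ (_ : q ≠ p), (directSumComponent A q).toSubmodule ≤
      LinearMap.ker (directSumEval A p) :=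
    iSup₂_le fun q hq a ha => ha p hq.symm
  refine Disjoint.mono_right h (Submodule.disjoint_def.2 fun a ha hp => ?_)
  rw [← directSumSingle_eval ha, LinearMap.mem_ker.1 hp, map_zero]

theorem iSup_directSumComponent : ⨆ p, (directSumComponent A p).toSubmodule = ⊤ := by
  refine eq_top_iff.2 fun a _ => ?_
  have : a = ∑ p ∈ Set.Finite.toFinset a.2, directSumSingle p (a.1 p) := by
    refine jointlyInjective_directSumEval.eq_of_forall fun q => ?_
    rw [map_sum, Finset.sum_eq_single q]
    · exact (directSumEval_single_self q _).symm
    · exact fun r _ h => directSumEval_single_of_ne h.symm _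
    · intro h
      have : a.1 q = 0 := not_not.1 fun hq => h ((Set.Finite.mem_toFinset _).2 hq)
      rw [this, map_zero, map_zero]
  rw [this]
  exact Submodule.sum_mem _ fun p _ => Submodule.mem_iSup_of_mem p (directSumSingle_mem p _)

theorem map_single_mem_span (p q : G) (x : A p ⊗[ℂ] A q) :
    map (directSumSingle p) (directSumSingle q) x ∈ Submodule.span ℂ
      {y : directSum A ⊗[ℂ] directSum A | ∃ a ∈ directSumComponent A p,
        ∃ b ∈ directSumComponent A q, y = a ⊗ₜ[ℂ] b} := by
  induction x with
  | zero => rw [map_zero]; exact Submodule.zero_mem _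
  | add x y hx hy => rw [map_add]; exact Submodule.add_mem _ hx hy
  | tmul u v =>
    exact Submodule.subset_span ⟨_, directSumSingle_mem p u, _, directSumSingle_mem q v, rfl⟩

/-! #### Existence and uniqueness -/

namespace HopfFamily

variable (D : HopfFamily A)

/-- The family of the `Δ_{p,q}(a(pq))` usually has infinite support, so it is not an element of `A ⊗
A`. It is a multiplier because its action on `u ⊗ v` lives only where `u` and `v` do. -/
theorem exists_comulMultiplier (a : directSum A) :
    ∃ m : Multiplier (directSum A ⊗[ℂ] directSum A), ∀ p q x,
      tensorEval A p q (m.left x) = (D.comul p q (a.1 (p * q))).left (tensorEval A p q x) ∧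
      tensorEval A p q (m.right x) = (D.comul p q (a.1 (p * q))).right (tensorEval A p q x) := by
  have fin : ∀ (f : ∀ pq : G × G, A pq.1 ⊗[ℂ] A pq.2 →ₗ[ℂ] A pq.1 ⊗[ℂ] A pq.2)
      (u v : directSum A), {pq | (f pq ∘ₗ tensorEval A pq.1 pq.2) (u ⊗ₜ v) ≠ 0}.Finite := by
    intro f u v
    refine (u.2.prod v.2).subset fun pq hpq => ⟨fun h => hpq ?_, fun h => hpq ?_⟩
    · simp [directSumEval_apply, show u.1 pq.1 = 0 from h]
    · simp [directSumEval_apply, show v.1 pq.2 = 0 from h]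
  obtain ⟨L, hL⟩ := exists_linearMap_tensorEval (A := A) _
    (fin fun pq => (D.comul pq.1 pq.2 (a.1 (pq.1 * pq.2))).left)
  obtain ⟨R, hR⟩ := exists_linearMap_tensorEval (A := A) _
    (fin fun pq => (D.comul pq.1 pq.2 (a.1 (pq.1 * pq.2))).right)
  simp only [LinearMap.comp_apply] at hL hR
  refine ⟨Multiplier.mk L R (fun x y => ?_) (fun x y => ?_) (fun x y => ?_),
    fun p q x => ⟨hL x p q, hR x p q⟩⟩ <;>
  refine jointlyInjective_tensorEval.eq_of_forall fun pq => ?_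
  · simp only [hL, tensorEval_mul, left_mul_apply]
  · simp only [hR, tensorEval_mul, right_mul_apply]
  · simp only [hL, hR, tensorEval_mul, right_mul_eq]

theorem multiplier_ext_tensorEval {m n : Multiplier (directSum A ⊗[ℂ] directSum A)}
    (h : ∀ p q x, tensorEval A p q (m.left x) = tensorEval A p q (n.left x) ∧
      tensorEval A p q (m.right x) = tensorEval A p q (n.right x)) : m = n :=
  Multiplier.ext (fun x => jointlyInjective_tensorEval.eq_of_forall fun pq => (h pq.1 pq.2 x).1)
    (fun x => jointlyInjective_tensorEval.eq_of_forall fun pq => (h pq.1 pq.2 x).2)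

theorem existsUnique_isDirectSumComul : ∃! Δ, D.IsDirectSumComul Δ := by
  choose Δ hΔ using D.exists_comulMultiplier
  refine ⟨{ toFun := Δ, map_smul' := fun z a => ?_, map_zero' := ?_, map_add' := fun a b => ?_,
            map_mul' := fun a b => ?_ }, fun a p q x => hΔ a p q x, fun Δ' hΔ' => ?_⟩
  · refine multiplier_ext_tensorEval fun p q x => ?_
    simp [hΔ]
  · refine multiplier_ext_tensorEval fun p q x => ?_
    simp [hΔ]
  · refine multiplier_ext_tensorEval fun p q x => ?_
    simp [hΔ]
  · refine multiplier_ext_tensorEval fun p q x => ?_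
    simp [hΔ]
  · refine NonUnitalAlgHom.ext fun a => multiplier_ext_tensorEval fun p q x => ?_
    exact ⟨(hΔ' a p q x).1.trans (hΔ a p q x).1.symm, (hΔ' a p q x).2.trans (hΔ a p q x).2.symm⟩

end HopfFamily

end DirectSum

/-! ### The Hopf structure of the direct sum, component by component -/

section DirectSum

open TensorProduct (map lift)

variable {G : Type*} [Group G] {A : G → Type*} [∀ p, NonUnitalRing (A p)] [∀ p, Module ℂ (A p)]
  [∀ p, IsScalarTower ℂ (A p) (A p)] [∀ p, SMulCommClass ℂ (A p) (A p)]

/-- `n` is the component `m(p, q)` of the multiplier `m` of `A ⊗ A`. -/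
def HasComponent (m : Multiplier (directSum A ⊗[ℂ] directSum A)) {p q : G}
    (n : Multiplier (A p ⊗[ℂ] A q)) : Prop :=
  ∀ x, tensorEval A p q (m.left x) = n.left (tensorEval A p q x) ∧
    tensorEval A p q (m.right x) = n.right (tensorEval A p q x)

namespace HasComponent

theorem mul {m m' : Multiplier (directSum A ⊗[ℂ] directSum A)} {p q : G}
    {n n' : Multiplier (A p ⊗[ℂ] A q)} (h : HasComponent m n) (h' : HasComponent m' n') :
    HasComponent (m * m') (n * n') := fun x => by
  simp [(h _).1, (h' _).1, (h _).2, (h' _).2]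

theorem incl {x : directSum A ⊗[ℂ] directSum A} {p q : G} {y : A p ⊗[ℂ] A q}
    (h : tensorEval A p q x = y) : HasComponent (incl x) (Multiplier.incl y) := fun z => by
  simp [tensorEval_mul, ← h]

theorem oneTmul (b : directSum A) (p q : G) :
    HasComponent (oneTmul (directSum A) b) (Multiplier.oneTmul (A p) (b.1 q)) := fun x => by
  rw [left_oneTmul, left_oneTmul, right_oneTmul, right_oneTmul, TensorProduct.map_map,
    TensorProduct.map_map, TensorProduct.map_map, TensorProduct.map_map]
  exact ⟨rfl, rfl⟩

theorem tmulOne (b : directSum A) (p q : G) :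
    HasComponent (tmulOne (directSum A) b) (Multiplier.tmulOne (A q) (b.1 p)) := fun x => by
  rw [left_tmulOne, left_tmulOne, right_tmulOne, right_tmulOne, TensorProduct.map_map,
    TensorProduct.map_map, TensorProduct.map_map, TensorProduct.map_map]
  exact ⟨rfl, rfl⟩

theorem ext {m m' : Multiplier (directSum A ⊗[ℂ] directSum A)}
    {n : ∀ p q, Multiplier (A p ⊗[ℂ] A q)} (h : ∀ p q, HasComponent m (n p q))
    (h' : ∀ p q, HasComponent m' (n p q)) : m = m' :=
  HopfFamily.multiplier_ext_tensorEval fun p q x =>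
    ⟨(h p q x).1.trans (h' p q x).1.symm, (h p q x).2.trans (h' p q x).2.symm⟩

end HasComponent

theorem castTo_mul {p q : G} (h : p = q) (x y : A p) :
    castTo h (x * y) = castTo h x * castTo h y := by
  subst h; rfl

namespace HopfFamily

variable (D : HopfFamily A)

/-- The antipode as a map `A_{p⁻¹} → A_p`. -/
def antipodeInv (p : G) : A p⁻¹ ≃ₗ[ℂ] A p := (D.antipode p⁻¹).trans (castTo (inv_inv p))

theorem antipodeInv_mul (p : G) (x y : A p⁻¹) :
    D.antipodeInv p (x * y) = D.antipodeInv p y * D.antipodeInv p x := by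
  simp only [antipodeInv, LinearEquiv.trans_apply, D.antipode_mul, castTo_mul]

theorem castTo_antipode (a : ∀ p, A p) {p q : G} (h : p = q) (h' : p⁻¹ = q⁻¹) :
    castTo h' (D.antipode p (a p)) = D.antipode q (a q) := by
  subst h; rfl

/-- The antipode of the sum transports the component at `p⁻¹` to the component at `p`; inversion on
`G` preserves finiteness of supports. -/
theorem exists_directSumAntipode : ∃ S : directSum A ≃ₗ[ℂ] directSum A,
    ∀ a p, directSumEval A p (S a) = D.antipodeInv p (directSumEval A p⁻¹ a) := by
  have hfin : ∀ (f : ∀ p, A p⁻¹ ≃ₗ[ℂ] A p) (a : directSum A),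
      {p | f p (a.1 p⁻¹) ≠ 0}.Finite := fun f a => by
    refine (Set.Finite.preimage inv_injective.injOn a.2).subset fun p hp h => hp ?_
    rw [show a.1 p⁻¹ = 0 from h, map_zero]
  obtain ⟨S, hS⟩ := jointlyInjective_directSumEval.exists_lift
    (fun p => (D.antipodeInv p).toLinearMap ∘ₗ directSumEval A p⁻¹)
    fun a => ⟨⟨fun p => D.antipodeInv p (a.1 p⁻¹), hfin D.antipodeInv a⟩, fun p => rfl⟩
  -- The inverse uses `S_p⁻¹ : A_{p⁻¹} → A_p`, which needs no identification of `(p⁻¹)⁻¹` with `p`.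
  obtain ⟨S', hS'⟩ := jointlyInjective_directSumEval.exists_lift
    (fun p => (D.antipode p).symm.toLinearMap ∘ₗ directSumEval A p⁻¹)
    fun a => ⟨⟨fun p => (D.antipode p).symm (a.1 p⁻¹), hfin (fun p => (D.antipode p).symm) a⟩,
      fun p => rfl⟩
  refine ⟨LinearEquiv.ofLinearMap S S' ?_ ?_, hS⟩
  · refine LinearMap.ext fun a => jointlyInjective_directSumEval.eq_of_forall fun p => ?_
    rw [LinearMap.comp_apply, hS, LinearMap.comp_apply, hS']
    simp only [antipodeInv, LinearMap.comp_apply, LinearEquiv.coe_coe, LinearEquiv.trans_apply,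
      LinearEquiv.apply_symm_apply, LinearMap.id_apply]
    exact castTo_directSumEval _ a
  · refine LinearMap.ext fun a => jointlyInjective_directSumEval.eq_of_forall fun p => ?_
    rw [LinearMap.comp_apply, hS', LinearMap.comp_apply, hS]
    simp only [antipodeInv, LinearMap.comp_apply, LinearEquiv.coe_coe, LinearEquiv.trans_apply,
      LinearMap.id_apply, LinearEquiv.symm_apply_eq]
    exact D.castTo_antipode a.1 (inv_inv p) _

theorem exists_coveredComul : ∃ (t₁ : ∀ p q, A (p * q) →ₗ[ℂ] A q →ₗ[ℂ] A p ⊗[ℂ] A q)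
    (t₂ t₃ : ∀ p q, A (p * q) →ₗ[ℂ] A p →ₗ[ℂ] A p ⊗[ℂ] A q)
    (t₄ : ∀ p q, A (p * q) →ₗ[ℂ] A q →ₗ[ℂ] A p ⊗[ℂ] A q),
    ∀ p q, CoveredComul (D.comul p q) (t₁ p q) (t₂ p q) (t₃ p q) (t₄ p q) := by
  choose t₁ t₂ t₃ t₄ h using fun p q => CogradedMHA.exists_coveredComul (D.nondegenerate p)
    (D.nondegenerate q) (D.comul p q) (D.comul_mul_oneTmul p q) (D.tmulOne_mul_comul p q)
    (D.comul_mul_tmulOne p q) (D.oneTmul_mul_comul p q)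
  exact ⟨t₁, t₂, t₃, t₄, h⟩

variable {D} {t₁ : ∀ p q, A (p * q) →ₗ[ℂ] A q →ₗ[ℂ] A p ⊗[ℂ] A q}
    {t₂ t₃ : ∀ p q, A (p * q) →ₗ[ℂ] A p →ₗ[ℂ] A p ⊗[ℂ] A q}
    {t₄ : ∀ p q, A (p * q) →ₗ[ℂ] A q →ₗ[ℂ] A p ⊗[ℂ] A q}

theorem coassoc_maps
    (ht : ∀ p q, CoveredComul (D.comul p q) (t₁ p q) (t₂ p q) (t₃ p q) (t₄ p q))
    (p q r : G) (a : A (p * q * r)) (b : A r) (c : A p) :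
    TensorProduct.assoc ℂ (A p) (A q) (A r)
        (map ((t₂ p q).flip c) LinearMap.id (t₁ (p * q) r a b)) =
      map LinearMap.id ((t₁ q r).flip b) (t₂ p (q * r) (castTo (mul_assoc p q r) a) c) := by
  have h := D.coassoc p q r a b c _ _ ((ht _ _).incl₁ _ _) ((ht _ _).incl₂ _ _)
  rw [assoc_tmulOne_mul_comulTensorId _ _ (ht p q).incl₂,
    idTensorComul_mul_oneTmul _ _ (ht q r).incl₁] at h
  exact incl_injective
    ((D.nondegenerate p).tensor ((D.nondegenerate q).tensor (D.nondegenerate r))) h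

/-- The bilinear maps of the direct sum with given components. -/
theorem exists_coveredComul_directSum
    (ht : ∀ p q, CoveredComul (D.comul p q) (t₁ p q) (t₂ p q) (t₃ p q) (t₄ p q))
    {Δ : directSum A →ₙₐ[ℂ] Multiplier (directSum A ⊗[ℂ] directSum A)}
    (hΔ : D.IsDirectSumComul Δ) :
    ∃ T₁ T₂ T₃ T₄, CoveredComul Δ T₁ T₂ T₃ T₄ ∧
      (∀ a b p q, tensorEval A p q (T₁ a b) = t₁ p q (a.1 (p * q)) (b.1 q)) ∧
      ∀ a b p q, tensorEval A p q (T₂ a b) = t₂ p q (a.1 (p * q)) (b.1 p) := by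
  have inj₁ : Function.Injective fun pq : G × G => (pq.1 * pq.2, pq.2) := by
    rintro ⟨p, q⟩ ⟨r, s⟩ h
    simp only [Prod.mk.injEq] at h
    obtain ⟨h, rfl⟩ := h
    rw [mul_right_cancel h]
  have inj₂ : Function.Injective fun pq : G × G => (pq.1 * pq.2, pq.1) := by
    rintro ⟨p, q⟩ ⟨r, s⟩ h
    simp only [Prod.mk.injEq] at h
    obtain ⟨h, rfl⟩ := h
    rw [mul_left_cancel h]
  obtain ⟨T₁, hT₁⟩ := exists_bilinear_tensorEval (A := A) (fun pq => pq.1 * pq.2) (fun pq => pq.2)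
    inj₁ fun pq => t₁ pq.1 pq.2
  obtain ⟨T₂, hT₂⟩ := exists_bilinear_tensorEval (A := A) (fun pq => pq.1 * pq.2) (fun pq => pq.1)
    inj₂ fun pq => t₂ pq.1 pq.2
  obtain ⟨T₃, hT₃⟩ := exists_bilinear_tensorEval (A := A) (fun pq => pq.1 * pq.2) (fun pq => pq.1)
    inj₂ fun pq => t₃ pq.1 pq.2
  obtain ⟨T₄, hT₄⟩ := exists_bilinear_tensorEval (A := A) (fun pq => pq.1 * pq.2) (fun pq => pq.2)
    inj₁ fun pq => t₄ pq.1 pq.2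
  have hc : ∀ (a : directSum A) p q, HasComponent (Δ a) (D.comul p q (a.1 (p * q))) :=
    fun a p q x => hΔ a p q x
  have hB := nondegenerateProduct_directSum D.nondegenerate
  refine ⟨T₁, T₂, T₃, T₄, ⟨hB, hB, fun a b => ?_, fun a b => ?_, fun a b => ?_, fun a b => ?_⟩,
    hT₁, hT₂⟩
  · refine HasComponent.ext (fun p q => HasComponent.incl (hT₁ a b p q)) fun p q => ?_
    rw [(ht p q).incl₁]
    exact (hc a p q).mul (HasComponent.oneTmul b p q)
  · refine HasComponent.ext (fun p q => HasComponent.incl (hT₂ a b p q)) fun p q => ?_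
    rw [(ht p q).incl₂]
    exact (HasComponent.tmulOne b p q).mul (hc a p q)
  · refine HasComponent.ext (fun p q => HasComponent.incl (hT₃ a b p q)) fun p q => ?_
    rw [(ht p q).incl₃]
    exact (hc a p q).mul (HasComponent.tmulOne b p q)
  · refine HasComponent.ext (fun p q => HasComponent.incl (hT₄ a b p q)) fun p q => ?_
    rw [(ht p q).incl₄]
    exact (HasComponent.oneTmul b p q).mul (hc a p q)

section Components

variable {Δ : directSum A →ₙₐ[ℂ] Multiplier (directSum A ⊗[ℂ] directSum A)}
  {T₁ T₂ T₃ T₄ : directSum A →ₗ[ℂ] directSum A →ₗ[ℂ] directSum A ⊗[ℂ] directSum A}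

/-- The `(p, q, r)` component of the identity involves only `Δ_{pq,r}`, `Δ_{p,q}` on one side and
`Δ_{p,qr}`, `Δ_{q,r}` on the other, so it is the coassociativity of the family. -/
theorem coassoc_directSum
    (ht : ∀ p q, CoveredComul (D.comul p q) (t₁ p q) (t₂ p q) (t₃ p q) (t₄ p q))
    (hT₁ : ∀ a b p q, tensorEval A p q (T₁ a b) = t₁ p q (a.1 (p * q)) (b.1 q))
    (hT₂ : ∀ a b p q, tensorEval A p q (T₂ a b) = t₂ p q (a.1 (p * q)) (b.1 p))
    (a b c : directSum A) :
    TensorProduct.assoc ℂ _ _ _ (map (T₂.flip c) LinearMap.id (T₁ a b)) =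
      map LinearMap.id (T₁.flip b) (T₂ a c) := by
  refine (jointlyInjective_directSumEval.tensor (jointlyInjective_directSumEval.tensor
    jointlyInjective_directSumEval)).eq_of_forall fun ⟨p, q, r⟩ => ?_
  have e₁ : tensorEval A q r ∘ₗ T₁.flip b = (t₁ q r).flip (b.1 r) ∘ₗ directSumEval A (q * r) := by
    refine LinearMap.ext fun z => ?_
    simp only [LinearMap.comp_apply, LinearMap.flip_apply]
    exact hT₁ z b q r
  have e₂ : tensorEval A p q ∘ₗ T₂.flip c = (t₂ p q).flip (c.1 p) ∘ₗ directSumEval A (p * q) := by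
    refine LinearMap.ext fun z => ?_
    simp only [LinearMap.comp_apply, LinearMap.flip_apply]
    exact hT₂ z c p q
  calc _ = TensorProduct.assoc ℂ (A p) (A q) (A r)
          (map (tensorEval A p q ∘ₗ T₂.flip c) (directSumEval A r) (T₁ a b)) := by
        dsimp only
        rw [TensorProduct.map_map_assoc, TensorProduct.map_map, LinearMap.comp_id]
    _ = TensorProduct.assoc ℂ (A p) (A q) (A r) (map ((t₂ p q).flip (c.1 p)) LinearMap.id
          (tensorEval A (p * q) r (T₁ a b))) := by
        rw [e₂, TensorProduct.map_map, LinearMap.id_comp]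
    _ = map LinearMap.id ((t₁ q r).flip (b.1 r)) (tensorEval A p (q * r) (T₂ a c)) := by
        rw [hT₁, coassoc_maps ht, hT₂, castTo_apply_eval]
    _ = map (directSumEval A p) (tensorEval A q r ∘ₗ T₁.flip b) (T₂ a c) := by
        rw [e₁, TensorProduct.map_map, LinearMap.id_comp]
    _ = _ := by
        dsimp only
        rw [TensorProduct.map_map, LinearMap.comp_id]

/-- The counit of the sum sees only the component at the identity. Evaluated at `p`, the counit
axioms therefore involve only the components `(1, p)` and `(p, 1)`, and the antipode axioms only
`(p⁻¹, p)` and `(p, p⁻¹)`, where they are axioms of the family. -/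
theorem hopfMaps_directSum
    (ht : ∀ p q, CoveredComul (D.comul p q) (t₁ p q) (t₂ p q) (t₃ p q) (t₄ p q))
    (hT : CoveredComul Δ T₁ T₂ T₃ T₄)
    (hT₁ : ∀ a b p q, tensorEval A p q (T₁ a b) = t₁ p q (a.1 (p * q)) (b.1 q))
    (hT₂ : ∀ a b p q, tensorEval A p q (T₂ a b) = t₂ p q (a.1 (p * q)) (b.1 p))
    {S : directSum A ≃ₗ[ℂ] directSum A}
    (hS : ∀ a p, directSumEval A p (S a) = D.antipodeInv p (directSumEval A p⁻¹ a)) :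
    HopfMaps (LinearMap.mul ℂ (directSum A)) T₁ T₂ T₃ T₄
      ((D.counit : A 1 →ₗ[ℂ] ℂ) ∘ₗ directSumEval A 1) S where
  mul_assoc := mul_assoc
  inj_left := hT.nondegenerate_left.jointlyInjective_mulLeft
  inj_right := hT.nondegenerate_left.jointlyInjective_mulRight
  rel₁₂ := hT.rel₁₂
  rel₁₃ := hT.rel₁₃
  rel₁₄ := hT.rel₁₄
  rel₂₃ := hT.rel₂₃
  rel₂₄ := hT.rel₂₄
  rel₃₄ := hT.rel₃₄
  coassoc := coassoc_directSum ht hT₁ hT₂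
  counit_left a b := by
    refine jointlyInjective_directSumEval.eq_of_forall fun p => ?_
    have key : ∀ x, directSumEval A p (TensorProduct.lid ℂ _
        (map ((D.counit : A 1 →ₗ[ℂ] ℂ) ∘ₗ directSumEval A 1) LinearMap.id x)) =
        TensorProduct.lid ℂ _ (map (D.counit : A 1 →ₗ[ℂ] ℂ) LinearMap.id (tensorEval A 1 p x)) := by
      intro x
      induction x with
      | zero => simp
      | add x y hx hy => simp only [map_add, hx, hy]
      | tmul u v => simp
    rw [key, hT₁, ← castTo_apply_eval a.1 (one_mul p).symm]
    exact D.counit_left p _ _ _ ((ht 1 p).incl₁ _ _)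
  counit_right a b := by
    refine jointlyInjective_directSumEval.eq_of_forall fun p => ?_
    have key : ∀ x, directSumEval A p (TensorProduct.rid ℂ _
        (map LinearMap.id ((D.counit : A 1 →ₗ[ℂ] ℂ) ∘ₗ directSumEval A 1) x)) =
        TensorProduct.rid ℂ _ (map LinearMap.id (D.counit : A 1 →ₗ[ℂ] ℂ) (tensorEval A p 1 x)) := by
      intro x
      induction x with
      | zero => simp
      | add x y hx hy => simp only [map_add, hx, hy]
      | tmul u v => simp
    rw [key, hT₂, ← castTo_apply_eval a.1 (mul_one p).symm]
    exact D.counit_right p _ _ _ ((ht p 1).incl₂ _ _)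
  antipode_mul a b := by
    refine jointlyInjective_directSumEval.eq_of_forall fun p => ?_
    simp only [LinearMap.mul_apply_apply]
    rw [directSumEval_mul, hS, hS, hS, directSumEval_mul, antipodeInv_mul]
  antipode_left a b := by
    refine jointlyInjective_directSumEval.eq_of_forall fun p => ?_
    have key : ∀ x, directSumEval A p (lift (LinearMap.mul ℂ (directSum A))
        (map S.toLinearMap LinearMap.id x)) = LinearMap.mul' ℂ (A p)
          (map (D.antipodeInv p).toLinearMap LinearMap.id (tensorEval A p⁻¹ p x)) := by
      intro x
      induction x with
      | zero => simp
      | add x y hx hy => simp only [map_add, hx, hy]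
      | tmul u v => simp [directSumEval_mul, hS]
    rw [key, hT₁, ← castTo_apply_eval a.1 (inv_mul_cancel p).symm, map_smul]
    exact D.antipode_left p _ _ _ ((ht p⁻¹ p).incl₁ _ _)
  antipode_right a b := by
    refine jointlyInjective_directSumEval.eq_of_forall fun p => ?_
    have key : ∀ x, directSumEval A p (lift (LinearMap.mul ℂ (directSum A))
        (map LinearMap.id S.toLinearMap x)) = LinearMap.mul' ℂ (A p)
          (map LinearMap.id (D.antipodeInv p).toLinearMap (tensorEval A p p⁻¹ x)) := by
      intro x
      induction x with
      | zero => simp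
      | add x y hx hy => simp only [map_add, hx, hy]
      | tmul u v => simp [directSumEval_mul, hS]
    rw [key, hT₂, ← castTo_apply_eval a.1 (mul_inv_cancel p).symm, map_smul]
    exact D.antipode_right p _ _ _ ((ht p p⁻¹).incl₂ _ _)

end Components

end HopfFamily

end DirectSum

/-! ### Graded surjectivity and the cograding of the direct sum -/

section DirectSum

open TensorProduct (map lift)

variable {G : Type*} [Group G] {A : G → Type*} [∀ p, NonUnitalRing (A p)] [∀ p, Module ℂ (A p)]
  [∀ p, IsScalarTower ℂ (A p) (A p)] [∀ p, SMulCommClass ℂ (A p) (A p)]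

section GradedMap

variable {T : directSum A →ₗ[ℂ] directSum A →ₗ[ℂ] directSum A ⊗[ℂ] directSum A} {i j : G → G → G}
  {t : ∀ p q, A (i p q) →ₗ[ℂ] A (j p q) →ₗ[ℂ] A p ⊗[ℂ] A q}

theorem tensorEval_lift
    (hT : ∀ a b p q, tensorEval A p q (T a b) = t p q (a.1 (i p q)) (b.1 (j p q))) (p q : G)
    (z : directSum A ⊗[ℂ] directSum A) :
    tensorEval A p q (lift T z) = lift (t p q) (tensorEval A (i p q) (j p q) z) := by
  induction z with
  | zero => simp
  | add x y hx hy => simp only [map_add, hx, hy]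
  | tmul a b =>
    rw [TensorProduct.lift.tmul, hT, TensorProduct.map_tmul, TensorProduct.lift.tmul]
    rfl

theorem surjective_lift_component
    (hT : ∀ a b p q, tensorEval A p q (T a b) = t p q (a.1 (i p q)) (b.1 (j p q)))
    (hs : Function.Surjective (lift T)) (p q : G) : Function.Surjective (lift (t p q)) := by
  intro y
  obtain ⟨z, hz⟩ := hs (map (directSumSingle p) (directSumSingle q) y)
  exact ⟨tensorEval A _ _ z, by rw [← tensorEval_lift hT, hz, tensorEval_single_self]⟩

theorem map_single_tensorEval {p q : G} {x : directSum A ⊗[ℂ] directSum A}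
    (hx : ∀ r s, (r, s) ≠ (p, q) → tensorEval A r s x = 0) :
    map (directSumSingle p) (directSumSingle q) (tensorEval A p q x) = x := by
  refine jointlyInjective_tensorEval.eq_of_forall fun ⟨r, s⟩ => ?_
  by_cases h : (r, s) = (p, q)
  · obtain ⟨rfl, rfl⟩ := Prod.mk.injEq .. ▸ h
    exact tensorEval_single_self _ _ _
  · exact (tensorEval_single_of_ne h _).trans (hx r s h).symm

/-- The component of `T z` at `(p, q)` depends only on the component of `z` at `(i(p,q), j(p,q))`,
and these index pairs are distinct for distinct `(p, q)`. Surjectivity of `T` is thus inherited by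
each homogeneous part. -/
theorem span_graded_eq (hij : Function.Injective fun pq : G × G => (i pq.1 pq.2, j pq.1 pq.2))
    (hT : ∀ a b p q, tensorEval A p q (T a b) = t p q (a.1 (i p q)) (b.1 (j p q)))
    (hs : Function.Surjective (lift T)) (p q : G) :
    Submodule.span ℂ {y | ∃ a ∈ directSumComponent A (i p q), ∃ b ∈ directSumComponent A (j p q),
        y = T a b} =
      Submodule.span ℂ {y | ∃ a ∈ directSumComponent A p, ∃ b ∈ directSumComponent A q,
        y = a ⊗ₜ[ℂ] b} := by
  apply le_antisymm
  · refine Submodule.span_le.2 ?_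
    rintro _ ⟨a, ha, b, hb, rfl⟩
    rw [← map_single_tensorEval (p := p) (q := q) (x := T a b)]
    · exact map_single_mem_span p q _
    · intro r s h
      rw [hT]
      by_cases hi : i r s = i p q
      · have hj : j r s ≠ j p q := fun hj => h (hij (by simp [hi, hj]))
        rw [hb _ hj, map_zero]
      · rw [ha _ hi, map_zero, LinearMap.zero_apply]
  · refine Submodule.span_le.2 ?_
    rintro _ ⟨a, ha, b, hb, rfl⟩
    obtain ⟨z, hz⟩ := hs (a ⊗ₜ b)
    -- A preimage of a homogeneous tensor can be truncated to its one relevant component.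
    have hz' : lift T (map (directSumSingle (i p q)) (directSumSingle (j p q))
        (tensorEval A (i p q) (j p q) z)) = a ⊗ₜ b := by
      refine jointlyInjective_tensorEval.eq_of_forall fun ⟨r, s⟩ => ?_
      dsimp only
      rw [tensorEval_lift hT]
      by_cases h : (r, s) = (p, q)
      · obtain ⟨rfl, rfl⟩ := Prod.mk.injEq .. ▸ h
        rw [tensorEval_single_self, ← tensorEval_lift hT, hz]
      · rw [tensorEval_single_of_ne fun h' => h (hij h'), map_zero, TensorProduct.map_tmul]
        by_cases hr : r = p
        · have hs : s ≠ q := fun hs => h (by rw [hr, hs])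
          rw [show directSumEval A s b = 0 from hb s hs, TensorProduct.tmul_zero]
        · rw [show directSumEval A r a = 0 from ha r hr, TensorProduct.zero_tmul]
    rw [SetLike.mem_coe, ← hz']
    have := Submodule.mem_map_of_mem (f := lift T) (map_single_mem_span (i p q) (j p q)
      (tensorEval A (i p q) (j p q) z))
    rw [Submodule.map_span] at this
    refine Submodule.span_mono ?_ this
    rintro _ ⟨_, ⟨u, hu, v, hv, rfl⟩, rfl⟩
    exact ⟨u, hu, v, hv, by simp⟩

end GradedMap

theorem span_incl_eq {B : Type*} [NonUnitalRing B] [Module ℂ B] [IsScalarTower ℂ B B]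
    [SMulCommClass ℂ B B] {s t : Set B} (h : Submodule.span ℂ s = Submodule.span ℂ t) :
    Submodule.span ℂ (incl '' s) = Submodule.span ℂ (incl '' t) := by
  have e : ∀ s : Set B, Submodule.span ℂ (incl '' s) = (Submodule.span ℂ s).map
      ((inclHom : B →ₙₐ[ℂ] Multiplier B) : B →ₗ[ℂ] Multiplier B) :=
    fun s => by rw [Submodule.map_span]; rfl
  rw [e, e, h]

namespace HopfFamily

variable {D : HopfFamily A}

theorem isRegular_and_isWeakCograding
    {Δ : directSum A →ₙₐ[ℂ] Multiplier (directSum A ⊗[ℂ] directSum A)}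
    (hΔ : D.IsDirectSumComul Δ) :
    IsRegularMultiplierHopf Δ ∧ IsWeakCograding Δ (directSumComponent A) := by
  obtain ⟨t₁, t₂, t₃, t₄, ht⟩ := D.exists_coveredComul
  obtain ⟨T₁, T₂, T₃, T₄, hT, hT₁, hT₂⟩ := exists_coveredComul_directSum ht hΔ
  obtain ⟨S, hS⟩ := D.exists_directSumAntipode
  have hH := hopfMaps_directSum ht hT hT₁ hT₂ hS
  refine ⟨hH.isRegularMultiplierHopf hT, iSupIndep_directSumComponent, iSup_directSumComponent,
    fun p q hpq a ha b hb => ?_, fun p q => ?_, fun p q => ?_⟩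
  · refine jointlyInjective_directSumEval _ fun r => ?_
    rw [directSumEval_mul]
    by_cases hr : r = p
    · rw [show directSumEval A r b = 0 from hb r fun h => hpq (hr.symm.trans h), mul_zero]
    · rw [show directSumEval A r a = 0 from ha r hr, zero_mul]
  · have hij : Function.Injective fun pq : G × G => (pq.1 * pq.2, pq.2) := by
      rintro ⟨p, q⟩ ⟨r, s⟩ h
      simp only [Prod.mk.injEq] at h
      obtain ⟨h, rfl⟩ := h
      rw [mul_right_cancel h]
    convert span_incl_eq (B := directSum A ⊗[ℂ] directSum A) (span_graded_eq (i := fun p q => p * q) (j := fun _ q => q) hij hT₁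
      hH.bijective_lift_t₁.2 p q) using 2
    · ext m
      constructor
      · rintro ⟨a, ha, b, hb, rfl⟩
        exact ⟨_, ⟨a, ha, b, hb, rfl⟩, hT.incl₁ a b⟩
      · rintro ⟨_, ⟨a, ha, b, hb, rfl⟩, rfl⟩
        exact ⟨a, ha, b, hb, hT.incl₁ a b⟩
    · ext m
      constructor
      · rintro ⟨a, ha, b, hb, rfl⟩
        exact ⟨_, ⟨a, ha, b, hb, rfl⟩, rfl⟩
      · rintro ⟨_, ⟨a, ha, b, hb, rfl⟩, rfl⟩
        exact ⟨a, ha, b, hb, rfl⟩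
  · have hij : Function.Injective fun pq : G × G => (pq.1 * pq.2, pq.1) := by
      rintro ⟨p, q⟩ ⟨r, s⟩ h
      simp only [Prod.mk.injEq] at h
      obtain ⟨h, rfl⟩ := h
      rw [mul_left_cancel h]
    have hs : Function.Surjective (lift T₂) := by
      have e : lift T₂ = lift T₂.flip ∘ₗ (TensorProduct.comm ℂ _ _).toLinearMap := by
        ext a b; simp
      rw [e]
      exact hH.bijective_lift_t₂_flip.2.comp (TensorProduct.comm ℂ _ _).surjective
    convert span_incl_eq (B := directSum A ⊗[ℂ] directSum A) (span_graded_eq (i := fun p q => p * q) (j := fun p _ => p) hij hT₂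
      hs p q) using 2
    · ext m
      constructor
      · rintro ⟨a, ha, b, hb, rfl⟩
        exact ⟨_, ⟨b, hb, a, ha, rfl⟩, hT.incl₂ b a⟩
      · rintro ⟨_, ⟨b, hb, a, ha, rfl⟩, rfl⟩
        exact ⟨a, ha, b, hb, hT.incl₂ b a⟩
    · ext m
      constructor
      · rintro ⟨a, ha, b, hb, rfl⟩
        exact ⟨_, ⟨a, ha, b, hb, rfl⟩, rfl⟩
      · rintro ⟨_, ⟨a, ha, b, hb, rfl⟩, rfl⟩
        exact ⟨a, ha, b, hb, rfl⟩

theorem nontrivial_directSumComponent (p : G) [Nontrivial (A p)] :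
    Nontrivial (directSumComponent A p) := by
  obtain ⟨x, hx⟩ := exists_ne (0 : A p)
  refine ⟨⟨⟨_, directSumSingle_mem p x⟩, 0, fun h => hx ?_⟩⟩
  rw [← directSumEval_single_self p x, show directSumSingle p x = 0 from congrArg Subtype.val h,
    map_zero]

/-- `Δ_{p,q}(A_{pq})(1 ⊗ A_q) = A_p ⊗ A_q`. -/
theorem surjective_comul_mul_oneTmul (D : HopfFamily A) (p q : G) (x : A p ⊗[ℂ] A q) :
    ∃ z : A (p * q) ⊗[ℂ] A q, incl x =
      lift ((LinearMap.mul ℂ (Multiplier (A p ⊗[ℂ] A q))).compl₁₂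
        (D.comul p q : A (p * q) →ₗ[ℂ] Multiplier (A p ⊗[ℂ] A q)) (oneTmulHom (A p))) z := by
  obtain ⟨t₁, t₂, t₃, t₄, ht⟩ := D.exists_coveredComul
  obtain ⟨Δ, hΔ, -⟩ := D.existsUnique_isDirectSumComul
  obtain ⟨T₁, T₂, T₃, T₄, hT, hT₁, hT₂⟩ := exists_coveredComul_directSum ht hΔ
  obtain ⟨S, hS⟩ := D.exists_directSumAntipode
  have hH := hopfMaps_directSum ht hT hT₁ hT₂ hS
  -- The bijection is known for the whole direct sum, through its antipode, and surjectivity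
  -- descends to the component.
  obtain ⟨z, rfl⟩ := surjective_lift_component (i := fun p q => p * q) (j := fun _ q => q)
    hT₁ hH.bijective_lift_t₁.2 p q x
  refine ⟨z, ?_⟩
  induction z with
  | zero => simp [incl_zero]
  | add x y hx hy => simp only [map_add, incl_add, hx, hy]
  | tmul a b => simp [(ht p q).incl₁, oneTmulHom_apply]

end HopfFamily

end DirectSum

/-! ### Unital algebras -/

section Unital

open TensorProduct (map lift)

theorem nondegenerateProduct_of_ring (A : Type*) [Ring A] : NondegenerateProduct A :=
  ⟨fun a h => by simpa using h 1, fun a h => by simpa using h 1⟩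

section Multiplier

variable {A B : Type*} [Ring A] [Algebra ℂ A] [Ring B] [Algebra ℂ B]

theorem incl_one : incl (1 : A) = 1 := by
  ext x <;> simp

theorem incl_left_one (m : Multiplier A) : incl (m.left 1) = m := by
  rw [← mul_incl, incl_one, mul_one]

theorem oneTmul_eq_incl (b : B) : oneTmul A b = incl ((1 : A) ⊗ₜ[ℂ] b) := by
  rw [incl_tmul, incl_one]; rfl

theorem tmulOne_eq_incl (a : A) : tmulOne B a = incl (a ⊗ₜ[ℂ] (1 : B)) := by
  rw [incl_tmul, incl_one]; rfl

theorem incl_injective_tensor : Function.Injective (incl : A ⊗[ℂ] B → Multiplier (A ⊗[ℂ] B)) :=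
  Multiplier.incl_injective
    ((nondegenerateProduct_of_ring A).tensor (nondegenerateProduct_of_ring B))

end Multiplier

variable {G : Type*} [Group G]

theorem HopfFamily.eq_of_data_eq {A : G → Type*} [∀ p, NonUnitalRing (A p)] [∀ p, Module ℂ (A p)]
    [∀ p, IsScalarTower ℂ (A p) (A p)] [∀ p, SMulCommClass ℂ (A p) (A p)] {D D' : HopfFamily A}
    (h₁ : D.comul = D'.comul) (h₂ : D.counit = D'.counit) (h₃ : D.antipode = D'.antipode) :
    D = D' := by
  cases D; cases D'
  congr

variable {A : G → Type*} [∀ p, Ring (A p)] [∀ p, Algebra ℂ (A p)]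

namespace HopfGroupCoalgebra

theorem eq_of_data_eq {T T' : HopfGroupCoalgebra A}
    (h₁ : T.comul = T'.comul) (h₂ : T.counit = T'.counit) (h₃ : T.antipode = T'.antipode) :
    T = T' := by
  cases T; cases T'
  congr

variable (T : HopfGroupCoalgebra A)

/-- The multiplier-valued comultiplication. -/
def multiplierComul (p q : G) : A (p * q) →ₙₐ[ℂ] Multiplier (A p ⊗[ℂ] A q) :=
  (inclHom : A p ⊗[ℂ] A q →ₙₐ[ℂ] Multiplier (A p ⊗[ℂ] A q)).comp
    (T.comul p q : A (p * q) →ₙₐ[ℂ] A p ⊗[ℂ] A q)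

theorem multiplierComul_apply (p q : G) (a : A (p * q)) :
    T.multiplierComul p q a = incl (T.comul p q a) := rfl

/-- `Δ(a)(1 ⊗ b)`. -/
noncomputable def comulMulRight (p q : G) : A (p * q) →ₗ[ℂ] A q →ₗ[ℂ] A p ⊗[ℂ] A q :=
  (LinearMap.mul ℂ (A p ⊗[ℂ] A q)).compl₁₂ (T.comul p q).toLinearMap (TensorProduct.mk ℂ _ _ 1)

/-- `(b ⊗ 1)Δ(a)`. -/
noncomputable def comulMulLeft (p q : G) : A (p * q) →ₗ[ℂ] A p →ₗ[ℂ] A p ⊗[ℂ] A q :=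
  (LinearMap.mul ℂ (A p ⊗[ℂ] A q)).flip.compl₁₂ (T.comul p q).toLinearMap
    ((TensorProduct.mk ℂ _ _).flip 1)

theorem comulMulRight_apply (p q : G) (a : A (p * q)) (b : A q) :
    T.comulMulRight p q a b = T.comul p q a * 1 ⊗ₜ b := rfl

theorem comulMulLeft_apply (p q : G) (a : A (p * q)) (b : A p) :
    T.comulMulLeft p q a b = b ⊗ₜ 1 * T.comul p q a := rfl

theorem incl_comulMulRight (p q : G) (a : A (p * q)) (b : A q) :
    incl (T.comulMulRight p q a b) = T.multiplierComul p q a * oneTmul (A p) b := by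
  rw [comulMulRight_apply, multiplierComul_apply, oneTmul_eq_incl, ← incl_mul]

theorem incl_comulMulLeft (p q : G) (a : A (p * q)) (b : A p) :
    incl (T.comulMulLeft p q a b) = tmulOne (A q) b * T.multiplierComul p q a := by
  rw [comulMulLeft_apply, multiplierComul_apply, tmulOne_eq_incl, ← incl_mul]

theorem eq_comul_mul {p q : G} {a : A (p * q)} {b : A q} {x : A p ⊗[ℂ] A q}
    (hx : incl x = T.multiplierComul p q a * oneTmul (A p) b) : x = T.comul p q a * 1 ⊗ₜ b :=
  incl_injective_tensor (by rw [hx, ← incl_comulMulRight, comulMulRight_apply])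

theorem eq_mul_comul {p q : G} {a : A (p * q)} {b : A p} {x : A p ⊗[ℂ] A q}
    (hx : incl x = tmulOne (A q) b * T.multiplierComul p q a) : x = b ⊗ₜ 1 * T.comul p q a :=
  incl_injective_tensor (by rw [hx, ← incl_comulMulLeft, comulMulLeft_apply])

/-- With `map_comulMulRight`, this shows that the covered coassociativity is Turaev's multiplied by
`c ⊗ 1 ⊗ 1` on the left and `1 ⊗ 1 ⊗ b` on the right. -/
theorem assoc_map_comulMulLeft (p q r : G) (b : A r) (c : A p) (x : A (p * q) ⊗[ℂ] A r) :
    TensorProduct.assoc ℂ (A p) (A q) (A r)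
        (map ((T.comulMulLeft p q).flip c) LinearMap.id (x * 1 ⊗ₜ b)) =
      c ⊗ₜ 1 * TensorProduct.assoc ℂ (A p) (A q) (A r)
        (map (T.comul p q).toLinearMap LinearMap.id x) * 1 ⊗ₜ (1 ⊗ₜ b) := by
  induction x with
  | zero => simp
  | add x y hx hy => simp only [map_add, add_mul, mul_add, hx, hy]
  | tmul u v =>
    simp only [Algebra.TensorProduct.tmul_mul_tmul, mul_one, TensorProduct.map_tmul,
      LinearMap.id_apply, LinearMap.flip_apply, comulMulLeft_apply, AlgHom.toLinearMap_apply]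
    induction T.comul p q u with
    | zero => simp
    | add x y hx hy => simp only [map_add, add_mul, mul_add, TensorProduct.add_tmul, hx, hy]
    | tmul w z => simp [Algebra.TensorProduct.one_def]

theorem map_comulMulRight (p q r : G) (b : A r) (c : A p) (x : A p ⊗[ℂ] A (q * r)) :
    map LinearMap.id ((T.comulMulRight q r).flip b) (c ⊗ₜ 1 * x) =
      c ⊗ₜ 1 * map LinearMap.id (T.comul q r).toLinearMap x * 1 ⊗ₜ (1 ⊗ₜ b) := by
  induction x with
  | zero => simp
  | add x y hx hy => simp only [map_add, add_mul, mul_add, hx, hy]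
  | tmul u v => simp [comulMulRight_apply]

/-- A Hopf `G`-coalgebra as a Hopf family. -/
noncomputable def toHopfFamily : HopfFamily A where
  nondegenerate p := nondegenerateProduct_of_ring (A p)
  comul := T.multiplierComul
  comul_mul_oneTmul p q a b := ⟨_, T.incl_comulMulRight p q a b⟩
  tmulOne_mul_comul p q a b := ⟨_, T.incl_comulMulLeft p q a b⟩
  oneTmul_mul_comul p q a b :=
    ⟨1 ⊗ₜ b * T.comul p q a, by rw [oneTmul_eq_incl, multiplierComul_apply, ← incl_mul]⟩
  comul_mul_tmulOne p q a b :=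
    ⟨T.comul p q a * b ⊗ₜ 1, by rw [tmulOne_eq_incl, multiplierComul_apply, ← incl_mul]⟩
  coassoc p q r a b c x y hx hy := by
    rw [assoc_tmulOne_mul_comulTensorId _ _ (T.incl_comulMulLeft p q),
      idTensorComul_mul_oneTmul _ _ (T.incl_comulMulRight q r), T.eq_comul_mul hx,
      T.eq_mul_comul hy, assoc_map_comulMulLeft, map_comulMulRight, T.coassoc]
  counit := (T.counit : A 1 →ₙₐ[ℂ] ℂ)
  counit_right p a b x hx := by
    have key : ∀ y : A p ⊗[ℂ] A 1, TensorProduct.rid ℂ (A p)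
        (map LinearMap.id T.counit.toLinearMap (a ⊗ₜ 1 * y)) =
        a * TensorProduct.rid ℂ (A p) (map LinearMap.id T.counit.toLinearMap y) := by
      intro y
      induction y with
      | zero => simp
      | add x y hx hy => simp only [map_add, mul_add, hx, hy]
      | tmul u v => simp
    rw [T.eq_mul_comul hx]
    exact (key _).trans (by rw [T.counit_right])
  counit_left p a b x hx := by
    have key : ∀ y : A 1 ⊗[ℂ] A p, TensorProduct.lid ℂ (A p)
        (map T.counit.toLinearMap LinearMap.id (y * 1 ⊗ₜ b)) =
        TensorProduct.lid ℂ (A p) (map T.counit.toLinearMap LinearMap.id y) * b := by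
      intro y
      induction y with
      | zero => simp
      | add x y hx hy => simp only [map_add, add_mul, hx, hy]
      | tmul u v => simp
    rw [T.eq_comul_mul hx]
    exact (key _).trans (by rw [T.counit_left])
  antipode := T.antipode
  antipode_mul := T.antipode_mul
  antipode_left p a b x hx := by
    have key : ∀ (f : A p⁻¹ →ₗ[ℂ] A p) (y : A p⁻¹ ⊗[ℂ] A p),
        LinearMap.mul' ℂ (A p) (map f LinearMap.id (y * 1 ⊗ₜ b)) =
          LinearMap.mul' ℂ (A p) (map f LinearMap.id y) * b := by
      intro f y
      induction y with
      | zero => simp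
      | add x y hx hy => simp only [map_add, add_mul, hx, hy]
      | tmul u v => simp [mul_assoc]
    rw [T.eq_comul_mul hx, key, T.antipode_left, smul_mul_assoc, one_mul]
    rfl
  antipode_right p a b x hx := by
    have key : ∀ (f : A p⁻¹ →ₗ[ℂ] A p) (y : A p ⊗[ℂ] A p⁻¹),
        LinearMap.mul' ℂ (A p) (map LinearMap.id f (b ⊗ₜ 1 * y)) =
          b * LinearMap.mul' ℂ (A p) (map LinearMap.id f y) := by
      intro f y
      induction y with
      | zero => simp
      | add x y hx hy => simp only [map_add, mul_add, hx, hy]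
      | tmul u v => simp [mul_assoc]
    rw [T.eq_mul_comul hx, key, T.antipode_right, mul_smul_comm, mul_one]
    rfl

theorem existsUnique_sameData : ∃! D : HopfFamily A, T.SameData D := by
  refine ⟨T.toHopfFamily, ⟨fun p q a => rfl, fun a => rfl, fun p a => rfl⟩, fun D hD => ?_⟩
  refine HopfFamily.eq_of_data_eq ?_ ?_ ?_
  · funext p q
    exact NonUnitalAlgHom.ext fun a => hD.comul p q a
  · exact NonUnitalAlgHom.ext fun a => hD.counit a
  · funext p
    exact LinearEquiv.ext fun a => hD.antipode p a

end HopfGroupCoalgebra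

namespace HopfFamily

variable (D : HopfFamily A)

/-- `Δ(1)` fixes every `Δ(a)(1 ⊗ b)` under left multiplication, and these elements span `A_p ⊗ A_q`,
which contains the identity. -/
theorem comul_one (p q : G) : D.comul p q 1 = 1 := by
  obtain ⟨z, hz⟩ := D.surjective_comul_mul_oneTmul p q 1
  have key : ∀ z, D.comul p q 1 *
      lift ((LinearMap.mul ℂ (Multiplier (A p ⊗[ℂ] A q))).compl₁₂
        (D.comul p q : A (p * q) →ₗ[ℂ] Multiplier (A p ⊗[ℂ] A q)) (oneTmulHom (A p))) z =
      lift ((LinearMap.mul ℂ (Multiplier (A p ⊗[ℂ] A q))).compl₁₂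
        (D.comul p q : A (p * q) →ₗ[ℂ] Multiplier (A p ⊗[ℂ] A q)) (oneTmulHom (A p))) z := by
    intro z
    induction z with
    | zero => simp
    | add x y hx hy => simp only [map_add, mul_add, hx, hy]
    | tmul a b =>
      simp only [TensorProduct.lift.tmul, LinearMap.compl₁₂_apply, LinearMap.mul_apply_apply]
      rw [← mul_assoc]
      congr 1
      exact ((D.comul p q).map_mul 1 a).symm.trans (by rw [one_mul]; rfl)
  have := key z
  rw [← hz, incl_one, mul_one] at this
  exact this

/-- `ε(1)` is an idempotent of `ℂ`. If it were `0`, then `ε = 0`, and the counit identity at `a = b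
= 1` would give `1 = 0` in `A_e`. -/
theorem counit_one [Nontrivial (A 1)] : D.counit 1 = 1 := by
  have h : D.counit 1 * D.counit 1 = D.counit 1 := by rw [← map_mul, mul_one]
  by_contra hne
  have h0 : D.counit 1 = 0 := by
    by_contra h0
    exact hne (mul_left_cancel₀ h0 (h.trans (mul_one _).symm))
  have hz : (D.counit : A 1 →ₗ[ℂ] ℂ) = 0 := by
    ext a
    change D.counit a = 0
    rw [← mul_one a, map_mul, h0, mul_zero]
  obtain ⟨x, hx⟩ := D.comul_mul_oneTmul 1 1 (castTo (one_mul 1).symm 1) 1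
  have := D.counit_left 1 1 1 x hx
  rw [hz, TensorProduct.map_zero_left] at this
  simp at this

/-- The comultiplication with values in `A_p ⊗ A_q = M(A_p ⊗ A_q)`. -/
noncomputable def tensorComul (p q : G) : A (p * q) →ₐ[ℂ] A p ⊗[ℂ] A q :=
  AlgHom.ofLinearMap
    { toFun := fun a => (D.comul p q a).left 1
      map_add' := fun a b => by simp
      map_smul' := fun z a => by simp }
    (by simp [D.comul_one])
    (fun a b => incl_injective_tensor (by
      rw [incl_mul]
      simp only [LinearMap.coe_mk, AddHom.coe_mk, incl_left_one, map_mul]))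

theorem incl_tensorComul (p q : G) (a : A (p * q)) :
    incl (D.tensorComul p q a) = D.comul p q a := incl_left_one _

theorem incl_tensorComul_eq_mul_oneTmul (p q : G) (a : A (p * q)) :
    incl (D.tensorComul p q a) = D.comul p q a * oneTmul (A p) (1 : A q) := by
  rw [incl_tensorComul, oneTmul_eq_incl, ← Algebra.TensorProduct.one_def, incl_one, mul_one]

theorem incl_tensorComul_eq_tmulOne_mul (p q : G) (a : A (p * q)) :
    incl (D.tensorComul p q a) = tmulOne (A q) (1 : A p) * D.comul p q a := by
  rw [incl_tensorComul, tmulOne_eq_incl, ← Algebra.TensorProduct.one_def, incl_one, one_mul]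

/-- A Hopf family on unital algebras as a Hopf `G`-coalgebra. -/
noncomputable def toHopfGroupCoalgebra [Nontrivial (A 1)] : HopfGroupCoalgebra A where
  comul := D.tensorComul
  coassoc p q r a := by
    obtain ⟨t₁, t₂, t₃, t₄, ht⟩ := D.exists_coveredComul
    -- Turaev's identities are the covered ones with the covering elements equal to `1`.
    have h₁ : ∀ p q a, t₁ p q a 1 = D.tensorComul p q a := fun p q a =>
      incl_injective_tensor (by rw [(ht p q).incl₁, incl_tensorComul_eq_mul_oneTmul])
    have h₂ : ∀ p q a, t₂ p q a 1 = D.tensorComul p q a := fun p q a =>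
      incl_injective_tensor (by rw [(ht p q).incl₂, incl_tensorComul_eq_tmulOne_mul])
    have e₁ : (t₁ q r).flip 1 = (D.tensorComul q r).toLinearMap := LinearMap.ext (h₁ q r)
    have e₂ : (t₂ p q).flip 1 = (D.tensorComul p q).toLinearMap := LinearMap.ext (h₂ p q)
    rw [← e₁, ← e₂, ← h₁, ← h₂]
    exact coassoc_maps ht p q r a 1 1
  counit := AlgHom.ofLinearMap (D.counit : A 1 →ₗ[ℂ] ℂ) D.counit_one (map_mul D.counit)
  counit_right p a := by
    have := D.counit_right p 1 a _ (D.incl_tensorComul_eq_tmulOne_mul p 1 _)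
    rwa [one_mul] at this
  counit_left p a := by
    have := D.counit_left p a 1 _ (D.incl_tensorComul_eq_mul_oneTmul 1 p _)
    rwa [mul_one] at this
  antipode := D.antipode
  antipode_mul := D.antipode_mul
  antipode_left p a := D.antipode_left p a 1 _ (D.incl_tensorComul_eq_mul_oneTmul _ _ _)
  antipode_right p a := D.antipode_right p a 1 _ (D.incl_tensorComul_eq_tmulOne_mul _ _ _)

theorem existsUnique_sameData [Nontrivial (A 1)] : ∃! T : HopfGroupCoalgebra A, T.SameData D := by
  refine ⟨D.toHopfGroupCoalgebra,
    ⟨fun p q a => (D.incl_tensorComul p q a).symm, fun a => rfl, fun p a => rfl⟩, fun T hT => ?_⟩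
  refine HopfGroupCoalgebra.eq_of_data_eq ?_ ?_ ?_
  · funext p q
    refine AlgHom.ext fun a => incl_injective_tensor ?_
    exact (hT.comul p q a).symm.trans (D.incl_tensorComul p q a).symm
  · exact AlgHom.ext fun a => (hT.counit a).symm
  · funext p
    exact LinearEquiv.ext fun a => (hT.antipode p a).symm

end HopfFamily

end Unital

/-! ### The counit and the antipode of a multiplier Hopf algebra -/

section GaloisMaps

open TensorProduct (map lift)

variable {A : Type*} [NonUnitalRing A] [Module ℂ A] [IsScalarTower ℂ A A] [SMulCommClass ℂ A A]

/-- The bijections `T₁(a ⊗ b) = Δ(a)(1 ⊗ b)` and `T₂(a ⊗ b) = (a ⊗ 1)Δ(b)` of a multiplier Hopf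
algebra. -/
structure GaloisMaps (Δ : A →ₙₐ[ℂ] Multiplier (A ⊗[ℂ] A)) (T₁ T₂ : A ⊗[ℂ] A ≃ₗ[ℂ] A ⊗[ℂ] A) :
    Prop where
  nondegenerate : NondegenerateProduct A
  incl₁ : ∀ a b, incl (T₁ (a ⊗ₜ b)) = Δ a * oneTmul A b
  incl₂ : ∀ a b, incl (T₂ (a ⊗ₜ b)) = tmulOne A a * Δ b
  coassoc : ∀ a b c, TensorProduct.assoc ℂ A A A
      (map (T₂.toLinearMap ∘ₗ TensorProduct.mk ℂ A A c) LinearMap.id (T₁ (a ⊗ₜ b))) =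
    map LinearMap.id (T₁.toLinearMap ∘ₗ (TensorProduct.mk ℂ A A).flip b) (T₂ (c ⊗ₜ a))

variable {Δ : A →ₙₐ[ℂ] Multiplier (A ⊗[ℂ] A)}

theorem IsMultiplierHopf.exists_galoisMaps (h : IsMultiplierHopf Δ) :
    ∃ T₁ T₂, GaloisMaps Δ T₁ T₂ := by
  obtain ⟨T₁, hb₁, h₁⟩ := h.bijective_left
  obtain ⟨T₂, hb₂, h₂⟩ := h.bijective_right
  refine ⟨LinearEquiv.ofBijective T₁ hb₁, LinearEquiv.ofBijective T₂ hb₂, h.nondegenerate, h₁, h₂,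
    fun a b c => ?_⟩
  have hc := h.coassoc a b c _ _ (h₁ a b) (h₂ c a)
  rw [assoc_tmulOne_mul_comulTensorId Δ (TensorProduct.curry T₂).flip (fun a c => h₂ c a),
    idTensorComul_mul_oneTmul Δ (TensorProduct.curry T₁) h₁] at hc
  exact incl_injective (h.nondegenerate.tensor (h.nondegenerate.tensor h.nondegenerate)) hc

namespace GaloisMaps

variable {T₁ T₂ : A ⊗[ℂ] A ≃ₗ[ℂ] A ⊗[ℂ] A}

theorem incl_inj (h : GaloisMaps Δ T₁ T₂) :
    Function.Injective (incl : A ⊗[ℂ] A → Multiplier (A ⊗[ℂ] A)) :=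
  incl_injective (h.nondegenerate.tensor h.nondegenerate)

/-- `(c ⊗ 1)Δ(a)(1 ⊗ b)` in two ways. -/
theorem mulLeft_T₁ (h : GaloisMaps Δ T₁ T₂) (a b c : A) :
    map (LinearMap.mulLeft ℂ c) LinearMap.id (T₁ (a ⊗ₜ b)) =
      map LinearMap.id (LinearMap.mulRight ℂ b) (T₂ (c ⊗ₜ a)) :=
  h.incl_inj <| by
    rw [incl_map_mulLeft_id, incl_map_id_mulRight, h.incl₁, h.incl₂, mul_assoc]

theorem T₁_mulRight (h : GaloisMaps Δ T₁ T₂) (c : A) (x : A ⊗[ℂ] A) :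
    T₁ (map LinearMap.id (LinearMap.mulRight ℂ c) x) =
      map LinearMap.id (LinearMap.mulRight ℂ c) (T₁ x) := by
  induction x with
  | zero => simp
  | add x y hx hy => simp only [map_add, hx, hy]
  | tmul a b =>
    refine h.incl_inj ?_
    rw [TensorProduct.map_tmul, LinearMap.id_apply, LinearMap.mulRight_apply, h.incl₁,
      incl_map_id_mulRight, h.incl₁, mul_assoc]
    congr 1
    rw [oneTmul, oneTmul, oneTmul, tmul_mul_tmul, ← incl_mul, one_mul]

theorem T₂_mulLeft (h : GaloisMaps Δ T₁ T₂) (c : A) (x : A ⊗[ℂ] A) :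
    T₂ (map (LinearMap.mulLeft ℂ c) LinearMap.id x) =
      map (LinearMap.mulLeft ℂ c) LinearMap.id (T₂ x) := by
  induction x with
  | zero => simp
  | add x y hx hy => simp only [map_add, hx, hy]
  | tmul a b =>
    refine h.incl_inj ?_
    rw [TensorProduct.map_tmul, LinearMap.id_apply, LinearMap.mulLeft_apply, h.incl₂,
      incl_map_mulLeft_id, h.incl₂, ← mul_assoc]
    congr 1
    rw [tmulOne, tmulOne, tmulOne, tmul_mul_tmul, ← incl_mul, one_mul]

theorem T₁_mulLeft (h : GaloisMaps Δ T₁ T₂) (c : A) (x : A ⊗[ℂ] A) :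
    T₁ (map (LinearMap.mulLeft ℂ c) LinearMap.id x) = (Δ c).left (T₁ x) := by
  induction x with
  | zero => simp
  | add x y hx hy => simp only [map_add, hx, hy]
  | tmul a b =>
    refine h.incl_inj ?_
    rw [TensorProduct.map_tmul, LinearMap.id_apply, LinearMap.mulLeft_apply, h.incl₁,
      ← mul_incl, h.incl₁, map_mul, mul_assoc]

theorem T₂_mulRight (h : GaloisMaps Δ T₁ T₂) (c : A) (x : A ⊗[ℂ] A) :
    T₂ (map LinearMap.id (LinearMap.mulRight ℂ c) x) = (Δ c).right (T₂ x) := by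
  induction x with
  | zero => simp
  | add x y hx hy => simp only [map_add, hx, hy]
  | tmul a b =>
    refine h.incl_inj ?_
    rw [TensorProduct.map_tmul, LinearMap.id_apply, LinearMap.mulRight_apply, h.incl₂,
      ← incl_mul_multiplier, h.incl₂, map_mul, mul_assoc]

/-- `Δ(p)(b ⊗ q)`. -/
theorem left_tmul_eq (h : GaloisMaps Δ T₁ T₂) (p b q : A) :
    (Δ p).left (b ⊗ₜ q) = map (LinearMap.mulRight ℂ b) LinearMap.id (T₁ (p ⊗ₜ q)) :=
  h.incl_inj <| by
    rw [← mul_incl, incl_map_mulRight_id, h.incl₁, ← oneTmul_mul_tmulOne, mul_assoc]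

/-- `(u ⊗ v)Δ(c)`. -/
theorem right_tmul_eq (h : GaloisMaps Δ T₁ T₂) (u v c : A) :
    (Δ c).right (u ⊗ₜ v) = map LinearMap.id (LinearMap.mulLeft ℂ v) (T₂ (u ⊗ₜ c)) :=
  h.incl_inj <| by
    rw [← incl_mul_multiplier, incl_map_id_mulLeft, h.incl₂, ← oneTmul_mul_tmulOne, mul_assoc]

/-- `(T₂ ⊗ ι)(c ⊗ T₁(x)) = (ι ⊗ T₁)(T₂ ⊗ ι)(c ⊗ x)`. -/
theorem coassoc_T₁ (h : GaloisMaps Δ T₁ T₂) (c : A) (x : A ⊗[ℂ] A) :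
    TensorProduct.assoc ℂ A A A
        (map (T₂.toLinearMap ∘ₗ TensorProduct.mk ℂ A A c) LinearMap.id (T₁ x)) =
      map LinearMap.id T₁.toLinearMap (TensorProduct.assoc ℂ A A A
        (map (T₂.toLinearMap ∘ₗ TensorProduct.mk ℂ A A c) LinearMap.id x)) := by
  induction x with
  | zero => simp
  | add x y hx hy => simp only [map_add, hx, hy]
  | tmul a b =>
    rw [h.coassoc]
    simp only [TensorProduct.map_tmul, LinearMap.comp_apply, TensorProduct.mk_apply,
      LinearEquiv.coe_coe, LinearMap.id_apply]
    induction T₂ (c ⊗ₜ a) with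
    | zero => simp
    | add x y hx hy => simp only [map_add, TensorProduct.add_tmul, hx, hy]
    | tmul u v => simp

theorem coassoc_T₁_symm (h : GaloisMaps Δ T₁ T₂) (c : A) (x : A ⊗[ℂ] A) :
    TensorProduct.assoc ℂ A A A
        (map (T₂.toLinearMap ∘ₗ TensorProduct.mk ℂ A A c) LinearMap.id (T₁.symm x)) =
      map LinearMap.id T₁.symm.toLinearMap (TensorProduct.assoc ℂ A A A
        (map (T₂.toLinearMap ∘ₗ TensorProduct.mk ℂ A A c) LinearMap.id x)) := by
  obtain ⟨y, rfl⟩ := T₁.surjective x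
  rw [h.coassoc_T₁, TensorProduct.map_map, LinearEquiv.symm_apply_apply]
  simp

/-- `(T₂ ⊗ ι)⁻¹(ι ⊗ T₁)(x ⊗ b) = (ι ⊗ T₁)(T₂⁻¹(x) ⊗ b)`. -/
theorem coassoc_T₂_symm (h : GaloisMaps Δ T₁ T₂) (b : A) (x : A ⊗[ℂ] A) :
    map T₂.symm.toLinearMap LinearMap.id ((TensorProduct.assoc ℂ A A A).symm
        (map LinearMap.id (T₁.toLinearMap ∘ₗ (TensorProduct.mk ℂ A A).flip b) x)) =
      (TensorProduct.assoc ℂ A A A).symm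
        (map LinearMap.id (T₁.toLinearMap ∘ₗ (TensorProduct.mk ℂ A A).flip b) (T₂.symm x)) := by
  obtain ⟨y, rfl⟩ := T₂.surjective x
  rw [LinearEquiv.symm_apply_apply]
  induction y with
  | zero => simp
  | add x y hx hy => simp only [map_add, hx, hy]
  | tmul c a =>
    rw [← h.coassoc, LinearEquiv.symm_apply_apply, TensorProduct.map_map]
    have : T₂.symm.toLinearMap ∘ₗ T₂.toLinearMap ∘ₗ TensorProduct.mk ℂ A A c =
        TensorProduct.mk ℂ A A c := by
      ext z; simp
    rw [this]
    simp only [TensorProduct.map_tmul, LinearMap.comp_apply, LinearMap.flip_apply,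
      TensorProduct.mk_apply, LinearEquiv.coe_coe, LinearMap.id_apply, LinearMap.id_comp]
    induction T₁ (a ⊗ₜ b) with
    | zero => simp
    | add x y hx hy => simp only [map_add, TensorProduct.tmul_add, hx, hy]
    | tmul u v => simp

/-- This is what makes the counit scalar-valued: an equality `a ⊗ x = y ⊗ c` for non-zero `a` and
`c` forces `x ∈ ℂc` and `y ∈ ℂa`. With `E(b) = m(T₁⁻¹(b ⊗ c))`, coassociativity gives `(ι ⊗ E)T₂(a ⊗
b) = ab ⊗ c`, and `T₂` can be inverted. -/
theorem tmul_mul_T₁_symm (h : GaloisMaps Δ T₁ T₂) (a b c : A) :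
    a ⊗ₜ[ℂ] LinearMap.mul' ℂ A (T₁.symm (b ⊗ₜ c)) =
      LinearMap.mul' ℂ A (T₂.symm (a ⊗ₜ b)) ⊗ₜ c := by
  let E : A →ₗ[ℂ] A := LinearMap.mul' ℂ A ∘ₗ T₁.symm.toLinearMap ∘ₗ (TensorProduct.mk ℂ A A).flip c
  have e₁ : ∀ a w, map LinearMap.id (LinearMap.mul' ℂ A) (TensorProduct.assoc ℂ A A A
      (map (T₂.toLinearMap ∘ₗ TensorProduct.mk ℂ A A a) LinearMap.id w)) =
      map (LinearMap.mulLeft ℂ a) LinearMap.id (T₁ w) := by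
    intro a w
    induction w with
    | zero => simp
    | add x y hx hy => simp only [map_add, hx, hy]
    | tmul u v =>
      rw [h.mulLeft_T₁]
      simp only [TensorProduct.map_tmul, LinearMap.comp_apply, TensorProduct.mk_apply,
        LinearEquiv.coe_coe, LinearMap.id_apply]
      induction T₂ (a ⊗ₜ u) with
      | zero => simp
      | add x y hx hy => simp only [map_add, TensorProduct.add_tmul, hx, hy]
      | tmul w z => simp
  have e₂ : ∀ z, map LinearMap.id E (T₂ z) = LinearMap.mul' ℂ A z ⊗ₜ c := by
    intro z
    induction z with
    | zero => simp
    | add x y hx hy => simp only [map_add, TensorProduct.add_tmul, hx, hy]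
    | tmul a b =>
      have := e₁ a (T₁.symm (b ⊗ₜ c))
      rw [h.coassoc_T₁_symm, LinearEquiv.apply_symm_apply, TensorProduct.map_map] at this
      simp only [TensorProduct.map_tmul, LinearMap.comp_apply, TensorProduct.mk_apply,
        LinearEquiv.coe_coe, LinearMap.id_apply, LinearMap.mulLeft_apply] at this
      rw [LinearMap.mul'_apply, ← this]
      induction T₂ (a ⊗ₜ b) with
      | zero => simp
      | add x y hx hy => simp only [map_add, TensorProduct.add_tmul, hx, hy]
      | tmul w z => simp [E]
  have := e₂ (T₂.symm (a ⊗ₜ b))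
  rw [LinearEquiv.apply_symm_apply] at this
  exact this

variable [Nontrivial A]

theorem exists_counit_functional (h : GaloisMaps Δ T₁ T₂) : ∃ ε : A →ₗ[ℂ] ℂ,
    (∀ x, TensorProduct.lid ℂ A (map ε LinearMap.id (T₁ x)) = LinearMap.mul' ℂ A x) ∧
    ∀ x, TensorProduct.rid ℂ A (map LinearMap.id ε (T₂ x)) = LinearMap.mul' ℂ A x := by
  obtain ⟨a₀, ha₀⟩ := exists_ne (0 : A)
  -- The functional `f` normalised at `a₀` extracts the scalar; the same identity with `a₀` in the
  -- first or in the last place gives the two counit formulas with one `ε`.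
  obtain ⟨f, hf⟩ := Module.Projective.exists_dual_eq_one ℂ ha₀
  let ε : A →ₗ[ℂ] ℂ := f ∘ₗ LinearMap.mul' ℂ A ∘ₗ T₂.symm.toLinearMap ∘ₗ TensorProduct.mk ℂ A A a₀
  have h₁ : ∀ b c, LinearMap.mul' ℂ A (T₁.symm (b ⊗ₜ c)) = ε b • c := by
    intro b c
    have := congrArg (fun z => TensorProduct.lid ℂ A (map f LinearMap.id z))
      (h.tmul_mul_T₁_symm a₀ b c)
    simpa [hf, ε] using this
  have h₂ : ∀ a b, LinearMap.mul' ℂ A (T₂.symm (a ⊗ₜ b)) = ε b • a := by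
    intro a b
    have := congrArg (fun z => TensorProduct.rid ℂ A (map LinearMap.id f z))
      (h.tmul_mul_T₁_symm a b a₀)
    rw [h₁] at this
    simpa [hf] using this.symm
  refine ⟨ε, fun x => ?_, fun x => ?_⟩
  · rw [← T₁.symm_apply_apply x]
    generalize T₁ x = y
    rw [LinearEquiv.apply_symm_apply]
    induction y with
    | zero => simp
    | add x y hx hy => simp only [map_add, hx, hy]
    | tmul a b => simp [h₁]
  · rw [← T₂.symm_apply_apply x]
    generalize T₂ x = y
    rw [LinearEquiv.apply_symm_apply]
    induction y with
    | zero => simp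
    | add x y hx hy => simp only [map_add, hx, hy]
    | tmul a b => simp [h₂]

/-- Write `u ⊗ v = T₂(z)`. Then `(u ⊗ v)Δ(c) = T₂(z(1 ⊗ c))`, and `ι ⊗ ε` gives `m(z)c = ε(v)uc`.
Since `T₂` is surjective, left multiplication by `v` inside `ε` is multiplication by `ε(v)`. -/
theorem counit_mul (h : GaloisMaps Δ T₁ T₂) {ε : A →ₗ[ℂ] ℂ}
    (hε : ∀ x, TensorProduct.rid ℂ A (map LinearMap.id ε (T₂ x)) = LinearMap.mul' ℂ A x)
    (a b : A) : ε (a * b) = ε a * ε b := by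
  have key : ∀ z c, LinearMap.mul' ℂ A (map LinearMap.id (LinearMap.mulRight ℂ c) z) =
      LinearMap.mul' ℂ A z * c := by
    intro z c
    induction z with
    | zero => simp
    | add x y hx hy => simp only [map_add, add_mul, hx, hy]
    | tmul a b => simp [mul_assoc]
  have e₁ : ∀ u v c, TensorProduct.rid ℂ A (map LinearMap.id ε
      (map LinearMap.id (LinearMap.mulLeft ℂ v) (T₂ (u ⊗ₜ c)))) =
      ε v • TensorProduct.rid ℂ A (map LinearMap.id ε (T₂ (u ⊗ₜ c))) := by
    intro u v c
    obtain ⟨z, hz⟩ := T₂.surjective (u ⊗ₜ v)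
    rw [← h.right_tmul_eq, ← hz, ← h.T₂_mulRight, hε, hε, key, ← hε, hz]
    simp [smul_mul_assoc]
  have e₂ : ∀ v y, TensorProduct.rid ℂ A (map LinearMap.id ε
      (map LinearMap.id (LinearMap.mulLeft ℂ v) y)) =
      ε v • TensorProduct.rid ℂ A (map LinearMap.id ε y) := by
    intro v y
    obtain ⟨z, rfl⟩ := T₂.surjective y
    induction z with
    | zero => simp
    | add x y hx hy => simp only [map_add, smul_add, hx, hy]
    | tmul u c => exact e₁ u v c
  obtain ⟨a₀, ha₀⟩ := exists_ne (0 : A)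
  have := e₂ a (a₀ ⊗ₜ b)
  simp only [TensorProduct.map_tmul, LinearMap.id_apply, LinearMap.mulLeft_apply,
    TensorProduct.rid_tmul, smul_smul] at this
  exact smul_left_injective ℂ ha₀ this

theorem exists_counit (h : GaloisMaps Δ T₁ T₂) : ∃ ε : A →ₙₐ[ℂ] ℂ,
    (∀ x, TensorProduct.lid ℂ A (map (ε : A →ₗ[ℂ] ℂ) LinearMap.id (T₁ x)) = LinearMap.mul' ℂ A x) ∧
    ∀ x, TensorProduct.rid ℂ A (map LinearMap.id (ε : A →ₗ[ℂ] ℂ) (T₂ x)) =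
      LinearMap.mul' ℂ A x := by
  obtain ⟨ε, h₁, h₂⟩ := h.exists_counit_functional
  exact ⟨{ toFun := ε, map_smul' := ε.map_smul, map_zero' := ε.map_zero, map_add' := ε.map_add,
           map_mul' := h.counit_mul h₂ }, h₁, h₂⟩

end GaloisMaps

/-- The bijections `T₁` and `T₂` of a multiplier Hopf algebra, with its counit `ε`. -/
structure CounitalGaloisMaps (Δ : A →ₙₐ[ℂ] Multiplier (A ⊗[ℂ] A))
    (T₁ T₂ : A ⊗[ℂ] A ≃ₗ[ℂ] A ⊗[ℂ] A) (ε : A →ₙₐ[ℂ] ℂ) : Prop extends GaloisMaps Δ T₁ T₂ where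
  counit_left : ∀ x,
    TensorProduct.lid ℂ A (map (ε : A →ₗ[ℂ] ℂ) LinearMap.id (T₁ x)) = LinearMap.mul' ℂ A x
  counit_right : ∀ x,
    TensorProduct.rid ℂ A (map LinearMap.id (ε : A →ₗ[ℂ] ℂ) (T₂ x)) = LinearMap.mul' ℂ A x

namespace CounitalGaloisMaps

variable {T₁ T₂ : A ⊗[ℂ] A ≃ₗ[ℂ] A ⊗[ℂ] A} {ε : A →ₙₐ[ℂ] ℂ}

theorem isCounit (h : CounitalGaloisMaps Δ T₁ T₂ ε) : IsCounit Δ ε where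
  counit_left a b x hx := by
    rw [h.incl_inj (hx.trans (h.incl₁ a b).symm), h.counit_left, LinearMap.mul'_apply]
  counit_right a b x hx := by
    rw [h.incl_inj (hx.trans (h.incl₂ a b).symm), h.counit_right, LinearMap.mul'_apply]

variable (T₁ ε) in
/-- The map `a ⊗ b ↦ S(a)b`. -/
noncomputable def antipodeMul : A ⊗[ℂ] A →ₗ[ℂ] A :=
  (TensorProduct.lid ℂ A).toLinearMap ∘ₗ map (ε : A →ₗ[ℂ] ℂ) LinearMap.id ∘ₗ T₁.symm.toLinearMap

variable (T₂ ε) in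
/-- The map `a ⊗ b ↦ aS(b)`. -/
noncomputable def mulAntipode : A ⊗[ℂ] A →ₗ[ℂ] A :=
  (TensorProduct.rid ℂ A).toLinearMap ∘ₗ map LinearMap.id (ε : A →ₗ[ℂ] ℂ) ∘ₗ T₂.symm.toLinearMap

variable (T₁ ε) in
theorem antipodeMul_T₁ (x : A ⊗[ℂ] A) :
    antipodeMul T₁ ε (T₁ x) = TensorProduct.lid ℂ A (map (ε : A →ₗ[ℂ] ℂ) LinearMap.id x) := by
  simp [antipodeMul]

variable (T₂ ε) in
theorem mulAntipode_T₂ (x : A ⊗[ℂ] A) :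
    mulAntipode T₂ ε (T₂ x) = TensorProduct.rid ℂ A (map LinearMap.id (ε : A →ₗ[ℂ] ℂ) x) := by
  simp [mulAntipode]

theorem antipodeMul_mulRight (h : CounitalGaloisMaps Δ T₁ T₂ ε) (c : A) (x : A ⊗[ℂ] A) :
    antipodeMul T₁ ε (map LinearMap.id (LinearMap.mulRight ℂ c) x) = antipodeMul T₁ ε x * c := by
  obtain ⟨y, rfl⟩ := T₁.surjective x
  rw [← h.T₁_mulRight, antipodeMul_T₁, antipodeMul_T₁]
  induction y with
  | zero => simp
  | add x y hx hy => simp only [map_add, add_mul, hx, hy]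
  | tmul a b => simp [smul_mul_assoc]

theorem mulAntipode_mulLeft (h : CounitalGaloisMaps Δ T₁ T₂ ε) (c : A) (x : A ⊗[ℂ] A) :
    mulAntipode T₂ ε (map (LinearMap.mulLeft ℂ c) LinearMap.id x) = c * mulAntipode T₂ ε x := by
  obtain ⟨y, rfl⟩ := T₂.surjective x
  rw [← h.T₂_mulLeft, mulAntipode_T₂, mulAntipode_T₂]
  induction y with
  | zero => simp
  | add x y hx hy => simp only [map_add, mul_add, hx, hy]
  | tmul a b => simp [mul_smul_comm]

/-- `S(u)v` is multiplied by `ε(a)` if `u ⊗ v` is multiplied by `Δ(a)` on the left. -/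
theorem antipodeMul_comul (h : CounitalGaloisMaps Δ T₁ T₂ ε) (a : A) (x : A ⊗[ℂ] A) :
    antipodeMul T₁ ε ((Δ a).left x) = ε a • antipodeMul T₁ ε x := by
  obtain ⟨y, rfl⟩ := T₁.surjective x
  rw [← h.T₁_mulLeft, antipodeMul_T₁, antipodeMul_T₁]
  induction y with
  | zero => simp
  | add x y hx hy => simp only [map_add, smul_add, hx, hy]
  | tmul b c => simp [mul_smul]

/-- `(aS(b))c = a(S(b)c)`. -/
theorem mulAntipode_mul (h : CounitalGaloisMaps Δ T₁ T₂ ε) (a b c : A) :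
    mulAntipode T₂ ε (a ⊗ₜ b) * c = a * antipodeMul T₁ ε (b ⊗ₜ c) := by
  -- `Q(x ⊗ y ⊗ z) = ε(y)xz`. Applied to both sides of `coassoc_T₂_symm` it gives `(aS(u₁))u₂v =
  -- ε(u)av`, which is the claim on the image of `T₁`, that is, everywhere.
  let Q : (A ⊗[ℂ] A) ⊗[ℂ] A →ₗ[ℂ] A := LinearMap.mul' ℂ A ∘ₗ
    map ((TensorProduct.rid ℂ A).toLinearMap ∘ₗ map LinearMap.id (ε : A →ₗ[ℂ] ℂ)) LinearMap.id
  have e₁ : ∀ v y, Q ((TensorProduct.assoc ℂ A A A).symm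
      (map LinearMap.id (T₁.toLinearMap ∘ₗ (TensorProduct.mk ℂ A A).flip v) y)) =
      LinearMap.mul' ℂ A y * v := by
    intro v y
    induction y with
    | zero => simp
    | add x y hx hy => simp only [map_add, add_mul, hx, hy]
    | tmul y₁ y₂ =>
      have e := h.counit_left (y₂ ⊗ₜ v)
      rw [LinearMap.mul'_apply] at e
      simp only [TensorProduct.map_tmul, LinearMap.comp_apply, LinearMap.flip_apply,
        TensorProduct.mk_apply, LinearEquiv.coe_coe, LinearMap.id_apply, LinearMap.mul'_apply]
      rw [mul_assoc, ← e]
      induction T₁ (y₂ ⊗ₜ v) with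
      | zero => simp
      | add x y hx hy => simp only [map_add, TensorProduct.tmul_add, mul_add, hx, hy]
      | tmul w z => simp [Q, smul_mul_assoc, mul_smul_comm]
  have e₂ : ∀ x : A ⊗[ℂ] A, Q (map T₂.symm.toLinearMap LinearMap.id
      ((TensorProduct.assoc ℂ A A A).symm (a ⊗ₜ x))) =
      LinearMap.mul' ℂ A (map (mulAntipode T₂ ε ∘ₗ TensorProduct.mk ℂ A A a) LinearMap.id x) := by
    intro x
    induction x with
    | zero => simp
    | add x y hx hy => simp only [map_add, TensorProduct.tmul_add, hx, hy]
    | tmul u v => simp [Q, mulAntipode]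
  have e₃ : ∀ w, LinearMap.mul' ℂ A
      (map (mulAntipode T₂ ε ∘ₗ TensorProduct.mk ℂ A A a) LinearMap.id (T₁ w)) =
      a * antipodeMul T₁ ε (T₁ w) := by
    intro w
    rw [antipodeMul_T₁]
    induction w with
    | zero => simp
    | add x y hx hy => simp only [map_add, mul_add, hx, hy]
    | tmul u v =>
      have e := h.coassoc_T₂_symm v (a ⊗ₜ u)
      simp only [TensorProduct.map_tmul, LinearMap.comp_apply, LinearMap.flip_apply,
        TensorProduct.mk_apply, LinearEquiv.coe_coe, LinearMap.id_apply] at e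
      rw [← e₂, e, e₁, ← h.counit_right, LinearEquiv.apply_symm_apply]
      simp [smul_mul_assoc, mul_smul_comm]
  obtain ⟨w, hw⟩ := T₁.surjective (b ⊗ₜ c)
  have := e₃ w
  rw [hw] at this
  simpa using this

/-- If `a ⊗ c = T₁(p ⊗ q)`, then `S(a)c = ε(p)q`, and `ab ⊗ c = Δ(p)(b ⊗ q)` is sent to `ε(p)S(b)q =
S(b)(S(a)c)`. The general case is a sum of such terms. -/
theorem antipodeMul_mul (h : CounitalGaloisMaps Δ T₁ T₂ ε) (a b c : A) :
    antipodeMul T₁ ε ((a * b) ⊗ₜ c) = antipodeMul T₁ ε (b ⊗ₜ antipodeMul T₁ ε (a ⊗ₜ c)) := by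
  have key : ∀ w, antipodeMul T₁ ε (map (LinearMap.mulRight ℂ b) LinearMap.id (T₁ w)) =
      antipodeMul T₁ ε (b ⊗ₜ antipodeMul T₁ ε (T₁ w)) := by
    intro w
    rw [antipodeMul_T₁]
    induction w with
    | zero => simp
    | add x y hx hy => simp only [map_add, TensorProduct.tmul_add, hx, hy]
    | tmul p q =>
      rw [← h.left_tmul_eq, h.antipodeMul_comul]
      simp
  obtain ⟨w, hw⟩ := T₁.surjective (a ⊗ₜ c)
  have := key w
  rw [hw] at this
  simpa using this

/-- The antipode. -/
noncomputable def antipode (h : CounitalGaloisMaps Δ T₁ T₂ ε) : A →ₗ[ℂ] Multiplier A where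
  toFun a := Multiplier.mk (antipodeMul T₁ ε ∘ₗ TensorProduct.mk ℂ A A a)
    (mulAntipode T₂ ε ∘ₗ (TensorProduct.mk ℂ A A).flip a)
    (fun b c => by simpa using h.antipodeMul_mulRight c (a ⊗ₜ b))
    (fun b c => by simpa using h.mulAntipode_mulLeft b (c ⊗ₜ a))
    (fun b c => h.mulAntipode_mul b a c)
  map_add' a b := Multiplier.ext
    (fun x => (congrArg (antipodeMul T₁ ε) (TensorProduct.add_tmul a b x)).trans (map_add _ _ _))
    (fun x => (congrArg (mulAntipode T₂ ε) (TensorProduct.tmul_add x a b)).trans (map_add _ _ _))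
  map_smul' z a := Multiplier.ext
    (fun x => (congrArg (antipodeMul T₁ ε) (TensorProduct.smul_tmul' z a x).symm).trans
      (map_smul _ _ _))
    (fun x => (congrArg (mulAntipode T₂ ε) (TensorProduct.tmul_smul z x a)).trans
      (map_smul _ _ _))

theorem left_antipode (h : CounitalGaloisMaps Δ T₁ T₂ ε) (a b : A) :
    (h.antipode a).left b = antipodeMul T₁ ε (a ⊗ₜ b) := rfl

theorem right_antipode (h : CounitalGaloisMaps Δ T₁ T₂ ε) (a b : A) :
    (h.antipode a).right b = mulAntipode T₂ ε (b ⊗ₜ a) := rfl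

theorem isAntipode (h : CounitalGaloisMaps Δ T₁ T₂ ε) : IsAntipode Δ ε h.antipode where
  antimultiplicative a b := ext_left h.nondegenerate fun c => h.antipodeMul_mul a b c
  antipode_left a b x hx := by
    have key : ∀ x, Multiplier.mulLeft (map h.antipode LinearMap.id x) = antipodeMul T₁ ε x := by
      intro x
      induction x with
      | zero => simp
      | add x y hx hy => simp only [map_add, hx, hy]
      | tmul a b => rfl
    rw [key, h.incl_inj (hx.trans (h.incl₁ a b).symm), antipodeMul_T₁]
    simp
  antipode_right a b x hx := by
    have key : ∀ x, Multiplier.mulRight (map LinearMap.id h.antipode x) = mulAntipode T₂ ε x := by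
      intro x
      induction x with
      | zero => simp
      | add x y hx hy => simp only [map_add, hx, hy]
      | tmul a b => rfl
    rw [key, h.incl_inj (hx.trans (h.incl₂ b a).symm), mulAntipode_T₂]
    simp

end CounitalGaloisMaps

end GaloisMaps

/-! ### Bijectivity of the antipode in the regular case -/

section Regular

open TensorProduct (map lift)

variable {A : Type*} [NonUnitalRing A] [Module ℂ A] [IsScalarTower ℂ A A] [SMulCommClass ℂ A A]
  {Δ : A →ₙₐ[ℂ] Multiplier (A ⊗[ℂ] A)}

theorem flip_comp_flip_comp : Multiplier.flip.comp (Multiplier.flip.comp Δ) = Δ :=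
  NonUnitalAlgHom.ext fun a => flip_flip (Δ a)

theorem IsMultiplierHopf.exists_counitalGaloisMaps [Nontrivial A] (h : IsMultiplierHopf Δ) :
    ∃ T₁ T₂ ε, CounitalGaloisMaps Δ T₁ T₂ ε := by
  obtain ⟨T₁, T₂, hT⟩ := h.exists_galoisMaps
  obtain ⟨ε, hl, hr⟩ := hT.exists_counit
  exact ⟨T₁, T₂, ε, hT, hl, hr⟩

namespace GaloisMaps

variable {T₁ T₂ : A ⊗[ℂ] A ≃ₗ[ℂ] A ⊗[ℂ] A}

theorem incl₃_of_flip (h : GaloisMaps (Multiplier.flip.comp Δ) T₁ T₂) (a b : A) :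
    incl (swap A (T₁ (a ⊗ₜ b))) = Δ a * tmulOne A b := by
  rw [LinearEquiv.coe_coe, ← flip_incl, h.incl₁, map_mul, flip_oneTmul]
  congr 1
  exact flip_flip (Δ a)

theorem incl₄_of_flip (h : GaloisMaps (Multiplier.flip.comp Δ) T₁ T₂) (a b : A) :
    incl (swap A (T₂ (b ⊗ₜ a))) = oneTmul A b * Δ a := by
  rw [LinearEquiv.coe_coe, ← flip_incl, h.incl₂, map_mul, flip_tmulOne]
  congr 1
  exact flip_flip (Δ a)

end GaloisMaps

namespace CounitalGaloisMaps

variable {T₁ T₂ T₁' T₂' : A ⊗[ℂ] A ≃ₗ[ℂ] A ⊗[ℂ] A} {ε ε' : A →ₙₐ[ℂ] ℂ}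

theorem exists_counit_eq_one [Nontrivial A] (h : CounitalGaloisMaps Δ T₁ T₂ ε) :
    ∃ a, ε a = 1 := by
  obtain ⟨a, ha⟩ : ∃ a, ε a ≠ 0 := by
    by_contra! hz
    have hε : (ε : A →ₗ[ℂ] ℂ) = 0 := LinearMap.ext hz
    obtain ⟨a, ha⟩ := exists_ne (0 : A)
    refine ha (h.nondegenerate.1 a fun b => ?_)
    have := h.counit_left (a ⊗ₜ b)
    rw [hε, TensorProduct.map_zero_left] at this
    simpa using this.symm
  exact ⟨(ε a)⁻¹ • a, by rw [map_smul, smul_eq_mul, inv_mul_cancel₀ ha]⟩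

/-- Both `ι ⊗ ε` and `ι ⊗ ε'` send `(b ⊗ 1)Δ(a)` to `ba`: for `ε'` this is seen after multiplication
by `c ⊗ 1` on the right, where the flipped counit identity applies. As `T₂` is surjective, the
functionals agree. -/
theorem counit_flip_eq [Nontrivial A] (h : CounitalGaloisMaps Δ T₁ T₂ ε)
    (h' : CounitalGaloisMaps (Multiplier.flip.comp Δ) T₁' T₂' ε') : ε' = ε := by
  have rel : ∀ a b c, map (LinearMap.mulRight ℂ c) LinearMap.id (T₂ (b ⊗ₜ a)) =
      map (LinearMap.mulLeft ℂ b) LinearMap.id (swap A (T₁' (a ⊗ₜ c))) := fun a b c =>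
    h.incl_inj <| by
      rw [incl_map_mulRight_id, incl_map_mulLeft_id, h.incl₂, h'.incl₃_of_flip, mul_assoc]
  have keyR : ∀ c x, TensorProduct.rid ℂ A (map LinearMap.id (ε' : A →ₗ[ℂ] ℂ)
      (map (LinearMap.mulRight ℂ c) LinearMap.id x)) =
      TensorProduct.rid ℂ A (map LinearMap.id (ε' : A →ₗ[ℂ] ℂ) x) * c := by
    intro c x
    induction x with
    | zero => simp
    | add x y hx hy => simp only [map_add, add_mul, hx, hy]
    | tmul u v => simp [smul_mul_assoc]
  have keyL : ∀ c x, TensorProduct.rid ℂ A (map LinearMap.id (ε' : A →ₗ[ℂ] ℂ)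
      (map (LinearMap.mulLeft ℂ c) LinearMap.id (swap A x))) =
      c * TensorProduct.lid ℂ A (map (ε' : A →ₗ[ℂ] ℂ) LinearMap.id x) := by
    intro c x
    induction x with
    | zero => simp
    | add x y hx hy => simp only [map_add, mul_add, hx, hy]
    | tmul u v => simp [mul_smul_comm]
  have e : ∀ y, TensorProduct.rid ℂ A (map LinearMap.id (ε' : A →ₗ[ℂ] ℂ) y) =
      TensorProduct.rid ℂ A (map LinearMap.id (ε : A →ₗ[ℂ] ℂ) y) := by
    intro y
    obtain ⟨z, rfl⟩ := T₂.surjective y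
    induction z with
    | zero => simp
    | add x y hx hy => simp only [map_add, hx, hy]
    | tmul b a =>
      refine h.nondegenerate.eq_of_mul_right fun c => ?_
      rw [← keyR, rel, keyL, h'.counit_left, h.counit_right, LinearMap.mul'_apply,
        LinearMap.mul'_apply, mul_assoc]
  obtain ⟨a₀, ha₀⟩ := exists_ne (0 : A)
  refine NonUnitalAlgHom.ext fun b => smul_left_injective ℂ ha₀ ?_
  simpa using e (a₀ ⊗ₜ b)

/-- Formally `S(p₁q)p₂ = S(q)S(p₁)p₂ = ε(p)S(q)`. Regularity puts `Δ(p)(q ⊗ 1)` into `A ⊗ A`, so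
with `ε(p) = 1` the multiplier `S(q)` is seen to belong to `A`. -/
theorem incl_antipodeMul_swap (h : CounitalGaloisMaps Δ T₁ T₂ ε)
    (h' : CounitalGaloisMaps (Multiplier.flip.comp Δ) T₁' T₂' ε') (p q : A) :
    incl (antipodeMul T₁ ε (swap A (T₁' (p ⊗ₜ q)))) = ε p • h.antipode q := by
  refine ext_left h.nondegenerate fun d => ?_
  have rel : map LinearMap.id (LinearMap.mulRight ℂ d) (swap A (T₁' (p ⊗ₜ q))) =
      (Δ p).left (q ⊗ₜ d) :=
    h.incl_inj <| by
      rw [incl_map_id_mulRight, h'.incl₃_of_flip, ← mul_incl, mul_assoc, tmulOne_mul_oneTmul]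
  rw [left_incl, ← h.antipodeMul_mulRight, rel, h.antipodeMul_comul]
  rfl

/-- The antipode of a regular multiplier Hopf algebra maps `A` into `A`. -/
theorem exists_incl_eq_antipode [Nontrivial A] (h : CounitalGaloisMaps Δ T₁ T₂ ε)
    (h' : CounitalGaloisMaps (Multiplier.flip.comp Δ) T₁' T₂' ε') :
    ∃ S : A →ₗ[ℂ] A, ∀ a, incl (S a) = h.antipode a := by
  obtain ⟨p, hp⟩ := h.exists_counit_eq_one
  refine ⟨antipodeMul T₁ ε ∘ₗ swap A ∘ₗ T₁'.toLinearMap ∘ₗ TensorProduct.mk ℂ A A p, fun a => ?_⟩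
  exact (h.incl_antipodeMul_swap h' p a).trans (by rw [hp, one_smul])

section Values

variable {S : A →ₗ[ℂ] A}

theorem antipodeMul_tmul (h : CounitalGaloisMaps Δ T₁ T₂ ε) (hS : ∀ a, incl (S a) = h.antipode a)
    (a b : A) : antipodeMul T₁ ε (a ⊗ₜ b) = S a * b := by
  rw [← left_antipode h, ← hS, left_incl]

theorem mulAntipode_tmul (h : CounitalGaloisMaps Δ T₁ T₂ ε) (hS : ∀ a, incl (S a) = h.antipode a)
    (a b : A) : mulAntipode T₂ ε (a ⊗ₜ b) = a * S b := by
  rw [← right_antipode h, ← hS, right_incl]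

theorem antipodeMul_eq (h : CounitalGaloisMaps Δ T₁ T₂ ε) (hS : ∀ a, incl (S a) = h.antipode a) :
    antipodeMul T₁ ε = LinearMap.mul' ℂ A ∘ₗ map S LinearMap.id := by
  ext a b; simp [h.antipodeMul_tmul hS]

theorem mulAntipode_eq (h : CounitalGaloisMaps Δ T₁ T₂ ε) (hS : ∀ a, incl (S a) = h.antipode a) :
    mulAntipode T₂ ε = LinearMap.mul' ℂ A ∘ₗ map LinearMap.id S := by
  ext a b; simp [h.mulAntipode_tmul hS]

theorem antipode_map_mul (h : CounitalGaloisMaps Δ T₁ T₂ ε)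
    (hS : ∀ a, incl (S a) = h.antipode a) (a b : A) : S (a * b) = S b * S a :=
  incl_injective h.nondegenerate (by
    rw [incl_mul, hS, hS, hS, h.isAntipode.antimultiplicative])

/-- From `S(S'(b)a) = S(a)b` and antimultiplicativity, `S(a)S(S'(b)) = S(a)b`. The elements `uS(a)`
span `A`, so non-degeneracy cancels the left factor. -/
theorem antipode_flip_antipode [Nontrivial A] (h : CounitalGaloisMaps Δ T₁ T₂ ε)
    (h' : CounitalGaloisMaps (Multiplier.flip.comp Δ) T₁' T₂' ε)
    (hS : ∀ a, incl (S a) = h.antipode a) {S' : A →ₗ[ℂ] A}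
    (hS' : ∀ a, incl (S' a) = h'.antipode a) (b : A) : S (S' b) = b := by
  have e₁ : ∀ y, S (antipodeMul T₁' ε y) = antipodeMul T₁ ε (swap A y) := by
    intro y
    obtain ⟨z, rfl⟩ := T₁'.surjective y
    rw [antipodeMul_T₁]
    induction z with
    | zero => simp
    | add x y hx hy => simp only [map_add, hx, hy]
    | tmul p q =>
      refine incl_injective h.nondegenerate ?_
      rw [h.incl_antipodeMul_swap h', ← hS, ← incl_smul, ← map_smul]
      simp
  have e₂ : ∀ a, S a * S (S' b) = S a * b := by
    intro a
    have := e₁ (b ⊗ₜ a)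
    rw [h'.antipodeMul_tmul hS', h.antipode_map_mul hS] at this
    rw [this]
    simp [h.antipodeMul_tmul hS]
  have e₃ : ∀ w, mulAntipode T₂ ε w * S (S' b) = mulAntipode T₂ ε w * b := by
    intro w
    induction w with
    | zero => simp
    | add x y hx hy => simp only [map_add, add_mul, hx, hy]
    | tmul u v => rw [h.mulAntipode_tmul hS, mul_assoc, e₂, mul_assoc]
  obtain ⟨p, hp⟩ := h.exists_counit_eq_one
  refine h.nondegenerate.eq_of_mul_left fun z => ?_
  -- With `ε(p) = 1`, `T₂(z ⊗ p)` is sent to `z` by `u ⊗ v ↦ uS(v)`.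
  have := e₃ (T₂ (z ⊗ₜ p))
  rw [mulAntipode_T₂] at this
  simpa [hp] using this

end Values

end CounitalGaloisMaps

/-- A regular multiplier Hopf algebra, with its counit and its antipode as a bijection of `A`. -/
theorem IsRegularMultiplierHopf.exists_antipode [Nontrivial A] (h : IsRegularMultiplierHopf Δ) :
    ∃ (T₁ T₂ : A ⊗[ℂ] A ≃ₗ[ℂ] A ⊗[ℂ] A) (ε : A →ₙₐ[ℂ] ℂ) (hT : CounitalGaloisMaps Δ T₁ T₂ ε)
      (S : A ≃ₗ[ℂ] A), ∀ a, incl (S a) = hT.antipode a := by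
  obtain ⟨T₁, T₂, ε, hT⟩ := h.1.exists_counitalGaloisMaps
  obtain ⟨T₁', T₂', ε', hT'⟩ := h.2.exists_counitalGaloisMaps
  obtain rfl := hT.counit_flip_eq hT'
  -- The flip is an involution, so the same argument with the roles exchanged gives the other
  -- composite.
  have hT'' : CounitalGaloisMaps (Multiplier.flip.comp (Multiplier.flip.comp Δ)) T₁ T₂ ε' := by
    rwa [flip_comp_flip_comp]
  obtain ⟨S, hS⟩ := hT.exists_incl_eq_antipode hT'
  obtain ⟨S', hS'⟩ := hT'.exists_incl_eq_antipode hT''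
  exact ⟨T₁, T₂, ε', hT, LinearEquiv.ofLinearMap S S'
    (LinearMap.ext fun b => hT.antipode_flip_antipode hT' hS hS' b)
    (LinearMap.ext fun b => hT'.antipode_flip_antipode hT'' hS' hS b), hS⟩

end Regular

/-! ### Restriction to the components of a cograding -/

section Graded

open TensorProduct (map lift)

variable {G : Type*} [Group G]
variable {A : Type*} [NonUnitalRing A] [Module ℂ A] [IsScalarTower ℂ A A] [SMulCommClass ℂ A A]
  {𝒜 : G → NonUnitalSubalgebra ℂ A}

theorem subalgebraIncl_apply (B : NonUnitalSubalgebra ℂ A) (b : B) : subalgebraIncl B b = b := rfl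

theorem coe_castTo {p q : G} (h : p = q) (a : 𝒜 p) :
    ((castTo (A := fun p => 𝒜 p) h a : 𝒜 q) : A) = a := by
  subst h; rfl

/-- `A` is the direct sum of the subalgebras `A_p` with `A_p A_q = 0` for `p ≠ q`, and `P p` is the
projection onto `A_p`. -/
structure IsGrading (𝒜 : G → NonUnitalSubalgebra ℂ A) (P : ∀ p, A →ₗ[ℂ] 𝒜 p) : Prop where
  iSup_eq_top : ⨆ p, (𝒜 p).toSubmodule = ⊤
  mul_eq_zero : ∀ p q, p ≠ q → ∀ a ∈ 𝒜 p, ∀ b ∈ 𝒜 q, a * b = 0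
  proj_self : ∀ p (a : 𝒜 p), P p a = a
  proj_of_ne : ∀ p q (a : 𝒜 p), q ≠ p → P q a = 0
  jointlyInjective : JointlyInjective P

theorem IsWeakCograding.exists_isGrading {Δ : A →ₙₐ[ℂ] Multiplier (A ⊗[ℂ] A)}
    (h : IsWeakCograding Δ 𝒜) : ∃ P : ∀ p, A →ₗ[ℂ] 𝒜 p, IsGrading 𝒜 P := by
  classical
  have hint : DirectSum.IsInternal fun p => (𝒜 p).toSubmodule :=
    DirectSum.isInternal_submodule_of_iSupIndep_of_iSup_eq_top h.independent h.iSup_eq_top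
  let e := LinearEquiv.ofBijective (DirectSum.coeLinearMap fun p => (𝒜 p).toSubmodule) hint
  have he : ∀ p (a : (𝒜 p).toSubmodule),
      e.symm a = DirectSum.lof ℂ G (fun p => (𝒜 p).toSubmodule) p a := fun p a => by
    rw [LinearEquiv.symm_apply_eq]
    exact (DirectSum.coeLinearMap_lof (fun p => (𝒜 p).toSubmodule) p a).symm
  refine ⟨fun p => DirectSum.component ℂ G (fun p => (𝒜 p).toSubmodule) p ∘ₗ e.symm.toLinearMap,
    h.iSup_eq_top, h.mul_eq_zero, fun p a => ?_, fun p q a hpq => ?_, fun a ha => ?_⟩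
  · exact (congrArg (DirectSum.component ℂ G _ p) (he p a)).trans (DirectSum.component.lof_self ..)
  · refine (congrArg (DirectSum.component ℂ G _ q) (he p a)).trans ?_
    rw [DirectSum.component.of, dif_neg hpq.symm]
  · apply e.symm.injective
    rw [map_zero]
    exact DirectSum.ext_component ℂ fun p => (ha p).trans (map_zero _).symm

namespace IsGrading

variable {P : ∀ p, A →ₗ[ℂ] 𝒜 p}

theorem hom_ext (hP : IsGrading 𝒜 P) {M : Type*} [AddCommGroup M] [Module ℂ M] {f g : A →ₗ[ℂ] M}
    (h : ∀ p (a : 𝒜 p), f a = g a) : f = g := by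
  ext a
  have ha : a ∈ ⨆ p, (𝒜 p).toSubmodule := hP.iSup_eq_top ▸ Submodule.mem_top
  induction ha using Submodule.iSup_induction' with
  | mem p a ha => exact h p ⟨a, ha⟩
  | zero => simp
  | add x y _ _ hx hy => simp only [map_add, hx, hy]

theorem proj_mul (hP : IsGrading 𝒜 P) (p : G) (a b : A) : P p (a * b) = P p a * P p b := by
  have : (LinearMap.mul ℂ A).compr₂ (P p) = (LinearMap.mul ℂ (𝒜 p)).compl₁₂ (P p) (P p) := by
    refine hP.hom_ext fun q a => hP.hom_ext fun r b => ?_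
    simp only [LinearMap.compr₂_apply, LinearMap.compl₁₂_apply, LinearMap.mul_apply_apply]
    by_cases hqr : q = r
    · subst hqr
      by_cases hpq : p = q
      · subst hpq
        rw [hP.proj_self, hP.proj_self]
        exact hP.proj_self p (a * b)
      · rw [hP.proj_of_ne _ _ a hpq, zero_mul]
        exact hP.proj_of_ne q p (a * b) hpq
    · rw [hP.mul_eq_zero q r hqr a a.2 b b.2, map_zero]
      by_cases hpq : p = q
      · rw [hP.proj_of_ne r p b (hpq ▸ hqr), mul_zero]
      · rw [hP.proj_of_ne q p a hpq, zero_mul]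
  exact LinearMap.congr_fun₂ this a b

theorem eq_coe_proj (hP : IsGrading 𝒜 P) {p : G} {a : A} (h : ∀ q, q ≠ p → P q a = 0) :
    a = P p a := by
  refine hP.jointlyInjective.eq_of_forall fun q => ?_
  by_cases hq : q = p
  · subst hq; rw [hP.proj_self]
  · rw [h q hq, hP.proj_of_ne p q _ hq]

theorem proj_mul_coe (hP : IsGrading 𝒜 P) (p : G) (a : A) (b : 𝒜 p) : P p (a * b) = P p a * b := by
  rw [hP.proj_mul, hP.proj_self]

/-- An element of `A_p` that annihilates `A_p` on one side annihilates all of `A` on that side, as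
products of different components vanish. -/
theorem nondegenerate (hP : IsGrading 𝒜 P) (hA : NondegenerateProduct A) (p : G) :
    NondegenerateProduct (𝒜 p) := by
  constructor
  · intro a ha
    refine Subtype.ext (hA.1 a fun b => hP.jointlyInjective _ fun q => ?_)
    rw [hP.proj_mul]
    by_cases hq : q = p
    · subst hq; rw [hP.proj_self, ha]
    · rw [hP.proj_of_ne p q a hq, zero_mul]
  · intro a ha
    refine Subtype.ext (hA.2 a fun b => hP.jointlyInjective _ fun q => ?_)
    rw [hP.proj_mul]
    by_cases hq : q = p
    · subst hq; rw [hP.proj_self, ha]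
    · rw [hP.proj_of_ne p q a hq, mul_zero]

end IsGrading

variable (𝒜) in
/-- The inclusion of `A_p ⊗ A_q` into `A ⊗ A`. -/
noncomputable abbrev tensorIncl (p q : G) : 𝒜 p ⊗[ℂ] 𝒜 q →ₗ[ℂ] A ⊗[ℂ] A :=
  map (subalgebraIncl (𝒜 p)) (subalgebraIncl (𝒜 q))

theorem tensorIncl_mul (p q : G) (x y : 𝒜 p ⊗[ℂ] 𝒜 q) :
    tensorIncl 𝒜 p q (x * y) = tensorIncl 𝒜 p q x * tensorIncl 𝒜 p q y := by
  induction x with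
  | zero => simp
  | add x x' hx hx' => simp only [add_mul, map_add, hx, hx']
  | tmul a b =>
    induction y with
    | zero => simp
    | add y y' hy hy' => simp only [mul_add, map_add, hy, hy']
    | tmul c d => simp [subalgebraIncl_apply]

theorem subalgebraIncl_injective (B : NonUnitalSubalgebra ℂ A) :
    Function.Injective (subalgebraIncl B) := Subtype.val_injective

theorem tensorIncl_injective (p q : G) : Function.Injective (tensorIncl 𝒜 p q) := by
  have h₁ := JointlyInjective.of_injective (subalgebraIncl_injective (𝒜 p))
  have h₂ := JointlyInjective.of_injective (subalgebraIncl_injective (𝒜 q))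
  refine (injective_iff_map_eq_zero _).2 fun x hx => ?_
  refine h₁.rTensor (𝒜 q) x fun _ => h₂.lTensor A _ fun _ => ?_
  dsimp only
  rw [TensorProduct.map_map, LinearMap.id_comp, LinearMap.comp_id, hx]

theorem jointlyInjective_tensorIncl (p q : G) :
    JointlyInjective (fun _ : Unit => tensorIncl 𝒜 p q) :=
  JointlyInjective.of_injective (tensorIncl_injective p q)

/-- `n` is the restriction to `A_p ⊗ A_q` of the multiplier `m` of `A ⊗ A`. -/
def HasRestriction (m : Multiplier (A ⊗[ℂ] A)) {p q : G} (n : Multiplier (𝒜 p ⊗[ℂ] 𝒜 q)) : Prop :=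
  ∀ x, tensorIncl 𝒜 p q (n.left x) = m.left (tensorIncl 𝒜 p q x) ∧
    tensorIncl 𝒜 p q (n.right x) = m.right (tensorIncl 𝒜 p q x)

namespace HasRestriction

variable {p q : G}

theorem mul {m m' : Multiplier (A ⊗[ℂ] A)} {n n' : Multiplier (𝒜 p ⊗[ℂ] 𝒜 q)}
    (h : HasRestriction m n) (h' : HasRestriction m' n') : HasRestriction (m * m') (n * n') :=
  fun x => by simp [(h _).1, (h' _).1, (h _).2, (h' _).2]

theorem add {m m' : Multiplier (A ⊗[ℂ] A)} {n n' : Multiplier (𝒜 p ⊗[ℂ] 𝒜 q)}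
    (h : HasRestriction m n) (h' : HasRestriction m' n') : HasRestriction (m + m') (n + n') :=
  fun x => by simp [(h _).1, (h' _).1, (h _).2, (h' _).2]

theorem smul {m : Multiplier (A ⊗[ℂ] A)} {n : Multiplier (𝒜 p ⊗[ℂ] 𝒜 q)} (z : ℂ)
    (h : HasRestriction m n) : HasRestriction (z • m) (z • n) :=
  fun x => by simp [(h _).1, (h _).2]

theorem zero : HasRestriction (0 : Multiplier (A ⊗[ℂ] A)) (0 : Multiplier (𝒜 p ⊗[ℂ] 𝒜 q)) :=
  fun x => by simp

theorem incl {x : 𝒜 p ⊗[ℂ] 𝒜 q} {y : A ⊗[ℂ] A} (h : tensorIncl 𝒜 p q x = y) :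
    HasRestriction (incl y) (Multiplier.incl x) := fun z => by
  simp [tensorIncl_mul, ← h]

theorem oneTmul (b : 𝒜 q) :
    HasRestriction (oneTmul A (b : A)) (Multiplier.oneTmul (𝒜 p) b) := fun x => by
  rw [left_oneTmul, left_oneTmul, right_oneTmul, right_oneTmul, TensorProduct.map_map,
    TensorProduct.map_map, TensorProduct.map_map, TensorProduct.map_map]
  exact ⟨rfl, rfl⟩

theorem tmulOne (b : 𝒜 p) :
    HasRestriction (tmulOne A (b : A)) (Multiplier.tmulOne (𝒜 q) b) := fun x => by
  rw [left_tmulOne, left_tmulOne, right_tmulOne, right_tmulOne, TensorProduct.map_map,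
    TensorProduct.map_map, TensorProduct.map_map, TensorProduct.map_map]
  exact ⟨rfl, rfl⟩

theorem unique {m : Multiplier (A ⊗[ℂ] A)} {n n' : Multiplier (𝒜 p ⊗[ℂ] 𝒜 q)}
    (h : HasRestriction m n) (h' : HasRestriction m n') : n = n' :=
  Multiplier.ext (fun x => tensorIncl_injective p q ((h x).1.trans (h' x).1.symm))
    (fun x => tensorIncl_injective p q ((h x).2.trans (h' x).2.symm))

theorem exists_of_mem_range {m : Multiplier (A ⊗[ℂ] A)}
    (hl : ∀ x, m.left (tensorIncl 𝒜 p q x) ∈ LinearMap.range (tensorIncl 𝒜 p q))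
    (hr : ∀ x, m.right (tensorIncl 𝒜 p q x) ∈ LinearMap.range (tensorIncl 𝒜 p q)) :
    ∃ n : Multiplier (𝒜 p ⊗[ℂ] 𝒜 q), HasRestriction m n := by
  obtain ⟨L, hL⟩ := (jointlyInjective_tensorIncl p q).exists_lift
    (fun _ => m.left ∘ₗ tensorIncl 𝒜 p q) fun x => (hl x).imp fun y hy _ => hy
  obtain ⟨R, hR⟩ := (jointlyInjective_tensorIncl p q).exists_lift
    (fun _ => m.right ∘ₗ tensorIncl 𝒜 p q) fun x => (hr x).imp fun y hy _ => hy
  replace hL := fun x => hL x ()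
  replace hR := fun x => hR x ()
  simp only [LinearMap.comp_apply] at hL hR
  refine ⟨Multiplier.mk L R (fun x y => tensorIncl_injective p q ?_)
    (fun x y => tensorIncl_injective p q ?_) (fun x y => tensorIncl_injective p q ?_),
    fun x => ⟨hL x, hR x⟩⟩
  · rw [hL, tensorIncl_mul, tensorIncl_mul, hL, left_mul_apply]
  · rw [hR, tensorIncl_mul, tensorIncl_mul, hR, right_mul_apply]
  · rw [tensorIncl_mul, tensorIncl_mul, hL, hR, right_mul_eq]

end HasRestriction

end Graded

/-! ### The covered products and the cograding -/

section Graded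

open TensorProduct (map lift)

variable {G : Type*} [Group G]
variable {A : Type*} [NonUnitalRing A] [Module ℂ A] [IsScalarTower ℂ A A] [SMulCommClass ℂ A A]
  {𝒜 : G → NonUnitalSubalgebra ℂ A} {P : ∀ p, A →ₗ[ℂ] 𝒜 p}

/-- The projection of `A ⊗ A` onto `A_p ⊗ A_q`. -/
noncomputable abbrev tensorProj (P : ∀ p, A →ₗ[ℂ] 𝒜 p) (p q : G) :
    A ⊗[ℂ] A →ₗ[ℂ] 𝒜 p ⊗[ℂ] 𝒜 q :=
  map (P p) (P q)

namespace IsGrading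

theorem tensorProj_self (hP : IsGrading 𝒜 P) (p q : G) (x : 𝒜 p ⊗[ℂ] 𝒜 q) :
    tensorProj P p q (tensorIncl 𝒜 p q x) = x := by
  have h : ∀ r, P r ∘ₗ subalgebraIncl (𝒜 r) = LinearMap.id := fun r =>
    LinearMap.ext (hP.proj_self r)
  rw [TensorProduct.map_map, h, h, TensorProduct.map_id, LinearMap.id_apply]

theorem tensorProj_of_ne (hP : IsGrading 𝒜 P) {p q r s : G} (h : (r, s) ≠ (p, q))
    (x : 𝒜 p ⊗[ℂ] 𝒜 q) : tensorProj P r s (tensorIncl 𝒜 p q x) = 0 := by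
  have hz : ∀ {r s : G}, s ≠ r → P s ∘ₗ subalgebraIncl (𝒜 r) = 0 := fun h =>
    LinearMap.ext fun a => hP.proj_of_ne _ _ a h
  rw [TensorProduct.map_map]
  by_cases hr : r = p
  · have hs : s ≠ q := fun hs => h (by rw [hr, hs])
    rw [hz hs, TensorProduct.map_zero_right, LinearMap.zero_apply]
  · rw [hz hr, TensorProduct.map_zero_left, LinearMap.zero_apply]

theorem mem_range_tensorIncl (hP : IsGrading 𝒜 P) {p q : G} {x : A ⊗[ℂ] A}
    (h : ∀ r s, (r, s) ≠ (p, q) → tensorProj P r s x = 0) :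
    x ∈ LinearMap.range (tensorIncl 𝒜 p q) := by
  refine ⟨tensorProj P p q x, ?_⟩
  refine (hP.jointlyInjective.tensor hP.jointlyInjective).eq_of_forall fun ⟨r, s⟩ => ?_
  change tensorProj P r s _ = tensorProj P r s x
  by_cases hrs : (r, s) = (p, q)
  · obtain ⟨rfl, rfl⟩ := Prod.mk.injEq .. ▸ hrs
    rw [hP.tensorProj_self]
  · rw [hP.tensorProj_of_ne hrs, h r s hrs]

end IsGrading

theorem span_incl_tmul (p q : G) :
    Submodule.span ℂ {m | ∃ a ∈ 𝒜 p, ∃ b ∈ 𝒜 q, m = incl (a ⊗ₜ[ℂ] b)} =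
      (LinearMap.range (tensorIncl 𝒜 p q)).map
        ((inclHom : A ⊗[ℂ] A →ₙₐ[ℂ] Multiplier (A ⊗[ℂ] A)) :
          A ⊗[ℂ] A →ₗ[ℂ] Multiplier (A ⊗[ℂ] A)) := by
  apply le_antisymm
  · refine Submodule.span_le.2 ?_
    rintro _ ⟨a, ha, b, hb, rfl⟩
    exact ⟨a ⊗ₜ b, ⟨(⟨a, ha⟩ : 𝒜 p) ⊗ₜ (⟨b, hb⟩ : 𝒜 q), rfl⟩, rfl⟩
  · rintro _ ⟨_, ⟨z, rfl⟩, rfl⟩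
    induction z with
    | zero => simp
    | add x y hx hy => rw [map_add, map_add]; exact Submodule.add_mem _ hx hy
    | tmul a b => exact Submodule.subset_span ⟨a, a.2, b, b.2, rfl⟩

variable {Δ : A →ₙₐ[ℂ] Multiplier (A ⊗[ℂ] A)} {T₁ T₂ T₁' T₂' : A ⊗[ℂ] A ≃ₗ[ℂ] A ⊗[ℂ] A}

namespace IsWeakCograding

theorem T₁_mem_range (hg : IsWeakCograding Δ 𝒜) (hT : GaloisMaps Δ T₁ T₂) {p q : G} {a b : A}
    (ha : a ∈ 𝒜 (p * q)) (hb : b ∈ 𝒜 q) :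
    T₁ (a ⊗ₜ b) ∈ LinearMap.range (tensorIncl 𝒜 p q) := by
  have h : Δ a * oneTmul A b ∈ Submodule.span ℂ
      {m | ∃ a ∈ 𝒜 (p * q), ∃ b ∈ 𝒜 q, m = Δ a * oneTmul A b} :=
    Submodule.subset_span ⟨a, ha, b, hb, rfl⟩
  rw [hg.comul_mul_oneTmul, span_incl_tmul] at h
  obtain ⟨x, hx, hx'⟩ := h
  rwa [hT.incl_inj ((hT.incl₁ a b).trans hx'.symm)]

theorem T₂_mem_range (hg : IsWeakCograding Δ 𝒜) (hT : GaloisMaps Δ T₁ T₂) {p q : G} {a b : A}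
    (ha : a ∈ 𝒜 p) (hb : b ∈ 𝒜 (p * q)) :
    T₂ (a ⊗ₜ b) ∈ LinearMap.range (tensorIncl 𝒜 p q) := by
  have h : tmulOne A a * Δ b ∈ Submodule.span ℂ
      {m | ∃ a ∈ 𝒜 p, ∃ b ∈ 𝒜 (p * q), m = tmulOne A a * Δ b} :=
    Submodule.subset_span ⟨a, ha, b, hb, rfl⟩
  rw [hg.tmulOne_mul_comul, span_incl_tmul] at h
  obtain ⟨x, hx, hx'⟩ := h
  rwa [hT.incl_inj ((hT.incl₂ a b).trans hx'.symm)]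

/-- `T₁⁻¹` maps `A_p ⊗ A_q` into `A_{pq} ⊗ A_q`. -/
theorem exists_T₁_eq (hg : IsWeakCograding Δ 𝒜) (hT : GaloisMaps Δ T₁ T₂) {p q : G}
    (a : 𝒜 p) (b : 𝒜 q) :
    ∃ z : 𝒜 (p * q) ⊗[ℂ] 𝒜 q, T₁ (tensorIncl 𝒜 (p * q) q z) = (a : A) ⊗ₜ (b : A) := by
  have h : incl ((a : A) ⊗ₜ[ℂ] (b : A)) ∈ Submodule.span ℂ
      {m | ∃ a ∈ 𝒜 p, ∃ b ∈ 𝒜 q, m = incl (a ⊗ₜ[ℂ] b)} :=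
    Submodule.subset_span ⟨a, a.2, b, b.2, rfl⟩
  rw [← hg.comul_mul_oneTmul] at h
  have hle : Submodule.span ℂ {m | ∃ a ∈ 𝒜 (p * q), ∃ b ∈ 𝒜 q, m = Δ a * oneTmul A b} ≤
      ((LinearMap.range (tensorIncl 𝒜 (p * q) q)).map T₁.toLinearMap).map
        ((inclHom : A ⊗[ℂ] A →ₙₐ[ℂ] Multiplier (A ⊗[ℂ] A)) :
          A ⊗[ℂ] A →ₗ[ℂ] Multiplier (A ⊗[ℂ] A)) := by
    refine Submodule.span_le.2 ?_
    rintro _ ⟨a, ha, b, hb, rfl⟩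
    exact ⟨_, ⟨a ⊗ₜ b, ⟨(⟨a, ha⟩ : 𝒜 (p * q)) ⊗ₜ (⟨b, hb⟩ : 𝒜 q), rfl⟩, rfl⟩, hT.incl₁ a b⟩
  obtain ⟨_, ⟨_, ⟨z, rfl⟩, rfl⟩, hx⟩ := hle h
  exact ⟨z, hT.incl_inj hx⟩

/-- `T₁` maps `A_g ⊗ A_h` into `A_{gh⁻¹} ⊗ A_h`, so only the component with `s = h` and `rs = g`
survives. -/
theorem tensorProj_T₁ (hg : IsWeakCograding Δ 𝒜) (hT : GaloisMaps Δ T₁ T₂) (hP : IsGrading 𝒜 P)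
    {g h r s : G} (a : 𝒜 g) (b : 𝒜 h) (hrs : s = h → r * s ≠ g) :
    tensorProj P r s (T₁ ((a : A) ⊗ₜ (b : A))) = 0 := by
  obtain ⟨x, hx⟩ := hg.T₁_mem_range hT (p := g * h⁻¹) (q := h) (a := a) (b := b)
    (by rw [inv_mul_cancel_right]; exact a.2) b.2
  rw [← hx]
  refine hP.tensorProj_of_ne (fun e => ?_) x
  obtain ⟨rfl, rfl⟩ := Prod.mk.injEq .. ▸ e
  exact hrs rfl (by rw [inv_mul_cancel_right])

theorem tensorProj_T₂ (hg : IsWeakCograding Δ 𝒜) (hT : GaloisMaps Δ T₁ T₂) (hP : IsGrading 𝒜 P)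
    {g h r s : G} (a : 𝒜 h) (b : 𝒜 g) (hrs : r = h → r * s ≠ g) :
    tensorProj P r s (T₂ ((a : A) ⊗ₜ (b : A))) = 0 := by
  obtain ⟨x, hx⟩ := hg.T₂_mem_range hT (p := h) (q := h⁻¹ * g) (a := a) (b := b) a.2
    (by rw [mul_inv_cancel_left]; exact b.2)
  rw [← hx]
  refine hP.tensorProj_of_ne (fun e => ?_) x
  obtain ⟨rfl, rfl⟩ := Prod.mk.injEq .. ▸ e
  exact hrs rfl (by rw [mul_inv_cancel_left])

/-- `Δ(a)(b ⊗ 1) ∈ A_p ⊗ A_q` for `a ∈ A_{pq}` and `b ∈ A_p`. -/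
theorem T₃_mem_range (hg : IsWeakCograding Δ 𝒜) (hT : GaloisMaps Δ T₁ T₂)
    (hT' : GaloisMaps (Multiplier.flip.comp Δ) T₁' T₂') (hP : IsGrading 𝒜 P) {p q : G}
    (a : 𝒜 (p * q)) (b : 𝒜 p) :
    swap A (T₁' ((a : A) ⊗ₜ (b : A))) ∈ LinearMap.range (tensorIncl 𝒜 p q) := by
  -- The cograding axioms do not mention `Δ(a)(b ⊗ 1)`. Covering the second leg by `d ∈ A_s` gives
  -- `Δ(a)(1 ⊗ d)(b ⊗ 1)`, whose `(r, s)` component needs `r = p` because of `b` and `rs = pq`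
  -- because of `a`. Non-degeneracy of `A_s` removes `d`.
  refine hP.mem_range_tensorIncl fun r s hrs => ?_
  refine ((hP.nondegenerate hT.nondegenerate s).jointlyInjective_mulRight.lTensor (𝒜 r)) _
    fun d => ?_
  have rel : map LinearMap.id (LinearMap.mulRight ℂ (d : A)) (swap A (T₁' ((a : A) ⊗ₜ (b : A)))) =
      map (LinearMap.mulRight ℂ (b : A)) LinearMap.id (T₁ ((a : A) ⊗ₜ (d : A))) :=
    hT.incl_inj <| by
      rw [incl_map_id_mulRight, incl_map_mulRight_id, hT.incl₁, hT'.incl₃_of_flip, mul_assoc,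
        mul_assoc, oneTmul_comm_tmulOne]
  have e₁ : P s ∘ₗ LinearMap.mulRight ℂ (d : A) = LinearMap.mulRight ℂ d ∘ₗ P s :=
    LinearMap.ext fun x => hP.proj_mul_coe s x d
  have e₂ : P r ∘ₗ LinearMap.mulRight ℂ (b : A) = LinearMap.mulRight ℂ (P r b) ∘ₗ P r :=
    LinearMap.ext fun x => hP.proj_mul r x b
  calc _ = tensorProj P r s (map LinearMap.id (LinearMap.mulRight ℂ (d : A))
          (swap A (T₁' ((a : A) ⊗ₜ (b : A))))) := by
        rw [TensorProduct.map_map, TensorProduct.map_map, e₁]; rfl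
    _ = map (LinearMap.mulRight ℂ (P r b)) LinearMap.id
          (tensorProj P r s (T₁ ((a : A) ⊗ₜ (d : A)))) := by
        rw [rel, TensorProduct.map_map, TensorProduct.map_map, e₂]; rfl
    _ = 0 := by
        by_cases hr : r = p
        · rw [hg.tensorProj_T₁ hT hP a d, map_zero]
          rintro - e
          rw [hr] at e
          exact hrs (by rw [hr, mul_left_cancel e])
        · rw [hP.proj_of_ne p r b hr, LinearMap.mulRight_zero_eq_zero,
            TensorProduct.map_zero_left, LinearMap.zero_apply]

/-- `(1 ⊗ b)Δ(a) ∈ A_p ⊗ A_q` for `a ∈ A_{pq}` and `b ∈ A_q`. -/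
theorem T₄_mem_range (hg : IsWeakCograding Δ 𝒜) (hT : GaloisMaps Δ T₁ T₂)
    (hT' : GaloisMaps (Multiplier.flip.comp Δ) T₁' T₂') (hP : IsGrading 𝒜 P) {p q : G}
    (a : 𝒜 (p * q)) (b : 𝒜 q) :
    swap A (T₂' ((b : A) ⊗ₜ (a : A))) ∈ LinearMap.range (tensorIncl 𝒜 p q) := by
  refine hP.mem_range_tensorIncl fun r s hrs => ?_
  refine ((hP.nondegenerate hT.nondegenerate r).jointlyInjective_mulLeft.rTensor (𝒜 s)) _
    fun d => ?_
  have rel : map (LinearMap.mulLeft ℂ (d : A)) LinearMap.id (swap A (T₂' ((b : A) ⊗ₜ (a : A)))) =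
      map LinearMap.id (LinearMap.mulLeft ℂ (b : A)) (T₂ ((d : A) ⊗ₜ (a : A))) :=
    hT.incl_inj <| by
      rw [incl_map_id_mulLeft, incl_map_mulLeft_id, hT.incl₂, hT'.incl₄_of_flip, ← mul_assoc,
        ← mul_assoc, oneTmul_comm_tmulOne]
  have e₁ : P r ∘ₗ LinearMap.mulLeft ℂ (d : A) = LinearMap.mulLeft ℂ d ∘ₗ P r :=
    LinearMap.ext fun x => by
      simp only [LinearMap.comp_apply, LinearMap.mulLeft_apply]
      rw [hP.proj_mul, hP.proj_self]
  have e₂ : P s ∘ₗ LinearMap.mulLeft ℂ (b : A) = LinearMap.mulLeft ℂ (P s b) ∘ₗ P s :=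
    LinearMap.ext fun x => hP.proj_mul s b x
  calc _ = tensorProj P r s (map (LinearMap.mulLeft ℂ (d : A)) LinearMap.id
          (swap A (T₂' ((b : A) ⊗ₜ (a : A))))) := by
        rw [TensorProduct.map_map, TensorProduct.map_map, e₁]; rfl
    _ = map LinearMap.id (LinearMap.mulLeft ℂ (P s b))
          (tensorProj P r s (T₂ ((d : A) ⊗ₜ (a : A)))) := by
        rw [rel, TensorProduct.map_map, TensorProduct.map_map, e₂]; rfl
    _ = 0 := by
        by_cases hs : s = q
        · rw [hg.tensorProj_T₂ hT hP d a, map_zero]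
          rintro - e
          rw [hs] at e
          exact hrs (by rw [hs, mul_right_cancel e])
        · rw [hP.proj_of_ne q s b hs, LinearMap.mulLeft_zero_eq_zero,
            TensorProduct.map_zero_right, LinearMap.zero_apply]

/-- The restriction of the comultiplication to the components. -/
theorem exists_restriction (hg : IsWeakCograding Δ 𝒜) (hT : GaloisMaps Δ T₁ T₂) :
    ∃ c : ∀ p q, 𝒜 (p * q) →ₙₐ[ℂ] Multiplier (𝒜 p ⊗[ℂ] 𝒜 q),
      ∀ p q (a : 𝒜 (p * q)), HasRestriction (Δ a) (c p q a) := by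
  have hex : ∀ p q (a : 𝒜 (p * q)),
      ∃ n : Multiplier (𝒜 p ⊗[ℂ] 𝒜 q), HasRestriction (Δ a) n := by
    intro p q a
    refine HasRestriction.exists_of_mem_range (fun x => ?_) (fun x => ?_)
    · induction x with
      | zero => simp
      | add x y hx hy => rw [map_add, map_add]; exact Submodule.add_mem _ hx hy
      | tmul u v =>
        -- `Δ(a)(u ⊗ v)` is `Δ(a)(1 ⊗ v)` times `u ⊗ 1`, and both factors respect the components.
        obtain ⟨y, hy⟩ := hg.T₁_mem_range hT a.2 v.2
        refine ⟨map (LinearMap.mulRight ℂ u) LinearMap.id y, ?_⟩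
        rw [TensorProduct.map_tmul, subalgebraIncl_apply, subalgebraIncl_apply, hT.left_tmul_eq,
          ← hy, TensorProduct.map_map, TensorProduct.map_map]
        rfl
    · induction x with
      | zero => simp
      | add x y hx hy => rw [map_add, map_add]; exact Submodule.add_mem _ hx hy
      | tmul u v =>
        obtain ⟨y, hy⟩ := hg.T₂_mem_range hT u.2 a.2
        refine ⟨map LinearMap.id (LinearMap.mulLeft ℂ v) y, ?_⟩
        rw [TensorProduct.map_tmul, subalgebraIncl_apply, subalgebraIncl_apply, hT.right_tmul_eq,
          ← hy, TensorProduct.map_map, TensorProduct.map_map]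
        rfl
  choose c hc using hex
  refine ⟨fun p q =>
    { toFun := c p q
      map_smul' := fun z a => ?_
      map_zero' := ?_
      map_add' := fun a b => ?_
      map_mul' := fun a b => ?_ }, hc⟩
  · refine (hc p q (z • a)).unique ?_
    have := (hc p q a).smul z
    rwa [← map_smul] at this
  · refine (hc p q 0).unique ?_
    have := HasRestriction.zero (𝒜 := 𝒜) (p := p) (q := q)
    rwa [← map_zero Δ] at this
  · refine (hc p q (a + b)).unique ?_
    have := (hc p q a).add (hc p q b)
    rwa [← map_add] at this
  · refine (hc p q (a * b)).unique ?_
    have := (hc p q a).mul (hc p q b)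
    rwa [← map_mul] at this

end IsWeakCograding

end Graded

/-! ### The Hopf family of a cograded regular multiplier Hopf algebra -/

section Graded

open TensorProduct (map lift)

variable {G : Type*} [Group G]
variable {A : Type*} [NonUnitalRing A] [Module ℂ A] [IsScalarTower ℂ A A] [SMulCommClass ℂ A A]
  {𝒜 : G → NonUnitalSubalgebra ℂ A} {P : ∀ p, A →ₗ[ℂ] 𝒜 p}

theorem HasRestriction.exists_incl_eq {p q : G} {m : Multiplier (A ⊗[ℂ] A)}
    {n : Multiplier (𝒜 p ⊗[ℂ] 𝒜 q)} (h : HasRestriction m n) {y : A ⊗[ℂ] A}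
    (hy : Multiplier.incl y = m) (hy' : y ∈ LinearMap.range (tensorIncl 𝒜 p q)) :
    ∃ x, tensorIncl 𝒜 p q x = y ∧ Multiplier.incl x = n := by
  obtain ⟨x, hx⟩ := hy'
  exact ⟨x, hx, (HasRestriction.incl hx).unique (hy ▸ h)⟩

/-- A bijection of `A` which maps every `A_p` into `A_{p⁻¹}` restricts to bijections. -/
theorem IsGrading.exists_restrict_equiv (hP : IsGrading 𝒜 P) (S : A ≃ₗ[ℂ] A)
    (hS : ∀ p (a : 𝒜 p), S a ∈ 𝒜 p⁻¹) :
    ∃ S' : ∀ p, 𝒜 p ≃ₗ[ℂ] 𝒜 p⁻¹, ∀ p (a : 𝒜 p), (S' p a : A) = S a := by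
  have hcoe : ∀ p (a : 𝒜 p), (P p⁻¹ (S a) : A) = S a := fun p a =>
    congrArg Subtype.val (hP.proj_self p⁻¹ ⟨S a, hS p a⟩)
  -- Since `S` permutes the components by inversion, it intertwines the projections. Hence the
  -- projection of `S⁻¹(b)` is a preimage of `b ∈ A_{p⁻¹}` in `A_p`.
  have hproj : ∀ p x, P p⁻¹ (S x) = P p⁻¹ (S (P p x)) := by
    intro p x
    have : P p⁻¹ ∘ₗ S.toLinearMap = P p⁻¹ ∘ₗ S.toLinearMap ∘ₗ subalgebraIncl (𝒜 p) ∘ₗ P p := by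
      refine hP.hom_ext fun q a => ?_
      simp only [LinearMap.comp_apply, LinearEquiv.coe_coe, subalgebraIncl_apply]
      by_cases hq : p = q
      · subst hq; rw [hP.proj_self]
      · rw [hP.proj_of_ne q p a hq, ZeroMemClass.coe_zero, map_zero, map_zero]
        exact hP.proj_of_ne q⁻¹ p⁻¹ ⟨S a, hS q a⟩ (fun e => hq (inv_injective e))
    exact LinearMap.congr_fun this x
  refine ⟨fun p => LinearEquiv.ofBijective (P p⁻¹ ∘ₗ S.toLinearMap ∘ₗ subalgebraIncl (𝒜 p))
    ⟨fun a b hab => ?_, fun b => ?_⟩, hcoe⟩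
  · have := congrArg (Subtype.val (p := fun x => x ∈ 𝒜 p⁻¹)) hab
    exact Subtype.ext (S.injective ((hcoe p a).symm.trans (this.trans (hcoe p b))))
  · refine ⟨P p (S.symm b), ?_⟩
    exact (hproj p _).symm.trans (by rw [LinearEquiv.apply_symm_apply, hP.proj_self])

variable {Δ : A →ₙₐ[ℂ] Multiplier (A ⊗[ℂ] A)} {T₁ T₂ T₁' T₂' : A ⊗[ℂ] A ≃ₗ[ℂ] A ⊗[ℂ] A}
  {ε : A →ₙₐ[ℂ] ℂ}

/-- `Δ(a)(1 ⊗ b)`, computed in `A ⊗ A` and in `A_p ⊗ A_q`. -/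
theorem IsWeakCograding.exists_incl₁ (hg : IsWeakCograding Δ 𝒜) (hT : GaloisMaps Δ T₁ T₂) {p q : G}
    {a : 𝒜 (p * q)} {n : Multiplier (𝒜 p ⊗[ℂ] 𝒜 q)} (hn : HasRestriction (Δ a) n) (b : 𝒜 q) :
    ∃ x, tensorIncl 𝒜 p q x = T₁ ((a : A) ⊗ₜ (b : A)) ∧ incl x = n * oneTmul (𝒜 p) b :=
  (hn.mul (.oneTmul b)).exists_incl_eq (hT.incl₁ _ _) (hg.T₁_mem_range hT a.2 b.2)

theorem IsWeakCograding.exists_incl₂ (hg : IsWeakCograding Δ 𝒜) (hT : GaloisMaps Δ T₁ T₂) {p q : G}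
    {a : 𝒜 (p * q)} {n : Multiplier (𝒜 p ⊗[ℂ] 𝒜 q)} (hn : HasRestriction (Δ a) n) (b : 𝒜 p) :
    ∃ x, tensorIncl 𝒜 p q x = T₂ ((b : A) ⊗ₜ (a : A)) ∧ incl x = tmulOne (𝒜 q) b * n :=
  (HasRestriction.mul (.tmulOne b) hn).exists_incl_eq (hT.incl₂ _ _)
    (hg.T₂_mem_range hT b.2 a.2)

theorem IsWeakCograding.tensorIncl_eq_T₁ (hg : IsWeakCograding Δ 𝒜) (hT : GaloisMaps Δ T₁ T₂)
    (hP : IsGrading 𝒜 P) {p q : G} {a : 𝒜 (p * q)} {n : Multiplier (𝒜 p ⊗[ℂ] 𝒜 q)}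
    (hn : HasRestriction (Δ a) n) {b : 𝒜 q} {x : 𝒜 p ⊗[ℂ] 𝒜 q}
    (hx : incl x = n * oneTmul (𝒜 p) b) :
    tensorIncl 𝒜 p q x = T₁ ((a : A) ⊗ₜ (b : A)) := by
  obtain ⟨y, hy, hy'⟩ := hg.exists_incl₁ hT hn b
  rw [← hy, incl_injective ((hP.nondegenerate hT.nondegenerate p).tensor
    (hP.nondegenerate hT.nondegenerate q)) (hx.trans hy'.symm)]

theorem IsWeakCograding.tensorIncl_eq_T₂ (hg : IsWeakCograding Δ 𝒜) (hT : GaloisMaps Δ T₁ T₂)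
    (hP : IsGrading 𝒜 P) {p q : G} {a : 𝒜 (p * q)} {n : Multiplier (𝒜 p ⊗[ℂ] 𝒜 q)}
    (hn : HasRestriction (Δ a) n) {b : 𝒜 p} {x : 𝒜 p ⊗[ℂ] 𝒜 q}
    (hx : incl x = tmulOne (𝒜 q) b * n) :
    tensorIncl 𝒜 p q x = T₂ ((b : A) ⊗ₜ (a : A)) := by
  obtain ⟨y, hy, hy'⟩ := hg.exists_incl₂ hT hn b
  rw [← hy, incl_injective ((hP.nondegenerate hT.nondegenerate p).tensor
    (hP.nondegenerate hT.nondegenerate q)) (hx.trans hy'.symm)]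

/-- The restrictions of the comultiplication to the components are coassociative. -/
theorem IsWeakCograding.coassoc_restriction (hg : IsWeakCograding Δ 𝒜) (hT : GaloisMaps Δ T₁ T₂)
    (hP : IsGrading 𝒜 P) {Δ' : ∀ p q, 𝒜 (p * q) →ₙₐ[ℂ] Multiplier (𝒜 p ⊗[ℂ] 𝒜 q)}
    (hΔ' : ∀ p q (a : 𝒜 (p * q)), HasRestriction (Δ a) (Δ' p q a)) (p q r : G)
    (a : 𝒜 (p * q * r)) (b : 𝒜 r) (c : 𝒜 p) (x : 𝒜 (p * q) ⊗[ℂ] 𝒜 r) (y : 𝒜 p ⊗[ℂ] 𝒜 (q * r))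
    (hx : incl x = Δ' (p * q) r a * oneTmul (𝒜 (p * q)) b)
    (hy : incl y = tmulOne (𝒜 (q * r)) c *
      Δ' p (q * r) (castTo (A := fun p => 𝒜 p) (mul_assoc p q r) a)) :
    Multiplier.assoc (𝒜 p) (𝒜 q) (𝒜 r)
        (tmul (tmulOne (𝒜 q) c) 1 * comulTensorId (Δ' p q) x) =
      idTensorComul (Δ' q r) y * tmul 1 (oneTmul (𝒜 q) b) := by
  have hn := hP.nondegenerate hT.nondegenerate
  obtain ⟨t₁, ht₁⟩ := exists_comul_mul_oneTmul (hn q) (hn r) (Δ' q r) fun a b =>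
    (hg.exists_incl₁ hT (hΔ' q r a) b).imp fun _ h => h.2
  obtain ⟨t₂, ht₂⟩ := exists_tmulOne_mul_comul (hn p) (hn q) (Δ' p q) fun a b =>
    (hg.exists_incl₂ hT (hΔ' p q a) b).imp fun _ h => h.2
  rw [assoc_tmulOne_mul_comulTensorId (Δ' p q) t₂ ht₂, idTensorComul_mul_oneTmul (Δ' q r) t₁ ht₁]
  congr 1
  -- The identity is tested in `A ⊗ A ⊗ A`, where it is the coassociativity of `Δ`.
  refine TensorProduct.map_injective_of_flat_flat (subalgebraIncl (𝒜 p)) (tensorIncl 𝒜 q r)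
    (subalgebraIncl_injective _) (tensorIncl_injective q r) ?_
  have e₁ : tensorIncl 𝒜 p q ∘ₗ t₂.flip c =
      (T₂.toLinearMap ∘ₗ TensorProduct.mk ℂ A A c) ∘ₗ subalgebraIncl (𝒜 (p * q)) :=
    LinearMap.ext fun a => hg.tensorIncl_eq_T₂ hT hP (hΔ' p q a) (ht₂ a c)
  have e₂ : tensorIncl 𝒜 q r ∘ₗ t₁.flip b =
      (T₁.toLinearMap ∘ₗ (TensorProduct.mk ℂ A A).flip b) ∘ₗ subalgebraIncl (𝒜 (q * r)) :=
    LinearMap.ext fun a => hg.tensorIncl_eq_T₁ hT hP (hΔ' q r a) (ht₁ a b)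
  calc map (subalgebraIncl (𝒜 p)) (tensorIncl 𝒜 q r)
        (TensorProduct.assoc ℂ _ _ _ (map (t₂.flip c) LinearMap.id x))
      = TensorProduct.assoc ℂ A A A (map (tensorIncl 𝒜 p q) (subalgebraIncl (𝒜 r))
          (map (t₂.flip c) LinearMap.id x)) :=
        TensorProduct.map_map_assoc ..
    _ = TensorProduct.assoc ℂ A A A (map (T₂.toLinearMap ∘ₗ TensorProduct.mk ℂ A A c) LinearMap.id
          (tensorIncl 𝒜 (p * q) r x)) := by
        rw [TensorProduct.map_map, TensorProduct.map_map, e₁]; rfl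
    _ = map LinearMap.id (T₁.toLinearMap ∘ₗ (TensorProduct.mk ℂ A A).flip b)
          (tensorIncl 𝒜 p (q * r) y) := by
        rw [hg.tensorIncl_eq_T₁ hT hP (hΔ' _ _ a) hx, hT.coassoc,
          hg.tensorIncl_eq_T₂ hT hP (hΔ' _ _ _) hy, coe_castTo]
    _ = map (subalgebraIncl (𝒜 p)) (tensorIncl 𝒜 q r) (map LinearMap.id (t₁.flip b) y) := by
        rw [TensorProduct.map_map, TensorProduct.map_map, e₂]; rfl

namespace IsCograding

/-- For `0 ≠ v ∈ A_e`, the element `T₁⁻¹(a ⊗ v)` lies in `A_p ⊗ A_e`, where the product vanishes as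
`p ≠ e`; but its product is `ε(a)v`. Here `A_e ≠ 0` is essential. -/
theorem counit_eq_zero (hg : IsCograding Δ 𝒜) (hT : CounitalGaloisMaps Δ T₁ T₂ ε) {p : G}
    (hp : p ≠ 1) (a : 𝒜 p) : ε a = 0 := by
  have := hg.nontrivial 1
  obtain ⟨v, hv⟩ := exists_ne (0 : 𝒜 1)
  obtain ⟨z, hz⟩ := hg.exists_T₁_eq hT.toGaloisMaps a v
  have hmul : LinearMap.mul' ℂ A ∘ₗ tensorIncl 𝒜 (p * 1) 1 = 0 := TensorProduct.ext' fun u w =>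
    hg.mul_eq_zero (p * 1) 1 (by rwa [mul_one]) u u.2 w w.2
  have h := hT.counit_left (tensorIncl 𝒜 (p * 1) 1 z)
  rw [hz, ← LinearMap.comp_apply, hmul] at h
  have h' : ε a • (v : A) = 0 := by simpa using h
  exact (smul_eq_zero.1 h').resolve_right fun e => hv (Subtype.ext e)

/-- `S(A_p) ⊆ A_{p⁻¹}`. -/
theorem antipode_mem (hg : IsCograding Δ 𝒜) (hT : CounitalGaloisMaps Δ T₁ T₂ ε)
    (hP : IsGrading 𝒜 P) {S : A →ₗ[ℂ] A} (hS : ∀ a, incl (S a) = hT.antipode a) (p : G)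
    (a : 𝒜 p) : S a ∈ 𝒜 p⁻¹ := by
  have hz : ∀ q, q ≠ p⁻¹ → P q (S a) = 0 := by
    -- For `b ∈ A_q`, `S(a)b = (ε ⊗ ι)T₁⁻¹(a ⊗ b)` with `T₁⁻¹(a ⊗ b) ∈ A_{pq} ⊗ A_q`, and `ε`
    -- vanishes on `A_{pq}` unless `q = p⁻¹`.
    refine fun q hq => (hP.nondegenerate hT.nondegenerate q).1 _ fun b => ?_
    rw [← hP.proj_mul_coe, ← hT.antipodeMul_tmul hS]
    obtain ⟨z, hz⟩ := hg.exists_T₁_eq hT.toGaloisMaps a b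
    have hε : (ε : A →ₗ[ℂ] ℂ) ∘ₗ subalgebraIncl (𝒜 (p * q)) = 0 := LinearMap.ext fun u =>
      hg.counit_eq_zero hT (fun e => hq (eq_inv_of_mul_eq_one_right e)) u
    rw [← hz, CounitalGaloisMaps.antipodeMul_T₁, TensorProduct.map_map, hε,
      TensorProduct.map_zero_left, LinearMap.zero_apply, map_zero, map_zero]
  rw [hP.eq_coe_proj hz]
  exact (P p⁻¹ (S a)).2

/-- The components of a cograded regular multiplier Hopf algebra form a Hopf family. -/
theorem exists_isRestriction (hg : IsCograding Δ 𝒜) (h : IsRegularMultiplierHopf Δ) :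
    ∃ (ε : A →ₙₐ[ℂ] ℂ) (S : A →ₗ[ℂ] Multiplier A), IsCounit Δ ε ∧ IsAntipode Δ ε S ∧
      ∃ D : HopfFamily fun p => 𝒜 p, D.IsRestriction Δ ε S := by
  have : Nontrivial A :=
    have := hg.nontrivial 1
    (subalgebraIncl_injective (𝒜 1)).nontrivial
  obtain ⟨T₁, T₂, ε, hT, S, hS⟩ := h.exists_antipode
  -- The bijections of `Δᵒᵖ` supply `Δ(a)(b ⊗ 1)` and `(1 ⊗ b)Δ(a)`, needed for the last two
  -- inclusions in (i).
  obtain ⟨T₁', T₂', hT'⟩ := h.2.exists_galoisMaps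
  obtain ⟨P, hP⟩ := hg.exists_isGrading
  obtain ⟨Δ', hΔ'⟩ := hg.exists_restriction hT.toGaloisMaps
  obtain ⟨S', hS'⟩ := hP.exists_restrict_equiv S (hg.antipode_mem hT hP (S := S.toLinearMap) hS)
  have hn := hP.nondegenerate hT.nondegenerate
  let ε' : 𝒜 1 →ₙₐ[ℂ] ℂ := ε.comp (NonUnitalSubalgebraClass.subtype (𝒜 1))
  have hε' : (ε' : 𝒜 1 →ₗ[ℂ] ℂ) = (ε : A →ₗ[ℂ] ℂ) ∘ₗ subalgebraIncl (𝒜 1) := rfl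
  have hS'' : ∀ p, subalgebraIncl (𝒜 p) ∘ₗ
      ((S' p⁻¹).trans (castTo (A := fun p => 𝒜 p) (inv_inv p))).toLinearMap =
        S.toLinearMap ∘ₗ subalgebraIncl (𝒜 p⁻¹) := fun p =>
    LinearMap.ext fun a => (coe_castTo (inv_inv p) _).trans (hS' p⁻¹ a)
  have hmul : ∀ p (x : 𝒜 p ⊗[ℂ] 𝒜 p), subalgebraIncl (𝒜 p) (LinearMap.mul' ℂ (𝒜 p) x) =
      LinearMap.mul' ℂ A (tensorIncl 𝒜 p p x) := fun p x =>
    LinearMap.congr_fun (f := subalgebraIncl (𝒜 p) ∘ₗ LinearMap.mul' ℂ (𝒜 p))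
      (g := LinearMap.mul' ℂ A ∘ₗ tensorIncl 𝒜 p p) (TensorProduct.ext' fun _ _ => rfl) x
  refine ⟨ε, hT.antipode, hT.isCounit, hT.isAntipode,
    { nondegenerate := hn
      comul := Δ'
      comul_mul_oneTmul := fun p q a b =>
        (hg.exists_incl₁ hT.toGaloisMaps (hΔ' p q a) b).imp fun _ h => h.2
      tmulOne_mul_comul := fun p q a b =>
        (hg.exists_incl₂ hT.toGaloisMaps (hΔ' p q a) b).imp fun _ h => h.2
      oneTmul_mul_comul := fun p q a b =>
        ((HasRestriction.mul (.oneTmul b) (hΔ' p q a)).exists_incl_eq (hT'.incl₄_of_flip _ _)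
          (hg.T₄_mem_range hT.toGaloisMaps hT' hP a b)).imp fun _ h => h.2
      comul_mul_tmulOne := fun p q a b =>
        (((hΔ' p q a).mul (.tmulOne b)).exists_incl_eq (hT'.incl₃_of_flip _ _)
          (hg.T₃_mem_range hT.toGaloisMaps hT' hP a b)).imp fun _ h => h.2
      coassoc := hg.coassoc_restriction hT.toGaloisMaps hP hΔ'
      counit := ε'
      counit_right := fun p a b x hx => ?_
      counit_left := fun p a b x hx => ?_
      antipode := S'
      antipode_mul := fun p a b => ?_
      antipode_left := fun p a b x hx => ?_
      antipode_right := fun p a b x hx => ?_ },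
    { comul_left := fun p q a x => (hΔ' p q a x).1
      comul_right := fun p q a x => (hΔ' p q a x).2
      counit := fun a => rfl
      antipode := fun p a => (congrArg incl (hS' p a)).trans (hS a) }⟩
  · have hx' := hg.tensorIncl_eq_T₂ hT.toGaloisMaps hP (hΔ' _ _ _) hx
    rw [coe_castTo] at hx'
    refine Subtype.ext ?_
    have key : (TensorProduct.rid ℂ A).toLinearMap ∘ₗ map LinearMap.id (ε : A →ₗ[ℂ] ℂ) ∘ₗ
        tensorIncl 𝒜 p 1 = subalgebraIncl (𝒜 p) ∘ₗ (TensorProduct.rid ℂ (𝒜 p)).toLinearMap ∘ₗ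
          map LinearMap.id (ε' : 𝒜 1 →ₗ[ℂ] ℂ) := TensorProduct.ext' fun u v => by simp; rfl
    refine (LinearMap.congr_fun key x).symm.trans ?_
    simp only [LinearMap.comp_apply, hx', LinearEquiv.coe_coe]
    rw [hT.counit_right, LinearMap.mul'_apply]; rfl
  · have hx' := hg.tensorIncl_eq_T₁ hT.toGaloisMaps hP (hΔ' _ _ _) hx
    rw [coe_castTo] at hx'
    refine Subtype.ext ?_
    have key : (TensorProduct.lid ℂ A).toLinearMap ∘ₗ map (ε : A →ₗ[ℂ] ℂ) LinearMap.id ∘ₗ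
        tensorIncl 𝒜 1 p = subalgebraIncl (𝒜 p) ∘ₗ (TensorProduct.lid ℂ (𝒜 p)).toLinearMap ∘ₗ
          map (ε' : 𝒜 1 →ₗ[ℂ] ℂ) LinearMap.id := TensorProduct.ext' fun u v => by simp; rfl
    refine (LinearMap.congr_fun key x).symm.trans ?_
    simp only [LinearMap.comp_apply, hx', LinearEquiv.coe_coe]
    rw [hT.counit_left, LinearMap.mul'_apply]; rfl
  · refine Subtype.ext ?_
    rw [hS', NonUnitalSubalgebra.coe_mul, NonUnitalSubalgebra.coe_mul, hS', hS']
    exact hT.antipode_map_mul (S := S.toLinearMap) hS a b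
  · have hx' := hg.tensorIncl_eq_T₁ hT.toGaloisMaps hP (hΔ' _ _ _) hx
    rw [coe_castTo] at hx'
    refine subalgebraIncl_injective (𝒜 p) ?_
    calc _ = LinearMap.mul' ℂ A (map S.toLinearMap LinearMap.id (tensorIncl 𝒜 p⁻¹ p x)) := by
          rw [hmul, TensorProduct.map_map, TensorProduct.map_map, hS'']; rfl
      _ = _ := by
          rw [hx', ← LinearMap.comp_apply, ← hT.antipodeMul_eq (S := S.toLinearMap) hS,
            CounitalGaloisMaps.antipodeMul_T₁]
          simp; rfl
  · have hx' := hg.tensorIncl_eq_T₂ hT.toGaloisMaps hP (hΔ' _ _ _) hx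
    rw [coe_castTo] at hx'
    refine subalgebraIncl_injective (𝒜 p) ?_
    calc _ = LinearMap.mul' ℂ A (map LinearMap.id S.toLinearMap (tensorIncl 𝒜 p p⁻¹ x)) := by
          rw [hmul, TensorProduct.map_map, TensorProduct.map_map, hS'']; rfl
      _ = _ := by
          rw [hx', ← LinearMap.comp_apply, ← hT.mulAntipode_eq (S := S.toLinearMap) hS,
            CounitalGaloisMaps.mulAntipode_T₂]
          simp; rfl

end IsCograding

end Graded

end CogradedMHA

/-! ### The main theorem -/

open CogradedMHA in
theorem theorem1p5 {G : Type*} [Group G] :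
    -- from the family to the direct sum
    (∀ (A : G → Type*) [∀ p, NonUnitalRing (A p)] [∀ p, Module ℂ (A p)]
        [∀ p, IsScalarTower ℂ (A p) (A p)] [∀ p, SMulCommClass ℂ (A p) (A p)]
        (D : HopfFamily A),
      (∃! Δ, D.IsDirectSumComul Δ) ∧
      ∀ Δ, D.IsDirectSumComul Δ →
        IsRegularMultiplierHopf Δ ∧
        IsWeakCograding Δ (directSumComponent A) ∧
        ((∀ p, Nontrivial (A p)) → IsCograding Δ (directSumComponent A))) ∧
    -- from a regular cograded multiplier Hopf algebra to the family of its components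
    (∀ (A : Type*) [NonUnitalRing A] [Module ℂ A] [IsScalarTower ℂ A A] [SMulCommClass ℂ A A]
        (Δ : A →ₙₐ[ℂ] Multiplier (A ⊗[ℂ] A)) (𝒜 : G → NonUnitalSubalgebra ℂ A),
      IsRegularMultiplierHopf Δ → IsCograding Δ 𝒜 →
        ∃ (ε : A →ₙₐ[ℂ] ℂ) (S : A →ₗ[ℂ] Multiplier A),
          IsCounit Δ ε ∧ IsAntipode Δ ε S ∧
          ∃ D : HopfFamily fun p => 𝒜 p, D.IsRestriction Δ ε S) ∧
    -- the case of unital components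
    (∀ (A : G → Type*) [∀ p, Ring (A p)] [∀ p, Algebra ℂ (A p)],
      (∀ T : HopfGroupCoalgebra A, ∃! D : HopfFamily A, T.SameData D) ∧
      (Nontrivial (A 1) → ∀ D : HopfFamily A, ∃! T : HopfGroupCoalgebra A, T.SameData D)) := by
  refine ⟨?_, ?_, ?_⟩
  · intro A _ _ _ _ D
    refine ⟨D.existsUnique_isDirectSumComul, fun Δ hΔ => ?_⟩
    obtain ⟨hr, hw⟩ := D.isRegular_and_isWeakCograding hΔ
    exact ⟨hr, hw, fun _ => ⟨hw, fun p => HopfFamily.nontrivial_directSumComponent p⟩⟩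
  · intro A _ _ _ _ Δ 𝒜 h hg
    exact hg.exists_isRestriction h
  · intro A _ _
    exact ⟨fun T => T.existsUnique_sameData, fun _ D => D.existsUnique_sameData⟩
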